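/- **Conventions.** Let $\mathbf k$ be a field of characteristic $0$ (for instance $\mathbb R$ or $\mathbb C$). For a $\mathbb Z$-graded vector space $V$ let $(sV)_p=V_{p+1}$ and let $T(sV)=\bigoplus_{n\ge 0}(sV)^{\otimes n}$ be the tensor coalgebra with deconcatenation, graded by the total degree. The Koszul sign rule is used throughout. A *curved $A_\infty$-structure* on $V$ is a degree $1$ coderivation $D$ of $T(sV)$ with $D^2=0$. A *graded inner product* is a symmetric non-degenerate bilinear form for which components of different degrees are orthogonal. A linear map is *partially isometric* if it restricts to an isometry on some complement of its kernel. Let $\mathbf J$ have as objects the triples $(V,\langle\cdot,\cdot\rangle,\mathfrak C)$, where $V$ is a graded vector space, $\langle\cdot,\cdot\rangle$ is a graded inner product on $T(sV)$ and $\mathfrak C$ is a set of curved $A_\infty$-structures on $V$; a morphism $(V_1,\langle\cdot,\cdot\rangle_1,\mathfrak C_1)\to(V_2,\langle\cdot,\cdot\rangle_2,\mathfrak C_2)$ is a pair of degree $0$, unit-preserving, partially isometric coalgebra maps $\phi:T(sV_1)\to T(sV_2)$, $\psi:T(sV_2)\to T(sV_1)$ with $\phi\,\mathfrak C_1\,\psi\subset\mathfrak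 C_2$. Pairs are composed by $(\phi_2,\psi_2)(\phi_1,\psi_1)=(\phi_2\phi_1,\psi_1\psi_2)$. An *algebraic gauge theory* over a groupoid is an assignment of objects and morphisms of $\mathbf J$ to its objects and arrows that preserves identities and composition. **Data.** Let $(A,d)$ be a unital dg algebra over $\mathbf k$ with a graded inner product, and let $G$ be a group of invertible degree $0$ elements of $A$ such that $\langle ga,b\rangle=\langle a,bg\rangle$ for all $g\in G$, $a,b\in A$. Write $\langle\cdot,\cdot\rangle$ also for the induced inner product on $T(sA)$ (words of different lengths are orthogonal, $\langle 1,1\rangle=1$, and $\langle a_1\otimes\cdots\otimes a_n,b_1\otimes\cdots\otimes b_n\rangle=\prod_j\langle a_j,b_j\rangle$). Put $c(g)a=gag^{-1}$, $\rho(g)=T(c(g))$ and $g\cdot\gamma=g\gamma g^{-1}+g\,d(g^{-1})$. For $\gamma\in A_1$ let $D_\gamma$ be the curved dg structure on $A$ with $m_0(1)=d\gamma+\gamma^2$, $m_1(a)=da+[\gamma,a]$, $m_2(a\otimes b)=ab$, and let $\delta_\gamma=D_\gamma-T(d)$, where $T(d)$ is the coderivation induced by $d$. Let $(B,d_B)$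 be a chain complex and let $p:A\to B$, $i:B\to A$ (chain maps) and $H:A^\bullet\to A^{\bullet-1}$ form a special contraction: $pi=1$, $ip-1=dH+Hd$, $Hi=0$, $pH=0$, $H^2=0$. Put $T(H)=\sum_{r,t} 1^{\otimes r}\otimes H\otimes(ip)^{\otimes t}$ on $T(sA)$. Let $\Gamma_A\subset A_1$ be a set such that for every $\gamma\in\Gamma_A$ the operator $1-\delta_\gamma T(H)$ is invertible on $T(sA)$. With $\Sigma_\gamma=(1-\delta_\gamma T(H))^{-1}\delta_\gamma$ define $$\widetilde D_\gamma=T(d_B)+T(p)\Sigma_\gamma T(i),\quad I_\gamma=T(i)+T(H)\Sigma_\gamma T(i),\quad P_\gamma=T(p)+T(p)\Sigma_\gamma T(H),$$ and $\langle x,y\rangle_{B,\gamma}=\langle I_\gamma x,I_\gamma y\rangle$ on $T(sB)$; assume that this form is non-degenerate for every $\gamma\in\Gamma_A$. Let $\mathbf G_A$ be the groupoid with set of objects $\Gamma_A$ and arrows $(\gamma,g,\gamma')\in\Gamma_A\times G\times\Gamma_A$, $g\cdot\gamma=\gamma'$, from $\gamma$ to $\gamma'$, composed by multiplication in $G$.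 Put $\widetilde\rho_{\gamma,\gamma'}(g)=P_{\gamma'}\,\rho(g)\,I_\gamma$. **Theorem.** Assume that $H$ commutes with $c(g)$ for every $g\in G$. Then the assignment $$\gamma\mapsto\bigl(B,\langle\cdot,\cdot\rangle_{B,\gamma},\{\widetilde D_\gamma\}\bigr),\qquad (\gamma,g,\gamma')\mapsto\bigl(\widetilde\rho_{\gamma,\gamma'}(g),\widetilde\rho_{\gamma',\gamma}(g^{-1})\bigr)$$ is an algebraic gauge theory $\mathcal F_B$ over $\mathbf G_A$; in particular each $\widetilde D_\gamma$ is a curved $A_\infty$-structure on $B$. The assignment $$\gamma\mapsto\bigl(A,\langle\cdot,\cdot\rangle,\{D_\gamma\}\bigr),\qquad (\gamma,g,\gamma')\mapsto\bigl(\rho(g),\rho(g^{-1})\bigr)$$ is an algebraic gauge theory $\mathcal F_A$ over $\mathbf G_A$, and the pairs $(P_\gamma,I_\gamma)$, $\gamma\in\Gamma_A$, are morphisms of $\mathbf J$ and form a natural transformation from $\mathcal F_A$ to $\mathcal F_B$. -/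

import Mathlib

open CategoryTheory TensorProduct

universe u v

noncomputable section

namespace AlgGauge

/-! ### The tensor coalgebra of the suspension of a graded vector space

For a graded vector space `V`, graded by submodules `𝒱 p`, the suspension `sV` is the same vector
space with `(sV)_p = V_{p+1}`.  The underlying vector space of `T(sV)` is `TensorAlgebra 𝕜 V`, a
word `v₁ ⊗ ⋯ ⊗ vₙ` being the product `ι v₁ * ⋯ * ι vₙ`. -/

section Coalgebra

variable {𝕜 : Type u} [Field 𝕜]

section Basic

variable (𝕜) (V : Type v) [AddCommGroup V] [Module 𝕜 V]

/-- The counit of `T(sV)`: the projection onto the words of length `0`. -/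
def counit : TensorAlgebra 𝕜 V →ₗ[𝕜] 𝕜 :=
  (TensorAlgebra.algebraMapInv (R := 𝕜) (M := V)).toLinearMap

/-- The projection of `T(sV)` onto the words of length `1`. -/
def proj₁ : TensorAlgebra 𝕜 V →ₗ[𝕜] V :=
  TensorAlgebra.ιInv

/-- The upper triangular matrix with rows `(v ⊗ 1, 1 ⊗ v)` and `(0, 1 ⊗ v)`. -/
def deconcLetter :
    V →ₗ[𝕜] Matrix (Fin 2) (Fin 2) (TensorAlgebra 𝕜 V ⊗[𝕜] TensorAlgebra 𝕜 V) where
  toFun v := !![TensorAlgebra.ι 𝕜 v ⊗ₜ[𝕜] 1, 1 ⊗ₜ[𝕜] TensorAlgebra.ι 𝕜 v;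
    0, 1 ⊗ₜ[𝕜] TensorAlgebra.ι 𝕜 v]
  map_add' x y := by
    ext i j
    fin_cases i <;> fin_cases j <;> simp [TensorProduct.add_tmul, TensorProduct.tmul_add]
  map_smul' c x := by
    ext i j
    fin_cases i <;> fin_cases j <;> simp [TensorProduct.smul_tmul']

/-- Deconcatenation, the comultiplication of `T(sV)`:
`Δ(v₁ ⋯ vₙ) = ∑_{r = 0}^{n} (v₁ ⋯ v_r) ⊗ (v_{r+1} ⋯ vₙ)`.
The product of the matrices `deconcLetter v₁, …, deconcLetter vₙ` has first row
`((v₁ ⋯ vₙ) ⊗ 1, ∑_{r < n} (v₁ ⋯ v_r) ⊗ (v_{r+1} ⋯ vₙ))`. -/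
def deconc : TensorAlgebra 𝕜 V →ₗ[𝕜] TensorAlgebra 𝕜 V ⊗[𝕜] TensorAlgebra 𝕜 V :=
  (Matrix.entryLinearMap 𝕜 _ 0 0 + Matrix.entryLinearMap 𝕜 _ 0 1) ∘ₗ
    (TensorAlgebra.lift 𝕜 (deconcLetter 𝕜 V)).toLinearMap

end Basic

section Maps

variable {V : Type v} [AddCommGroup V] [Module 𝕜 V] {W : Type v} [AddCommGroup W] [Module 𝕜 W]

/-- `T(f) = ∑ₙ f^{⊗ n}` for a degree `0` map `f`. -/
def tmap (f : V →ₗ[𝕜] W) : TensorAlgebra 𝕜 V →ₗ[𝕜] TensorAlgebra 𝕜 W :=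
  (TensorAlgebra.lift 𝕜 (TensorAlgebra.ι 𝕜 ∘ₗ f)).toLinearMap

/-- The operator `w ↦ ∑_{w = w₁ w₂ w₃} f(w₁) ⊗ b(w₂) ⊗ g(w₃)`, the sum being over all
factorizations of the word `w` into three (possibly empty) consecutive words. -/
def insertOp (f : Module.End 𝕜 (TensorAlgebra 𝕜 V)) (b : TensorAlgebra 𝕜 V →ₗ[𝕜] V)
    (g : Module.End 𝕜 (TensorAlgebra 𝕜 V)) : Module.End 𝕜 (TensorAlgebra 𝕜 V) :=
  LinearMap.mul' 𝕜 (TensorAlgebra 𝕜 V) ∘ₗ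
    TensorProduct.map f
      (LinearMap.mul' 𝕜 (TensorAlgebra 𝕜 V) ∘ₗ
        TensorProduct.map (TensorAlgebra.ι 𝕜 ∘ₗ b) g ∘ₗ deconc 𝕜 V) ∘ₗ
    deconc 𝕜 V

/-- The linear map that contracts the first letter of a word with `v`:
`u₁ u₂ ⋯ uₙ ↦ β(v, u₁) u₂ ⋯ uₙ`, and `1 ↦ 0`. -/
def contractHead (β : V →ₗ[𝕜] V →ₗ[𝕜] 𝕜) : V →ₗ[𝕜] Module.End 𝕜 (TensorAlgebra 𝕜 V) where
  toFun v := (TensorProduct.lid 𝕜 (TensorAlgebra 𝕜 V)).toLinearMap ∘ₗ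
    TensorProduct.map (β v ∘ₗ proj₁ 𝕜 V) LinearMap.id ∘ₗ deconc 𝕜 V
  map_add' x y := by
    simp [LinearMap.add_comp, LinearMap.comp_add, TensorProduct.map_add_left]
  map_smul' c x := by
    simp [LinearMap.smul_comp, LinearMap.comp_smul, TensorProduct.map_smul_left]

/-- The bilinear form on the tensor coalgebra induced by a bilinear form `β` on `V`: words of
different lengths are orthogonal, `⟨1, 1⟩ = 1` and
`⟨v₁ ⋯ vₙ, u₁ ⋯ uₙ⟩ = β(v₁, u₁) ⋯ β(vₙ, uₙ)`. -/
def tensorForm (β : V →ₗ[𝕜] V →ₗ[𝕜] 𝕜) :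
    TensorAlgebra 𝕜 V →ₗ[𝕜] TensorAlgebra 𝕜 V →ₗ[𝕜] 𝕜 :=
  LinearMap.llcomp 𝕜 (TensorAlgebra 𝕜 V) (TensorAlgebra 𝕜 V) 𝕜 (counit 𝕜 V) ∘ₗ
    (MulOpposite.opLinearEquiv 𝕜).symm.toLinearMap ∘ₗ
    (TensorAlgebra.lift 𝕜
      ((MulOpposite.opLinearEquiv 𝕜).toLinearMap ∘ₗ contractHead β)).toLinearMap

/-- A coalgebra map: compatible with the comultiplications and the counits. -/
structure IsCoalgebraMap (F : TensorAlgebra 𝕜 V →ₗ[𝕜] TensorAlgebra 𝕜 W) : Prop where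
  comul : deconc 𝕜 W ∘ₗ F = TensorProduct.map F F ∘ₗ deconc 𝕜 V
  counit : counit 𝕜 W ∘ₗ F = counit 𝕜 V

/-- A linear map is partially isometric if it restricts to an isometry on some complement of its
kernel. -/
def IsPartiallyIsometric (bV : TensorAlgebra 𝕜 V →ₗ[𝕜] TensorAlgebra 𝕜 V →ₗ[𝕜] 𝕜)
    (bW : TensorAlgebra 𝕜 W →ₗ[𝕜] TensorAlgebra 𝕜 W →ₗ[𝕜] 𝕜)
    (F : TensorAlgebra 𝕜 V →ₗ[𝕜] TensorAlgebra 𝕜 W) : Prop :=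
  ∃ U : Submodule 𝕜 (TensorAlgebra 𝕜 V), IsCompl U (LinearMap.ker F) ∧
    ∀ x ∈ U, ∀ y ∈ U, bW (F x) (F y) = bV x y

end Maps

section Graded

variable {V : Type v} [AddCommGroup V] [Module 𝕜 V] (𝒱 : ℤ → Submodule 𝕜 V)
variable {W : Type v} [AddCommGroup W] [Module 𝕜 W] (𝒲 : ℤ → Submodule 𝕜 W)

/-- The degree `n` part of `T(sV)` for the total grading: it is spanned by the words in homogeneous
letters `v₁ ∈ V_{p₁}, …, v_k ∈ V_{p_k}` with `∑ (p_j - 1) = n`. -/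
def totalGrading (n : ℤ) : Submodule 𝕜 (TensorAlgebra 𝕜 V) :=
  Submodule.span 𝕜 {x | ∃ l : List (Σ p : ℤ, 𝒱 p),
    (l.map fun a => a.1 - 1).sum = n ∧
      (l.map fun a => TensorAlgebra.ι 𝕜 (a.2 : V)).prod = x}

/-- A map `T(sV) → T(sW)` that raises the total degree by `k`. -/
def HasDegree (k : ℤ) (F : TensorAlgebra 𝕜 V →ₗ[𝕜] TensorAlgebra 𝕜 W) : Prop :=
  ∀ n : ℤ, ∀ x ∈ totalGrading 𝒱 n, F x ∈ totalGrading 𝒲 (n + k)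

/-- The Koszul sign of a letter of `sV`: `v ↦ (-1)^{p-1} v` for `v ∈ V_p = (sV)_{p-1}`. -/
def koszul [DirectSum.Decomposition 𝒱] : Module.End 𝕜 V :=
  DirectSum.toModule 𝕜 ℤ V (fun p => (-1 : 𝕜) ^ (p - 1) • (𝒱 p).subtype) ∘ₗ
    (DirectSum.decomposeLinearEquiv 𝒱).toLinearMap

/-- The operator `∑ 1^{⊗ r} ⊗ b ⊗ 1^{⊗ t}` with Koszul signs, for `b : T(sV) → sV` of odd degree;
for `b` of degree `1` this is the coderivation with corestriction `b`. -/
def coderivation [DirectSum.Decomposition 𝒱] (b : TensorAlgebra 𝕜 V →ₗ[𝕜] V) :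
    Module.End 𝕜 (TensorAlgebra 𝕜 V) :=
  insertOp (tmap (koszul 𝒱)) b LinearMap.id

/-- A graded coderivation of odd degree: `Δ D = (D ⊗ 1 + 1 ⊗ D) Δ` with the Koszul sign rule
`(1 ⊗ D)(x ⊗ y) = (-1)^{deg x} x ⊗ D y`. -/
def IsOddCoderivation [DirectSum.Decomposition 𝒱] (D : Module.End 𝕜 (TensorAlgebra 𝕜 V)) : Prop :=
  deconc 𝕜 V ∘ₗ D =
    (TensorProduct.map D LinearMap.id + TensorProduct.map (tmap (koszul 𝒱)) D) ∘ₗ deconc 𝕜 V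

/-- A curved `A_∞`-structure on `V`: a coderivation of `T(sV)` of degree `1` and of square zero. -/
structure IsCurvedAInfinity [DirectSum.Decomposition 𝒱]
    (D : Module.End 𝕜 (TensorAlgebra 𝕜 V)) : Prop where
  degree : HasDegree 𝒱 𝒱 1 D
  coderivation : IsOddCoderivation 𝒱 D
  sq : D ∘ₗ D = 0

/-- A graded inner product on `T(sV)`: a symmetric non-degenerate bilinear form for which parts of
different total degree are orthogonal. -/
structure IsGradedInnerProduct
    (b : TensorAlgebra 𝕜 V →ₗ[𝕜] TensorAlgebra 𝕜 V →ₗ[𝕜] 𝕜) : Prop where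
  symm : ∀ x y, b x y = b y x
  nondegenerate : ∀ x, (∀ y, b x y = 0) → x = 0
  graded : ∀ m n : ℤ, m ≠ n → ∀ x ∈ totalGrading 𝒱 m, ∀ y ∈ totalGrading 𝒱 n, b x y = 0

end Graded

end Coalgebra

/-! ### The category `J` and algebraic gauge theories -/

/-- The data of an object of `J`: a graded vector space `V`, a bilinear form on `T(sV)` and a set of
endomorphisms of `T(sV)`.  The conditions on these data are in `GradedTriple.IsObject`. -/
structure GradedTriple (𝕜 : Type u) [Field 𝕜] where
  V : Type v
  [addCommGroup : AddCommGroup V]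
  [module : Module 𝕜 V]
  grading : ℤ → Submodule 𝕜 V
  [decomposition : DirectSum.Decomposition grading]
  form : TensorAlgebra 𝕜 V →ₗ[𝕜] TensorAlgebra 𝕜 V →ₗ[𝕜] 𝕜
  structures : Set (Module.End 𝕜 (TensorAlgebra 𝕜 V))

namespace GradedTriple

attribute [instance] GradedTriple.addCommGroup GradedTriple.module GradedTriple.decomposition

variable {𝕜 : Type u} [Field 𝕜]

/-- A pair of linear maps in opposite directions between tensor coalgebras.  The conditions under
which it is a morphism of `J` are in `GradedTriple.IsMorphism`. -/
@[ext]
structure Hom (X Y : GradedTriple.{u, v} 𝕜) where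
  φ : TensorAlgebra 𝕜 X.V →ₗ[𝕜] TensorAlgebra 𝕜 Y.V
  ψ : TensorAlgebra 𝕜 Y.V →ₗ[𝕜] TensorAlgebra 𝕜 X.V

instance : Category (GradedTriple.{u, v} 𝕜) where
  Hom := Hom
  id _ := ⟨LinearMap.id, LinearMap.id⟩
  comp f g := ⟨g.φ ∘ₗ f.φ, f.ψ ∘ₗ g.ψ⟩

/-- The triples that are objects of `J`. -/
structure IsObject (X : GradedTriple.{u, v} 𝕜) : Prop where
  form : IsGradedInnerProduct X.grading X.form
  structures : ∀ D ∈ X.structures, IsCurvedAInfinity X.grading D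

/-- The pairs that are morphisms of `J`: pairs of unit-preserving partially isometric (degree `0`)
coalgebra maps such that `φ C_X ψ ⊆ C_Y`. -/
structure IsMorphism {X Y : GradedTriple.{u, v} 𝕜} (f : X ⟶ Y) : Prop where
  degree_φ : HasDegree X.grading Y.grading 0 f.φ
  degree_ψ : HasDegree Y.grading X.grading 0 f.ψ
  coalgebraMap_φ : IsCoalgebraMap f.φ
  coalgebraMap_ψ : IsCoalgebraMap f.ψ
  unit_φ : f.φ 1 = 1
  unit_ψ : f.ψ 1 = 1
  partiallyIsometric_φ : IsPartiallyIsometric X.form Y.form f.φ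
  partiallyIsometric_ψ : IsPartiallyIsometric Y.form X.form f.ψ
  structures : ∀ D ∈ X.structures, f.φ ∘ₗ D ∘ₗ f.ψ ∈ Y.structures

end GradedTriple

/-- An assignment on objects and arrows of a groupoid is an algebraic gauge theory if it takes
values in the objects and the morphisms of `J` and is functorial. -/
structure IsAlgebraicGaugeTheory {𝕜 : Type u} [Field 𝕜] {𝒢 : Type v} [Groupoid.{v} 𝒢]
    (F : 𝒢 ⥤q GradedTriple.{u, v} 𝕜) : Prop where
  isObject : ∀ x, (F.obj x).IsObject
  isMorphism : ∀ {x y : 𝒢} (f : x ⟶ y), GradedTriple.IsMorphism (F.map f)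
  map_id : ∀ x, F.map (𝟙 x) = 𝟙 (F.obj x)
  map_comp : ∀ {x y z : 𝒢} (f : x ⟶ y) (g : y ⟶ z), F.map (f ≫ g) = F.map f ≫ F.map g

/-- The functor given by an algebraic gauge theory. -/
def IsAlgebraicGaugeTheory.functor {𝕜 : Type u} [Field 𝕜] {𝒢 : Type v} [Groupoid.{v} 𝒢]
    {F : 𝒢 ⥤q GradedTriple.{u, v} 𝕜} (h : IsAlgebraicGaugeTheory F) :
    𝒢 ⥤ GradedTriple.{u, v} 𝕜 where
  obj := F.obj
  map f := F.map f
  map_id := h.map_id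
  map_comp := h.map_comp

/-! ### dg algebras, special contractions and the perturbation lemma data -/

variable {𝕜 : Type u} [Field 𝕜]

/-- A differential of degree `1` on a graded vector space. -/
structure Differential {V : Type v} [AddCommGroup V] [Module 𝕜 V] (𝒱 : ℤ → Submodule 𝕜 V) where
  d : V →ₗ[𝕜] V
  d_mem : ∀ (n : ℤ) (a : V), a ∈ 𝒱 n → d a ∈ 𝒱 (n + 1)
  d_d : ∀ a : V, d (d a) = 0

/-- The differential of a unital dg algebra. -/
structure DGDifferential {A : Type v} [Ring A] [Algebra 𝕜 A] (𝒜 : ℤ → Submodule 𝕜 A)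
    extends Differential 𝒜 where
  leibniz : ∀ (n : ℤ) (a b : A), a ∈ 𝒜 n → d (a * b) = d a * b + (-1 : 𝕜) ^ n • (a * d b)

/-- A special chain contraction `(p, i, H)` of a chain complex to another. -/
structure SpecialContraction {A : Type v} [AddCommGroup A] [Module 𝕜 A] {𝒜 : ℤ → Submodule 𝕜 A}
    {B : Type v} [AddCommGroup B] [Module 𝕜 B] {ℬ : ℤ → Submodule 𝕜 B}
    (dA : Differential 𝒜) (dB : Differential ℬ) where
  p : A →ₗ[𝕜] B
  i : B →ₗ[𝕜] A
  H : A →ₗ[𝕜] A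
  p_mem : ∀ (n : ℤ) (a : A), a ∈ 𝒜 n → p a ∈ ℬ n
  i_mem : ∀ (n : ℤ) (b : B), b ∈ ℬ n → i b ∈ 𝒜 n
  H_mem : ∀ (n : ℤ) (a : A), a ∈ 𝒜 n → H a ∈ 𝒜 (n - 1)
  p_d : ∀ a, p (dA.d a) = dB.d (p a)
  i_d : ∀ b, i (dB.d b) = dA.d (i b)
  p_i : ∀ b, p (i b) = b
  homotopy : ∀ a, i (p a) - a = dA.d (H a) + H (dA.d a)
  H_i : ∀ b, H (i b) = 0
  p_H : ∀ a, p (H a) = 0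
  H_H : ∀ a, H (H a) = 0

section DG

variable {A : Type v} [Ring A] [Algebra 𝕜 A] {𝒜 : ℤ → Submodule 𝕜 A} [GradedAlgebra 𝒜]

/-- The gauge action `g · γ = g γ g⁻¹ + g d(g⁻¹)`. -/
def gaugeAct (E : DGDifferential 𝒜) (g : Aˣ) (γ : A) : A :=
  g * γ * (g⁻¹ : Aˣ) + g * E.d (g⁻¹ : Aˣ)

variable (𝕜) in
/-- Conjugation `c(g) a = g a g⁻¹`. -/
def conj (g : Aˣ) : A →ₗ[𝕜] A :=
  LinearMap.mulLeft 𝕜 (g : A) ∘ₗ LinearMap.mulRight 𝕜 ((g⁻¹ : Aˣ) : A)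

variable (𝕜) in
/-- The representation `ρ(g) = T(c(g))` on `T(sA)`. -/
def gaugeRep (g : Aˣ) :
    Module.End 𝕜 (TensorAlgebra 𝕜 A) :=
  tmap (conj 𝕜 g)

/-- The corestriction `T(sA) → sA` of `D_γ`.  Its components are `1 ↦ dγ + γ²` on words of length
`0`, `a ↦ da + [γ, a] = da + γ a - (-1)^{deg a} a γ` on words of length `1`, and, with the Koszul
sign of the suspension, `a ⊗ b ↦ (-1)^{deg a - 1} a b` on words of length `2`. -/
def curvedDGComponents (E : DGDifferential 𝒜) (γ : A) : TensorAlgebra 𝕜 A →ₗ[𝕜] A :=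
  (counit 𝕜 A).smulRight (E.d γ + γ * γ) +
    (E.d + LinearMap.mulLeft 𝕜 γ + LinearMap.mulRight 𝕜 γ ∘ₗ koszul 𝒜) ∘ₗ proj₁ 𝕜 A +
    LinearMap.mul' 𝕜 A ∘ₗ TensorProduct.map (koszul 𝒜 ∘ₗ proj₁ 𝕜 A) (proj₁ 𝕜 A) ∘ₗ deconc 𝕜 A

/-- The curved dg structure `D_γ` on `A`, as a coderivation of `T(sA)`. -/
def curvedDG (E : DGDifferential 𝒜) (γ : A) : Module.End 𝕜 (TensorAlgebra 𝕜 A) :=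
  coderivation 𝒜 (curvedDGComponents E γ)

/-- The groupoid `G_A`: its objects are the elements of `Γ`, and its arrows `γ ⟶ γ'` are the
elements `g` of `G` with `g · γ = γ'`. -/
@[ext]
structure GaugeGroupoid (E : DGDifferential 𝒜) (G : Subgroup Aˣ)
    (hG : ∀ g ∈ G, (g : A) ∈ 𝒜 0) (Γ : Set A) where
  γ : A
  mem : γ ∈ Γ

theorem gaugeAct_one (E : DGDifferential 𝒜) (γ : A) : gaugeAct E 1 γ = γ := by
  have h := E.leibniz 0 1 1 SetLike.GradedOne.one_mem
  simp at h
  simp [gaugeAct, h]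

set_option linter.unusedSectionVars false in
theorem gaugeAct_mul (E : DGDifferential 𝒜) (g h : Aˣ) (hh : ((h⁻¹ : Aˣ) : A) ∈ 𝒜 0) (γ : A) :
    gaugeAct E (g * h) γ = gaugeAct E g (gaugeAct E h γ) := by
  have := E.leibniz 0 _ ((g⁻¹ : Aˣ) : A) hh
  simp only [gaugeAct, mul_inv_rev, Units.val_mul, this, zpow_zero, one_smul]
  simp only [mul_add, add_mul, mul_assoc, Units.mul_inv_cancel_left]
  abel

instance (E : DGDifferential 𝒜) (G : Subgroup Aˣ) (hG : ∀ g ∈ G, (g : A) ∈ 𝒜 0) (Γ : Set A) :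
    Groupoid.{v} (GaugeGroupoid E G hG Γ) where
  Hom x y := {g : G // gaugeAct E (g : Aˣ) x.γ = y.γ}
  id x := ⟨1, by simpa using gaugeAct_one E x.γ⟩
  comp f g := ⟨g.1 * f.1, by
    rw [Subgroup.coe_mul, gaugeAct_mul E _ _ (hG _ (f.1⁻¹).2), f.2, g.2]⟩
  id_comp f := Subtype.ext (mul_one _)
  comp_id f := Subtype.ext (one_mul _)
  assoc f g h := Subtype.ext (mul_assoc _ _ _).symm
  inv {x y} f := ⟨f.1⁻¹, by
    have h := gaugeAct_mul E ((f.1⁻¹ : G) : Aˣ) f.1 (hG _ (f.1⁻¹).2) x.γ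
    rw [f.2, ← Subgroup.coe_mul, inv_mul_cancel] at h
    exact h.symm.trans (by simpa using gaugeAct_one E x.γ)⟩
  inv_comp f := Subtype.ext (mul_inv_cancel _)
  comp_inv f := Subtype.ext (inv_mul_cancel _)

variable {B : Type v} [AddCommGroup B] [Module 𝕜 B] {ℬ : ℤ → Submodule 𝕜 B}
variable {E : DGDifferential 𝒜} {dB : Differential ℬ}

/-- The coderivation `T(d)` of `T(sV)` induced by a differential on `V`. -/
def tensorDifferential {V : Type v} [AddCommGroup V] [Module 𝕜 V] {𝒱 : ℤ → Submodule 𝕜 V}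
    [DirectSum.Decomposition 𝒱] (D : Differential 𝒱) : Module.End 𝕜 (TensorAlgebra 𝕜 V) :=
  coderivation 𝒱 (D.d ∘ₗ proj₁ 𝕜 V)

variable (c : SpecialContraction E.toDifferential dB)

/-- The homotopy `T(H) = ∑ 1^{⊗ r} ⊗ H ⊗ (i p)^{⊗ t}` on `T(sA)`. -/
def tensorHomotopy : Module.End 𝕜 (TensorAlgebra 𝕜 A) :=
  insertOp (tmap (koszul 𝒜)) (c.H ∘ₗ proj₁ 𝕜 A) (tmap (c.i ∘ₗ c.p))

/-- The perturbation `δ_γ = D_γ - T(d)` of the differential `T(d)` on `T(sA)`. -/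
def perturbation (E : DGDifferential 𝒜) (γ : A) : Module.End 𝕜 (TensorAlgebra 𝕜 A) :=
  curvedDG E γ - tensorDifferential E.toDifferential

/-- The hypothesis of the perturbation lemma: `1 - δ_γ T(H)` is invertible on `T(sA)`. -/
def IsTransferable (γ : A) : Prop :=
  IsUnit (1 - perturbation E γ * tensorHomotopy c)

/-- `Σ_γ = (1 - δ_γ T(H))⁻¹ δ_γ` (used only when the inverse exists). -/
def sigma (γ : A) : Module.End 𝕜 (TensorAlgebra 𝕜 A) :=
  Ring.inverse (1 - perturbation E γ * tensorHomotopy c) * perturbation E γ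

/-- `I_γ = T(i) + T(H) Σ_γ T(i)`. -/
def transferI (γ : A) : TensorAlgebra 𝕜 B →ₗ[𝕜] TensorAlgebra 𝕜 A :=
  tmap c.i + tensorHomotopy c ∘ₗ sigma c γ ∘ₗ tmap c.i

/-- `P_γ = T(p) + T(p) Σ_γ T(H)`. -/
def transferP (γ : A) : TensorAlgebra 𝕜 A →ₗ[𝕜] TensorAlgebra 𝕜 B :=
  tmap c.p + tmap c.p ∘ₗ sigma c γ ∘ₗ tensorHomotopy c

/-- The form on `T(sB)` pulled back along `I_γ`: `⟨x, y⟩_{B,γ} = ⟨I_γ x, I_γ y⟩`, where the form on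
`T(sA)` is induced by the form `β` on `A`. -/
def transferForm (β : A →ₗ[𝕜] A →ₗ[𝕜] 𝕜) (γ : A) :
    TensorAlgebra 𝕜 B →ₗ[𝕜] TensorAlgebra 𝕜 B →ₗ[𝕜] 𝕜 :=
  (tensorForm β).compl₁₂ (transferI c γ) (transferI c γ)

variable [DirectSum.Decomposition ℬ]

/-- `D̃_γ = T(d_B) + T(p) Σ_γ T(i)`. -/
def transferD (γ : A) : Module.End 𝕜 (TensorAlgebra 𝕜 B) :=
  tensorDifferential dB + tmap c.p ∘ₗ sigma c γ ∘ₗ tmap c.i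

/-- The assignment `F_A`: `γ ↦ (A, ⟨·,·⟩, {D_γ})` on objects and `(γ, g, γ') ↦ ρ(g)`, paired with
its inverse `ρ(g⁻¹)`, on arrows. -/
def gaugeTheoryA (E : DGDifferential 𝒜) (β : A →ₗ[𝕜] A →ₗ[𝕜] 𝕜) (G : Subgroup Aˣ)
    (hG : ∀ g ∈ G, (g : A) ∈ 𝒜 0) (Γ : Set A) :
    GaugeGroupoid E G hG Γ ⥤q GradedTriple.{u, v} 𝕜 where
  obj x := ⟨A, 𝒜, tensorForm β, {curvedDG E x.γ}⟩
  map {_ _} f := ⟨gaugeRep 𝕜 (f.1 : Aˣ), gaugeRep 𝕜 ((f.1 : Aˣ)⁻¹)⟩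

/-- The gauge transformation `ρ̃_{γ,γ'}(g) = P_{γ'} ρ(g) I_γ` on `T(sB)`. -/
def transferRep (γ γ' : A) (g : Aˣ) : Module.End 𝕜 (TensorAlgebra 𝕜 B) :=
  transferP c γ' ∘ₗ gaugeRep 𝕜 g ∘ₗ transferI c γ

/-- The assignment `F_B`: `γ ↦ (B, ⟨·,·⟩_{B,γ}, {D̃_γ})` on objects and
`(γ, g, γ') ↦ ρ̃_{γ,γ'}(g)`, paired with `ρ̃_{γ',γ}(g⁻¹)`, on arrows. -/
def gaugeTheoryB (β : A →ₗ[𝕜] A →ₗ[𝕜] 𝕜) (G : Subgroup Aˣ)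
    (hG : ∀ g ∈ G, (g : A) ∈ 𝒜 0) (Γ : Set A) :
    GaugeGroupoid E G hG Γ ⥤q GradedTriple.{u, v} 𝕜 where
  obj x := ⟨B, ℬ, transferForm c β x.γ, {transferD c x.γ}⟩
  map {x y} f := ⟨transferRep c x.γ y.γ (f.1 : Aˣ), transferRep c y.γ x.γ ((f.1 : Aˣ)⁻¹)⟩

/-- The pair `(P_γ, I_γ)`, from `F_A(γ)` to `F_B(γ)`. -/
def transferPair (β : A →ₗ[𝕜] A →ₗ[𝕜] 𝕜) (G : Subgroup Aˣ)
    (hG : ∀ g ∈ G, (g : A) ∈ 𝒜 0) (Γ : Set A) (x : GaugeGroupoid E G hG Γ) :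
    (gaugeTheoryA E β G hG Γ).obj x ⟶ (gaugeTheoryB c β G hG Γ).obj x :=
  ⟨transferP (A := A) (B := B) c x.γ, transferI (A := A) (B := B) c x.γ⟩

end DG

end AlgGauge

end

noncomputable section

namespace AlgGauge

/-! ### Words: deconcatenation and insertion operators by recursion on the first letter. -/

section Words

variable {𝕜 : Type u} [Field 𝕜]
variable {V : Type v} [AddCommGroup V] [Module 𝕜 V] {W : Type v} [AddCommGroup W] [Module 𝕜 W]

local notation "ιₜ" => TensorAlgebra.ι 𝕜

/-! The special contraction of `A` to `B` induces one of T(sA) to T(sB), with homotopy T(H) (the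
tensor trick, `insertOp_homotopy`). Since D_γ and T(d) square to zero, δ_γ is a perturbation of
T(d), and the homological perturbation lemma gives P_γ I_γ = 1, I_γ P_γ = 1 + D_γ H_γ + H_γ D_γ with
H_γ = T(H) + T(H) Σ_γ T(H), and D̃_γ = P_γ D_γ I_γ. In particular D̃_γ squares to zero.

The perturbation lemma knows nothing of coproducts. Compatibility comes from the co-Leibniz rule of
T(H) together with the side conditions. On T(sA) ⊗ T(sA) the operator H_γ ⊗ I_γ P_γ + K ⊗ H_γ, where
K = (-1)^deg, is a homotopy from the identity to I_γ P_γ ⊗ I_γ P_γ, and it vanishes on Δ I_γ. Hence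
(I_γ P_γ ⊗ I_γ P_γ) Δ I_γ = Δ I_γ, and (P_γ ⊗ P_γ) Δ I_γ = Δ makes I_γ a coalgebra map (`comul_I`).
A similar argument treats P_γ (`comul_P`), and D̃_γ is then a coderivation (`comul_Dt`). A coalgebra
map fixes 1, the only group-like element.

On the gauge side, curvature, covariant derivative and product are covariant under c(g), and a map
obeying a co-Leibniz rule is determined by its corestriction; so ρ(g) D_γ = D_γ' ρ(g). Although `H`
commutes with c(g), `d` is not assumed to, hence neither is ip, and T(H) is not treated as commuting
with ρ(g). What survives is T(H) ρ T(H) = T(H) ρ T(ip) = T(ip) ρ T(H) = 0. This suffices for I_γ'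
ρ̃(g) = ρ(g) I_γ and ρ̃(g) P_γ = P_γ' ρ(g) (`I_comp_P_intertwine`, `P_intertwine`). These two
relations yield functoriality, the transformation of D̃_γ, the isometry property for the pulled-back
forms, and naturality. Finally P_γ is partially isometric because the image of I_γ is a complement
of its kernel. -/

theorem submodule_eq_top_of_words (S : Submodule 𝕜 (TensorAlgebra 𝕜 V)) (one : 1 ∈ S)
    (cons : ∀ v, ∀ w ∈ S, ιₜ v * w ∈ S) (x : TensorAlgebra 𝕜 V) : x ∈ S := by
  have key : ∀ x : TensorAlgebra 𝕜 V, ∀ w ∈ S, x * w ∈ S := by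
    intro x
    induction x using TensorAlgebra.induction with
    | algebraMap r =>
      intro w hw
      rw [← Algebra.smul_def]
      exact S.smul_mem r hw
    | ι v => exact cons v
    | mul a b ha hb =>
      intro w hw
      rw [mul_assoc]
      exact ha _ (hb _ hw)
    | add a b ha hb =>
      intro w hw
      rw [add_mul]
      exact S.add_mem (ha _ hw) (hb _ hw)
  simpa using key x 1 one

theorem linearMap_ext_words {M : Type*} [AddCommGroup M] [Module 𝕜 M]
    {F G : TensorAlgebra 𝕜 V →ₗ[𝕜] M} (one : F 1 = G 1)
    (cons : ∀ v w, F w = G w → F (ιₜ v * w) = G (ιₜ v * w)) : F = G := by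
  ext x
  exact submodule_eq_top_of_words (LinearMap.eqLocus F G) one cons x

@[simp] theorem counit_one : counit 𝕜 V 1 = 1 := by simp [counit]

theorem counit_mul (x y : TensorAlgebra 𝕜 V) :
    counit 𝕜 V (x * y) = counit 𝕜 V x * counit 𝕜 V y := by simp [counit]

@[simp] theorem counit_ι (v : V) : counit 𝕜 V (ιₜ v) = 0 := by
  simp [counit, TensorAlgebra.algebraMapInv]

@[simp] theorem counit_cons (v : V) (x : TensorAlgebra 𝕜 V) : counit 𝕜 V (ιₜ v * x) = 0 := by
  simp [counit_mul]

@[simp] theorem proj₁_one : proj₁ 𝕜 V 1 = 0 := by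
  -- `TensorAlgebra.ιInv` is the second component of an algebra map to `TrivSqZeroExt`, whose
  -- product needs a right action; this one, from commutativity of `𝕜`, is the one in its
  -- definition.
  let _ : Module 𝕜ᵐᵒᵖ V := Module.compHom _ ((RingHom.id 𝕜).fromOpposite mul_comm)
  have _ : IsCentralScalar 𝕜 V := ⟨fun r m => rfl⟩
  exact congrArg TrivSqZeroExt.snd (map_one (TensorAlgebra.toTrivSqZeroExt (R := 𝕜) (M := V)))

@[simp] theorem proj₁_ι (v : V) : proj₁ 𝕜 V (ιₜ v) = v :=
  TensorAlgebra.ι_leftInverse v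

theorem proj₁_mul (x y : TensorAlgebra 𝕜 V) :
    proj₁ 𝕜 V (x * y) = counit 𝕜 V x • proj₁ 𝕜 V y + counit 𝕜 V y • proj₁ 𝕜 V x := by
  let _ : Module 𝕜ᵐᵒᵖ V := Module.compHom _ ((RingHom.id 𝕜).fromOpposite mul_comm)
  have _ : IsCentralScalar 𝕜 V := ⟨fun r m => rfl⟩
  have h1 : ∀ x : TensorAlgebra 𝕜 V, (TensorAlgebra.toTrivSqZeroExt x).fst = counit 𝕜 V x := by
    intro x
    have : (TrivSqZeroExt.fstHom 𝕜 𝕜 V).comp TensorAlgebra.toTrivSqZeroExt =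
        TensorAlgebra.algebraMapInv (R := 𝕜) (M := V) := by
      ext v
      simp [TensorAlgebra.algebraMapInv]
    exact congrArg (fun f => f x) this
  have h2 : ∀ x : TensorAlgebra 𝕜 V, (TensorAlgebra.toTrivSqZeroExt x).snd = proj₁ 𝕜 V x :=
    fun x => rfl
  rw [← h2, map_mul, TrivSqZeroExt.snd_mul, h1, h1, h2, h2]
  simp

@[simp] theorem proj₁_cons (v : V) (x : TensorAlgebra 𝕜 V) :
    proj₁ 𝕜 V (ιₜ v * x) = counit 𝕜 V x • v := by
  simp [proj₁_mul]

/-! ### Deconcatenation -/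

@[simp] theorem deconc_one : deconc 𝕜 V 1 = 1 := by
  simp [deconc]

/-- Upper triangularity makes the diagonal entries multiplicative, so only the entry (0, 1) carries
a genuine sum. -/
theorem lift_deconcLetter_entries (x : TensorAlgebra 𝕜 V) :
    TensorAlgebra.lift 𝕜 (deconcLetter 𝕜 V) x 0 0 = x ⊗ₜ[𝕜] 1 ∧
      TensorAlgebra.lift 𝕜 (deconcLetter 𝕜 V) x 1 0 = 0 ∧
      TensorAlgebra.lift 𝕜 (deconcLetter 𝕜 V) x 1 1 = 1 ⊗ₜ[𝕜] x := by
  induction x using TensorAlgebra.induction with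
  | algebraMap r =>
    simp [Algebra.TensorProduct.one_def,
      Algebra.algebraMap_eq_smul_one, TensorProduct.smul_tmul']
  | ι v => simp [deconcLetter]
  | mul a b ha hb =>
    obtain ⟨a1, a2, a3⟩ := ha
    obtain ⟨b1, b2, b3⟩ := hb
    simp [Matrix.mul_apply, Fin.sum_univ_two, a1, a2, a3, b1, b2, b3]
  | add a b ha hb =>
    obtain ⟨a1, a2, a3⟩ := ha
    obtain ⟨b1, b2, b3⟩ := hb
    simp [a1, a2, a3, b1, b2, b3, TensorProduct.add_tmul, TensorProduct.tmul_add]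

/-- A cut of `v x` is either a cut of `x` with `v` attached to its left part, or the cut before `v`.
Later computations with Δ rest on this recursion. -/
theorem deconc_cons (v : V) (x : TensorAlgebra 𝕜 V) :
    deconc 𝕜 V (ιₜ v * x) = (ιₜ v ⊗ₜ[𝕜] 1) * deconc 𝕜 V x + 1 ⊗ₜ[𝕜] (ιₜ v * x) := by
  obtain ⟨a1, a2, a3⟩ := lift_deconcLetter_entries (𝕜 := 𝕜) x
  simp only [deconc, LinearMap.comp_apply, LinearMap.add_apply, Matrix.entryLinearMap_apply,
    AlgHom.toLinearMap_apply, map_mul, TensorAlgebra.lift_ι_apply, Matrix.mul_apply,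
    Fin.sum_univ_two, a1, a2, a3, mul_add]
  simp [deconcLetter, add_assoc]

theorem map_mul_left {M N : Type*} [AddCommGroup M] [Module 𝕜 M] [AddCommGroup N] [Module 𝕜 N]
    (F : TensorAlgebra 𝕜 V →ₗ[𝕜] M) (G : TensorAlgebra 𝕜 W →ₗ[𝕜] N) (a : TensorAlgebra 𝕜 V)
    (z : TensorAlgebra 𝕜 V ⊗[𝕜] TensorAlgebra 𝕜 W) :
    TensorProduct.map F G ((a ⊗ₜ[𝕜] 1) * z) =
      TensorProduct.map (F ∘ₗ LinearMap.mulLeft 𝕜 a) G z := by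
  induction z with
  | zero => simp
  | tmul x y => simp
  | add x y hx hy => rw [mul_add, map_add, map_add, hx, hy]

theorem map_deconc_cons {M N : Type*} [AddCommGroup M] [Module 𝕜 M] [AddCommGroup N]
    [Module 𝕜 N] (F : TensorAlgebra 𝕜 V →ₗ[𝕜] M) (G : TensorAlgebra 𝕜 V →ₗ[𝕜] N) (v : V)
    (x : TensorAlgebra 𝕜 V) :
    TensorProduct.map F G (deconc 𝕜 V (ιₜ v * x)) =
      TensorProduct.map (F ∘ₗ LinearMap.mulLeft 𝕜 (ιₜ v)) G (deconc 𝕜 V x) +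
        F 1 ⊗ₜ[𝕜] G (ιₜ v * x) := by
  rw [deconc_cons, map_add, map_mul_left, TensorProduct.map_tmul]

theorem map_deconc_one {M N : Type*} [AddCommGroup M] [Module 𝕜 M] [AddCommGroup N]
    [Module 𝕜 N] (F : TensorAlgebra 𝕜 V →ₗ[𝕜] M) (G : TensorAlgebra 𝕜 V →ₗ[𝕜] N) :
    TensorProduct.map F G (deconc 𝕜 V 1) = F 1 ⊗ₜ[𝕜] G 1 := by
  rw [deconc_one, Algebra.TensorProduct.one_def, TensorProduct.map_tmul]

theorem proj₁_comp_cons (v : V) :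
    proj₁ 𝕜 V ∘ₗ LinearMap.mulLeft 𝕜 (ιₜ v) = (counit 𝕜 V).smulRight v := by
  ext x
  simp

/-- Of all cuts of a word, only the one with empty left part survives the counit. -/
theorem map_counit_deconc {M N : Type*} [AddCommGroup M] [Module 𝕜 M] [AddCommGroup N]
    [Module 𝕜 N] (m : M) (G : TensorAlgebra 𝕜 V →ₗ[𝕜] N) (x : TensorAlgebra 𝕜 V) :
    TensorProduct.map ((counit 𝕜 V).smulRight m) G (deconc 𝕜 V x) = m ⊗ₜ[𝕜] G x := by
  have : TensorProduct.map ((counit 𝕜 V).smulRight m) G ∘ₗ deconc 𝕜 V =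
      TensorProduct.mk 𝕜 M N m ∘ₗ G := by
    refine linearMap_ext_words ?_ fun v w _ => ?_
    · simp [Algebra.TensorProduct.one_def]
    · have h : (counit 𝕜 V).smulRight m ∘ₗ LinearMap.mulLeft 𝕜 (ιₜ v) = 0 := by
        ext x
        simp
      rw [LinearMap.comp_apply, map_deconc_cons, h]
      simp
  exact congrArg (fun f => f x) this

variable (𝕜 V) in
/-- The map `T(sV) → sV ⊗ T(sV)` that splits off the first letter of a word. -/
def splitHead : TensorAlgebra 𝕜 V →ₗ[𝕜] V ⊗[𝕜] TensorAlgebra 𝕜 V :=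
  TensorProduct.map (proj₁ 𝕜 V) LinearMap.id ∘ₗ deconc 𝕜 V

@[simp] theorem splitHead_one : splitHead 𝕜 V 1 = 0 := by
  simp [splitHead, Algebra.TensorProduct.one_def]

@[simp] theorem splitHead_cons (v : V) (x : TensorAlgebra 𝕜 V) :
    splitHead 𝕜 V (ιₜ v * x) = v ⊗ₜ[𝕜] x := by
  rw [splitHead, LinearMap.comp_apply, map_deconc_cons, proj₁_comp_cons, map_counit_deconc]
  simp

theorem eq_counit_add_splitHead (x : TensorAlgebra 𝕜 V) :
    x = counit 𝕜 V x • 1 +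
      TensorProduct.lift ((LinearMap.mul 𝕜 (TensorAlgebra 𝕜 V)) ∘ₗ ιₜ) (splitHead 𝕜 V x) := by
  have : LinearMap.id = (counit 𝕜 V).smulRight (1 : TensorAlgebra 𝕜 V) +
      TensorProduct.lift ((LinearMap.mul 𝕜 (TensorAlgebra 𝕜 V)) ∘ₗ ιₜ) ∘ₗ splitHead 𝕜 V := by
    refine linearMap_ext_words ?_ fun v w _ => ?_ <;> simp
  exact congrArg (fun f => f x) this

/-- Multiplying the first letter back onto the tail recovers everything except the part of length 0,
so the counit and `splitHead` together are injective. -/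
theorem eq_zero_of_splitHead {x : TensorAlgebra 𝕜 V} (h0 : counit 𝕜 V x = 0)
    (h1 : splitHead 𝕜 V x = 0) : x = 0 := by
  rw [eq_counit_add_splitHead x, h0, h1]
  simp

/-! ### The maps `T(f)` -/

@[simp] theorem tmap_one (f : V →ₗ[𝕜] W) : tmap f 1 = 1 := by simp [tmap]

theorem tmap_mul (f : V →ₗ[𝕜] W) (x y : TensorAlgebra 𝕜 V) :
    tmap f (x * y) = tmap f x * tmap f y := by simp [tmap]

@[simp] theorem tmap_ι (f : V →ₗ[𝕜] W) (v : V) : tmap f (ιₜ v) = ιₜ (f v) := by simp [tmap]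

@[simp] theorem tmap_cons (f : V →ₗ[𝕜] W) (v : V) (x : TensorAlgebra 𝕜 V) :
    tmap f (ιₜ v * x) = ιₜ (f v) * tmap f x := by simp [tmap_mul]

theorem tmap_comp_tmap {U : Type v} [AddCommGroup U] [Module 𝕜 U] (g : W →ₗ[𝕜] U)
    (f : V →ₗ[𝕜] W) : tmap g ∘ₗ tmap f = tmap (g ∘ₗ f) := by
  refine linearMap_ext_words (by simp) fun v w h => ?_
  simp only [LinearMap.comp_apply] at h ⊢
  simp [h]

theorem tmap_id : tmap (LinearMap.id : V →ₗ[𝕜] V) = LinearMap.id :=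
  linearMap_ext_words (by simp) fun v w h => by simp [h]

theorem counit_comp_tmap (f : V →ₗ[𝕜] W) : counit 𝕜 W ∘ₗ tmap f = counit 𝕜 V :=
  linearMap_ext_words (by simp) fun v w _ => by simp

theorem counit_tmap (f : V →ₗ[𝕜] W) (x : TensorAlgebra 𝕜 V) :
    counit 𝕜 W (tmap f x) = counit 𝕜 V x :=
  congrArg (fun F => F x) (counit_comp_tmap f)

theorem proj₁_comp_tmap (f : V →ₗ[𝕜] W) : proj₁ 𝕜 W ∘ₗ tmap f = f ∘ₗ proj₁ 𝕜 V :=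
  linearMap_ext_words (by simp) fun v w _ => by simp [counit_tmap]

theorem deconc_comp_tmap (f : V →ₗ[𝕜] W) :
    deconc 𝕜 W ∘ₗ tmap f = TensorProduct.map (tmap f) (tmap f) ∘ₗ deconc 𝕜 V := by
  refine linearMap_ext_words (by simp [Algebra.TensorProduct.one_def]) fun v w h => ?_
  have hc : tmap f ∘ₗ LinearMap.mulLeft 𝕜 (ιₜ v) = LinearMap.mulLeft 𝕜 (ιₜ (f v)) ∘ₗ tmap f := by
    ext x
    simp
  simp only [LinearMap.comp_apply] at h ⊢
  rw [tmap_cons, deconc_cons, map_deconc_cons, h, hc, tmap_one, tmap_cons]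
  congr 1
  generalize deconc 𝕜 V w = z
  induction z with
  | zero => simp
  | tmul x y => simp
  | add x y hx hy => rw [map_add, mul_add, map_add, hx, hy]

theorem isCoalgebraMap_tmap (f : V →ₗ[𝕜] W) : IsCoalgebraMap (tmap f) :=
  ⟨deconc_comp_tmap f, counit_comp_tmap f⟩

theorem IsCoalgebraMap.comp {U : Type v} [AddCommGroup U] [Module 𝕜 U]
    {G : TensorAlgebra 𝕜 W →ₗ[𝕜] TensorAlgebra 𝕜 U}
    {F : TensorAlgebra 𝕜 V →ₗ[𝕜] TensorAlgebra 𝕜 W} (hG : IsCoalgebraMap G)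
    (hF : IsCoalgebraMap F) : IsCoalgebraMap (G ∘ₗ F) where
  comul := by
    rw [← LinearMap.comp_assoc, hG.comul, LinearMap.comp_assoc, hF.comul, ← LinearMap.comp_assoc,
      ← TensorProduct.map_comp]
  counit := by rw [← LinearMap.comp_assoc, hG.counit, hF.counit]

/-! ### Insertion operators -/

/-- The operator `w ↦ ∑_{w = w₁ w₂} b(w₁) ⊗ g(w₂)`. -/
def insertHead (b : TensorAlgebra 𝕜 V →ₗ[𝕜] V) (g : Module.End 𝕜 (TensorAlgebra 𝕜 V)) :
    Module.End 𝕜 (TensorAlgebra 𝕜 V) :=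
  LinearMap.mul' 𝕜 (TensorAlgebra 𝕜 V) ∘ₗ TensorProduct.map (ιₜ ∘ₗ b) g ∘ₗ deconc 𝕜 V

theorem insertHead_one (b : TensorAlgebra 𝕜 V →ₗ[𝕜] V)
    (g : Module.End 𝕜 (TensorAlgebra 𝕜 V)) : insertHead b g 1 = ιₜ (b 1) * g 1 := by
  simp only [insertHead, LinearMap.comp_apply, map_deconc_one, LinearMap.mul'_apply]

/-- Either `b` consumes `v` together with a prefix of `x`, or it consumes the empty word. The first
case changes `b` into `b` precomposed with `v ·`. -/
theorem insertHead_cons (b : TensorAlgebra 𝕜 V →ₗ[𝕜] V)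
    (g : Module.End 𝕜 (TensorAlgebra 𝕜 V)) (v : V) (x : TensorAlgebra 𝕜 V) :
    insertHead b g (ιₜ v * x) =
      insertHead (b ∘ₗ LinearMap.mulLeft 𝕜 (ιₜ v)) g x + ιₜ (b 1) * g (ιₜ v * x) := by
  simp only [insertHead, LinearMap.comp_apply, map_deconc_cons, map_add, LinearMap.mul'_apply,
    LinearMap.comp_assoc]

theorem insertOp_one (f : V →ₗ[𝕜] V) (b : TensorAlgebra 𝕜 V →ₗ[𝕜] V)
    (g : Module.End 𝕜 (TensorAlgebra 𝕜 V)) :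
    insertOp (tmap f) b g 1 = insertHead b g 1 := by
  simp only [insertOp, LinearMap.comp_apply, map_deconc_one, LinearMap.mul'_apply, insertHead,
    tmap_one, one_mul]

theorem insertOp_cons (f : V →ₗ[𝕜] V) (b : TensorAlgebra 𝕜 V →ₗ[𝕜] V)
    (g : Module.End 𝕜 (TensorAlgebra 𝕜 V)) (v : V) (x : TensorAlgebra 𝕜 V) :
    insertOp (tmap f) b g (ιₜ v * x) =
      ιₜ (f v) * insertOp (tmap f) b g x + insertHead b g (ιₜ v * x) := by
  have hc : tmap f ∘ₗ LinearMap.mulLeft 𝕜 (ιₜ v) = LinearMap.mulLeft 𝕜 (ιₜ (f v)) ∘ₗ tmap f := by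
    ext x
    simp
  have key : ∀ z, LinearMap.mul' 𝕜 (TensorAlgebra 𝕜 V) (TensorProduct.map
      (LinearMap.mulLeft 𝕜 (ιₜ (f v)) ∘ₗ tmap f) (insertHead b g) z) =
      ιₜ (f v) * LinearMap.mul' 𝕜 (TensorAlgebra 𝕜 V)
        (TensorProduct.map (tmap f) (insertHead b g) z) := by
    intro z
    induction z with
    | zero => simp
    | tmul x y => simp [mul_assoc]
    | add x y hx hy => simp only [map_add, mul_add, hx, hy]
  change LinearMap.mul' 𝕜 (TensorAlgebra 𝕜 V) (TensorProduct.map (tmap f) (insertHead b g)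
    (deconc 𝕜 V (ιₜ v * x))) = ιₜ (f v) * LinearMap.mul' 𝕜 (TensorAlgebra 𝕜 V)
        (TensorProduct.map (tmap f) (insertHead b g) (deconc 𝕜 V x)) + _
  rw [map_deconc_cons, map_add, hc, key]
  simp

theorem insertHead_smulRight_counit (v : V) (g : Module.End 𝕜 (TensorAlgebra 𝕜 V))
    (x : TensorAlgebra 𝕜 V) : insertHead ((counit 𝕜 V).smulRight v) g x = ιₜ v * g x := by
  have : ιₜ ∘ₗ (counit 𝕜 V).smulRight v = (counit 𝕜 V).smulRight (ιₜ v) := by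
    ext x
    simp
  rw [insertHead, LinearMap.comp_apply, LinearMap.comp_apply, this, map_counit_deconc]
  simp

theorem insertOp_proj₁_one (f h : V →ₗ[𝕜] V) (g : Module.End 𝕜 (TensorAlgebra 𝕜 V)) :
    insertOp (tmap f) (h ∘ₗ proj₁ 𝕜 V) g 1 = 0 := by
  rw [insertOp_one, insertHead_one]
  simp

theorem insertOp_proj₁_cons (f h : V →ₗ[𝕜] V) (g : Module.End 𝕜 (TensorAlgebra 𝕜 V)) (v : V)
    (x : TensorAlgebra 𝕜 V) :
    insertOp (tmap f) (h ∘ₗ proj₁ 𝕜 V) g (ιₜ v * x) =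
      ιₜ (f v) * insertOp (tmap f) (h ∘ₗ proj₁ 𝕜 V) g x + ιₜ (h v) * g x := by
  have : (h ∘ₗ proj₁ 𝕜 V) ∘ₗ LinearMap.mulLeft 𝕜 (ιₜ v) = (counit 𝕜 V).smulRight (h v) := by
    ext x
    simp
  rw [insertOp_cons, insertHead_cons, this, insertHead_smulRight_counit]
  simp

theorem counit_insertHead (b : TensorAlgebra 𝕜 V →ₗ[𝕜] V)
    (g : Module.End 𝕜 (TensorAlgebra 𝕜 V)) : counit 𝕜 V ∘ₗ insertHead b g = 0 := by
  have key : ∀ z, counit 𝕜 V (LinearMap.mul' 𝕜 (TensorAlgebra 𝕜 V)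
      (TensorProduct.map (ιₜ ∘ₗ b) g z)) = 0 := by
    intro z
    induction z with
    | zero => simp
    | tmul x y => simp
    | add x y hx hy => simp only [map_add, hx, hy, add_zero]
  ext x
  exact key _

theorem counit_insertOp (f : V →ₗ[𝕜] V) (b : TensorAlgebra 𝕜 V →ₗ[𝕜] V)
    (g : Module.End 𝕜 (TensorAlgebra 𝕜 V)) : counit 𝕜 V ∘ₗ insertOp (tmap f) b g = 0 := by
  have h : ∀ x, counit 𝕜 V (insertHead b g x) = 0 := fun x =>
    congrArg (fun F => F x) (counit_insertHead b g)
  exact linearMap_ext_words (by simp [insertOp_one, h]) fun v w _ => by simp [insertOp_cons, h]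

theorem proj₁_insertHead (g : V →ₗ[𝕜] V) (x : TensorAlgebra 𝕜 V) :
    ∀ b : TensorAlgebra 𝕜 V →ₗ[𝕜] V, proj₁ 𝕜 V (insertHead b (tmap g) x) = b x := by
  -- The recursion in `insertHead_cons` changes `b`, so the induction on words runs over all `b` at
  -- once.
  let S : Submodule 𝕜 (TensorAlgebra 𝕜 V) :=
    ⨅ b : TensorAlgebra 𝕜 V →ₗ[𝕜] V, LinearMap.eqLocus (proj₁ 𝕜 V ∘ₗ insertHead b (tmap g)) b
  have : x ∈ S := by
    apply submodule_eq_top_of_words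
    · simp [S, insertHead_one]
    · intro v w hw
      simp only [S, Submodule.mem_iInf, LinearMap.mem_eqLocus, LinearMap.comp_apply] at hw ⊢
      intro b
      rw [insertHead_cons, map_add, hw]
      simp
  simpa [S] using this

theorem proj₁_insertOp (f g : V →ₗ[𝕜] V) (b : TensorAlgebra 𝕜 V →ₗ[𝕜] V) :
    proj₁ 𝕜 V ∘ₗ insertOp (tmap f) b (tmap g) = b := by
  refine linearMap_ext_words (by simp [insertOp_one, proj₁_insertHead]) fun v w _ => ?_
  have h := congrArg (fun F => F w) (counit_insertOp f b (tmap g))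
  simp only [LinearMap.comp_apply, LinearMap.zero_apply] at h
  simp [insertOp_cons, proj₁_insertHead, h]

theorem deconc_insertHead (g : V →ₗ[𝕜] V) (x : TensorAlgebra 𝕜 V) :
    ∀ b : TensorAlgebra 𝕜 V →ₗ[𝕜] V, deconc 𝕜 V (insertHead b (tmap g) x) =
      TensorProduct.map (insertHead b (tmap g)) (tmap g) (deconc 𝕜 V x) +
        1 ⊗ₜ[𝕜] insertHead b (tmap g) x := by
  let S : Submodule 𝕜 (TensorAlgebra 𝕜 V) :=
    ⨅ b : TensorAlgebra 𝕜 V →ₗ[𝕜] V, LinearMap.eqLocus (deconc 𝕜 V ∘ₗ insertHead b (tmap g))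
      (TensorProduct.map (insertHead b (tmap g)) (tmap g) ∘ₗ deconc 𝕜 V +
        TensorProduct.mk 𝕜 _ _ 1 ∘ₗ insertHead b (tmap g))
  have : x ∈ S := by
    apply submodule_eq_top_of_words
    · simp only [S, Submodule.mem_iInf, LinearMap.mem_eqLocus, LinearMap.comp_apply,
        LinearMap.add_apply, TensorProduct.mk_apply, map_deconc_one]
      intro b
      have h := deconc_cons (𝕜 := 𝕜) (b 1) 1
      rw [deconc_one] at h
      simpa only [insertHead_one, tmap_one, mul_one] using h
    · intro v w hw
      simp only [S, Submodule.mem_iInf, LinearMap.mem_eqLocus, LinearMap.comp_apply,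
        LinearMap.add_apply, TensorProduct.mk_apply] at hw ⊢
      intro b
      have h1 : insertHead b (tmap g) ∘ₗ LinearMap.mulLeft 𝕜 (ιₜ v) =
          insertHead (b ∘ₗ LinearMap.mulLeft 𝕜 (ιₜ v)) (tmap g) +
            LinearMap.mulLeft 𝕜 (ιₜ (b 1) * ιₜ (g v)) ∘ₗ tmap g := by
        ext y
        simp [insertHead_cons]
      have h2 : deconc 𝕜 V (tmap g w) = TensorProduct.map (tmap g) (tmap g) (deconc 𝕜 V w) :=
        congrArg (fun F => F w) (deconc_comp_tmap g)
      have h3 : TensorProduct.map (LinearMap.mulLeft 𝕜 (ιₜ (b 1) * ιₜ (g v)) ∘ₗ tmap g) (tmap g)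
          (deconc 𝕜 V w) = (ιₜ (b 1) ⊗ₜ[𝕜] 1) * ((ιₜ (g v) ⊗ₜ[𝕜] 1) *
            TensorProduct.map (tmap g) (tmap g) (deconc 𝕜 V w)) := by
        generalize deconc 𝕜 V w = z
        induction z with
        | zero => simp
        | tmul x y => simp
        | add x y hx hy => simp only [map_add, mul_add, hx, hy]
      rw [map_deconc_cons, h1, TensorProduct.map_add_left, LinearMap.add_apply, h3,
        insertHead_cons, map_add, hw, tmap_cons, deconc_cons, deconc_cons, h2, insertHead_one,
        TensorProduct.tmul_add, mul_add]
      simp only [tmap_one, mul_one, Algebra.TensorProduct.tmul_mul_tmul, one_mul]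
      abel
  simpa [S] using this

/-- The co-Leibniz rule of the operator `w ↦ ∑ f(w₁) ⊗ b(w₂) ⊗ g(w₃)`. -/
theorem deconc_insertOp (f g : V →ₗ[𝕜] V) (b : TensorAlgebra 𝕜 V →ₗ[𝕜] V) :
    deconc 𝕜 V ∘ₗ insertOp (tmap f) b (tmap g) =
      (TensorProduct.map (insertOp (tmap f) b (tmap g)) (tmap g) +
        TensorProduct.map (tmap f) (insertOp (tmap f) b (tmap g))) ∘ₗ deconc 𝕜 V := by
  refine linearMap_ext_words ?_ fun v w hw => ?_
  · simp only [LinearMap.comp_apply, LinearMap.add_apply, map_deconc_one, insertOp_one,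
      deconc_insertHead, tmap_one]
  · simp only [LinearMap.comp_apply, LinearMap.add_apply] at hw ⊢
    set L := insertOp (tmap f) b (tmap g) with hL
    have h1 : L ∘ₗ LinearMap.mulLeft 𝕜 (ιₜ v) =
        LinearMap.mulLeft 𝕜 (ιₜ (f v)) ∘ₗ L +
          insertHead b (tmap g) ∘ₗ LinearMap.mulLeft 𝕜 (ιₜ v) := by
      ext y
      simp [hL, insertOp_cons]
    have h2 : tmap f ∘ₗ LinearMap.mulLeft 𝕜 (ιₜ v) =
        LinearMap.mulLeft 𝕜 (ιₜ (f v)) ∘ₗ tmap f := by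
      ext x
      simp
    have h3 : ∀ F G : Module.End 𝕜 (TensorAlgebra 𝕜 V), TensorProduct.map
        (LinearMap.mulLeft 𝕜 (ιₜ (f v)) ∘ₗ F) G (deconc 𝕜 V w) =
        (ιₜ (f v) ⊗ₜ[𝕜] 1) * TensorProduct.map F G (deconc 𝕜 V w) := by
      intro F G
      generalize deconc 𝕜 V w = z
      induction z with
      | zero => simp
      | tmul x y => simp
      | add x y hx hy => simp only [map_add, mul_add, hx, hy]
    have h4 : L (ιₜ v * w) = ιₜ (f v) * L w + insertHead b (tmap g) (ιₜ v * w) :=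
      insertOp_cons f b (tmap g) v w
    have h5 : L 1 = insertHead b (tmap g) 1 := insertOp_one f b (tmap g)
    rw [map_deconc_cons, map_deconc_cons, h1, h2, TensorProduct.map_add_left, LinearMap.add_apply,
      h3, h3, h4, map_add, deconc_cons, hw, deconc_insertHead, map_deconc_cons, mul_add, h5,
      TensorProduct.tmul_add, tmap_one]
    abel

/-- A map that satisfies a co-Leibniz rule is determined by its corestriction. -/
theorem eq_zero_of_coLeibniz {E f g : TensorAlgebra 𝕜 V →ₗ[𝕜] TensorAlgebra 𝕜 W}
    (hE : deconc 𝕜 W ∘ₗ E =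
      (TensorProduct.map E g + TensorProduct.map f E) ∘ₗ deconc 𝕜 V)
    {k : V →ₗ[𝕜] W} (hf : proj₁ 𝕜 W ∘ₗ f = k ∘ₗ proj₁ 𝕜 V)
    (h0 : counit 𝕜 W ∘ₗ E = 0) (h1 : proj₁ 𝕜 W ∘ₗ E = 0) : E = 0 := by
  -- Projecting the left tensor factor to letters kills `E ⊗ g` by `h1` and turns `f ⊗ E` into `k ⊗
  -- E`. Thus the value of `E` on a word is governed by its value on the tail.
  have key : splitHead 𝕜 W ∘ₗ E = TensorProduct.map k E ∘ₗ splitHead 𝕜 V := by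
    rw [splitHead, LinearMap.comp_assoc, hE, ← LinearMap.comp_assoc, LinearMap.comp_add,
      ← TensorProduct.map_comp, ← TensorProduct.map_comp, h1, hf, splitHead,
      ← LinearMap.comp_assoc, ← TensorProduct.map_comp]
    simp
  refine linearMap_ext_words ?_ fun v w hw => ?_
  · refine eq_zero_of_splitHead (congrArg (fun F => F 1) h0) ?_
    simpa using congrArg (fun F => F 1) key
  · refine eq_zero_of_splitHead (congrArg (fun F => F (ιₜ v * w)) h0) ?_
    have := congrArg (fun F => F (ιₜ v * w)) key
    simp only [LinearMap.comp_apply, splitHead_cons, TensorProduct.map_tmul, hw] at this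
    simpa using this

end Words

/-! ### The total grading, degrees of operators, and Koszul signs. -/

section Grading

variable {𝕜 : Type u} [Field 𝕜]
variable {V : Type v} [AddCommGroup V] [Module 𝕜 V] {𝒱 : ℤ → Submodule 𝕜 V}
variable {W : Type v} [AddCommGroup W] [Module 𝕜 W] {𝒲 : ℤ → Submodule 𝕜 W}
variable {U : Type v} [AddCommGroup U] [Module 𝕜 U] {𝒰 : ℤ → Submodule 𝕜 U}

theorem one_mem_totalGrading : (1 : TensorAlgebra 𝕜 V) ∈ totalGrading 𝒱 0 :=
  Submodule.subset_span ⟨[], by simp⟩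

theorem ι_mem_totalGrading {p : ℤ} {v : V} (hv : v ∈ 𝒱 p) :
    TensorAlgebra.ι 𝕜 v ∈ totalGrading 𝒱 (p - 1) :=
  Submodule.subset_span ⟨[⟨p, v, hv⟩], by simp⟩

theorem mul_mem_totalGrading {m n : ℤ} {x y : TensorAlgebra 𝕜 V} (hx : x ∈ totalGrading 𝒱 m)
    (hy : y ∈ totalGrading 𝒱 n) : x * y ∈ totalGrading 𝒱 (m + n) := by
  induction hx, hy using Submodule.span_induction₂ with
  | mem_mem x y hx hy =>
    obtain ⟨l, hl, rfl⟩ := hx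
    obtain ⟨l', hl', rfl⟩ := hy
    exact Submodule.subset_span ⟨l ++ l', by simp [hl, hl'], by simp⟩
  | zero_left y hy => simp
  | zero_right x hx => simp
  | add_left x y z _ _ _ h1 h2 => rw [add_mul]; exact add_mem h1 h2
  | add_right x y z _ _ _ h1 h2 => rw [mul_add]; exact add_mem h1 h2
  | smul_left r x y _ _ h => rw [smul_mul_assoc]; exact Submodule.smul_mem _ _ h
  | smul_right r x y _ _ h => rw [mul_smul_comm]; exact Submodule.smul_mem _ _ h

theorem cons_mem_totalGrading {p n : ℤ} {v : V} (hv : v ∈ 𝒱 p) {x : TensorAlgebra 𝕜 V}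
    (hx : x ∈ totalGrading 𝒱 n) : TensorAlgebra.ι 𝕜 v * x ∈ totalGrading 𝒱 (p - 1 + n) :=
  mul_mem_totalGrading (ι_mem_totalGrading hv) hx

/-- Induction over words in homogeneous letters, for a family of submodules that varies with the
degree. -/
theorem totalGrading_le (S : ℤ → Submodule 𝕜 (TensorAlgebra 𝕜 V)) (one : 1 ∈ S 0)
    (cons : ∀ p n v, v ∈ 𝒱 p → ∀ w ∈ totalGrading 𝒱 n, w ∈ S n →
      TensorAlgebra.ι 𝕜 v * w ∈ S (p - 1 + n)) (n : ℤ) : totalGrading 𝒱 n ≤ S n := by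
  rw [totalGrading, Submodule.span_le]
  rintro _ ⟨l, hl, rfl⟩
  subst hl
  induction l with
  | nil => simpa using one
  | cons a l ih =>
    simpa using cons a.1 _ a.2 a.2.2 _ (Submodule.subset_span ⟨l, rfl, rfl⟩) ih

theorem counit_of_mem_totalGrading {n : ℤ} (hn : n ≠ 0) {x : TensorAlgebra 𝕜 V}
    (hx : x ∈ totalGrading 𝒱 n) : counit 𝕜 V x = 0 := by
  let S : ℤ → Submodule 𝕜 (TensorAlgebra 𝕜 V) := fun n =>
    ⨅ _ : n ≠ 0, LinearMap.ker (counit 𝕜 V)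
  have := totalGrading_le (𝒱 := 𝒱) S (by simp [S]) (by simp [S]) n hx
  simpa [S, hn] using this

theorem counit_smul_mem {n : ℤ} {x : TensorAlgebra 𝕜 V} (hx : x ∈ totalGrading 𝒱 n) {p : ℤ}
    {w : W} (hw : w ∈ 𝒲 p) : counit 𝕜 V x • w ∈ 𝒲 (n + p) := by
  by_cases hn : n = 0
  · subst hn
    simpa using Submodule.smul_mem _ _ hw
  · rw [counit_of_mem_totalGrading hn hx, zero_smul]
    exact zero_mem _

theorem proj₁_mem {n : ℤ} {x : TensorAlgebra 𝕜 V} (hx : x ∈ totalGrading 𝒱 n) :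
    proj₁ 𝕜 V x ∈ 𝒱 (n + 1) := by
  refine totalGrading_le (𝒱 := 𝒱) (fun n => (𝒱 (n + 1)).comap (proj₁ 𝕜 V)) (by simp)
    (fun p n v hv w hw _ => ?_) n hx
  rw [Submodule.mem_comap, proj₁_cons]
  have := counit_smul_mem hw hv
  rwa [show p - 1 + n + 1 = n + p by ring]

theorem HasDegree.comp {k l : ℤ} {G : TensorAlgebra 𝕜 W →ₗ[𝕜] TensorAlgebra 𝕜 U}
    {F : TensorAlgebra 𝕜 V →ₗ[𝕜] TensorAlgebra 𝕜 W} (hG : HasDegree 𝒲 𝒰 l G)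
    (hF : HasDegree 𝒱 𝒲 k F) : HasDegree 𝒱 𝒰 (k + l) (G ∘ₗ F) := by
  intro n x hx
  rw [← add_assoc]
  exact hG _ _ (hF _ _ hx)

theorem HasDegree.comp_of_eq {k l m : ℤ} {G : TensorAlgebra 𝕜 W →ₗ[𝕜] TensorAlgebra 𝕜 U}
    {F : TensorAlgebra 𝕜 V →ₗ[𝕜] TensorAlgebra 𝕜 W} (hG : HasDegree 𝒲 𝒰 l G)
    (hF : HasDegree 𝒱 𝒲 k F) (h : k + l = m) : HasDegree 𝒱 𝒰 m (G ∘ₗ F) :=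
  h ▸ hG.comp hF

theorem HasDegree.add {k : ℤ} {F G : TensorAlgebra 𝕜 V →ₗ[𝕜] TensorAlgebra 𝕜 W}
    (hF : HasDegree 𝒱 𝒲 k F) (hG : HasDegree 𝒱 𝒲 k G) : HasDegree 𝒱 𝒲 k (F + G) :=
  fun n x hx => add_mem (hF n x hx) (hG n x hx)

theorem HasDegree.sub {k : ℤ} {F G : TensorAlgebra 𝕜 V →ₗ[𝕜] TensorAlgebra 𝕜 W}
    (hF : HasDegree 𝒱 𝒲 k F) (hG : HasDegree 𝒱 𝒲 k G) : HasDegree 𝒱 𝒲 k (F - G) :=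
  fun n x hx => sub_mem (hF n x hx) (hG n x hx)

theorem hasDegree_id : HasDegree 𝒱 𝒱 0 (LinearMap.id : Module.End 𝕜 (TensorAlgebra 𝕜 V)) :=
  fun n x hx => by simpa using hx

theorem hasDegree_tmap {f : V →ₗ[𝕜] W} (hf : ∀ p, ∀ v ∈ 𝒱 p, f v ∈ 𝒲 p) :
    HasDegree 𝒱 𝒲 0 (tmap f) := by
  intro n x hx
  rw [add_zero]
  refine totalGrading_le (𝒱 := 𝒱) (fun n => (totalGrading 𝒲 n).comap (tmap f)) ?_ ?_ n hx
  · simpa using one_mem_totalGrading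
  · intro p n v hv w _ hw'
    rw [Submodule.mem_comap] at hw' ⊢
    rw [tmap_cons]
    exact cons_mem_totalGrading (hf p v hv) hw'

theorem hasDegree_insertHead {g : Module.End 𝕜 (TensorAlgebra 𝕜 V)} (hg : HasDegree 𝒱 𝒱 0 g)
    (g_one : g 1 = 1) {k : ℤ} {b : TensorAlgebra 𝕜 V →ₗ[𝕜] V}
    (hb : ∀ n, ∀ x ∈ totalGrading 𝒱 n, b x ∈ 𝒱 (n + 1 + k)) :
    HasDegree 𝒱 𝒱 k (insertHead b g) := by
  intro n x hx
  -- Absorbing a letter of `V_p` into `b` also shifts its degree by `p - 1`; the induction therefore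
  -- runs over all `k` as well as all `b`.
  let S : ℤ → Submodule 𝕜 (TensorAlgebra 𝕜 V) := fun n =>
    ⨅ k : ℤ, ⨅ b : TensorAlgebra 𝕜 V →ₗ[𝕜] V,
      ⨅ _ : ∀ n, ∀ x ∈ totalGrading 𝒱 n, b x ∈ 𝒱 (n + 1 + k),
        (totalGrading 𝒱 (n + k)).comap (insertHead b g)
  have : x ∈ S n := by
    refine totalGrading_le (𝒱 := 𝒱) S ?_ ?_ n hx
    · simp only [S, Submodule.mem_iInf, Submodule.mem_comap]
      intro k b hb
      have := ι_mem_totalGrading (hb 0 1 one_mem_totalGrading)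
      rw [insertHead_one, g_one, mul_one]
      rwa [show 0 + k = 0 + 1 + k - 1 by ring]
    · intro p n v hv w hw hS
      simp only [S, Submodule.mem_iInf, Submodule.mem_comap] at hS ⊢
      intro k b hb
      rw [insertHead_cons]
      refine add_mem ?_ ?_
      · have := hS (k + p - 1) (b ∘ₗ LinearMap.mulLeft 𝕜 (TensorAlgebra.ι 𝕜 v)) fun m y hy => by
          have := hb _ _ (cons_mem_totalGrading hv hy)
          rwa [show m + 1 + (k + p - 1) = p - 1 + m + 1 + k by ring]
        rwa [show p - 1 + n + k = n + (k + p - 1) by ring]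
      · have := cons_mem_totalGrading (hb 0 1 one_mem_totalGrading)
          (hg _ _ (cons_mem_totalGrading hv hw))
        rwa [show p - 1 + n + k = 0 + 1 + k - 1 + (p - 1 + n + 0) by ring]
  simp only [S, Submodule.mem_iInf, Submodule.mem_comap] at this
  exact this k b hb

theorem hasDegree_insertOp {f : V →ₗ[𝕜] V} (hf : ∀ p, ∀ v ∈ 𝒱 p, f v ∈ 𝒱 p)
    {g : Module.End 𝕜 (TensorAlgebra 𝕜 V)} (hg : HasDegree 𝒱 𝒱 0 g)
    (g_one : g 1 = 1) {k : ℤ} {b : TensorAlgebra 𝕜 V →ₗ[𝕜] V}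
    (hb : ∀ n, ∀ x ∈ totalGrading 𝒱 n, b x ∈ 𝒱 (n + 1 + k)) :
    HasDegree 𝒱 𝒱 k (insertOp (tmap f) b g) := by
  have hN := hasDegree_insertHead hg g_one hb
  intro n x hx
  refine totalGrading_le (𝒱 := 𝒱)
    (fun n => (totalGrading 𝒱 (n + k)).comap (insertOp (tmap f) b g)) ?_ ?_ n hx
  · rw [Submodule.mem_comap, insertOp_one]
    exact hN _ _ one_mem_totalGrading
  · intro p n v hv w hw hw'
    rw [Submodule.mem_comap, insertOp_cons]
    refine add_mem ?_ (hN _ _ (cons_mem_totalGrading hv hw))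
    rw [add_assoc]
    exact cons_mem_totalGrading (hf p v hv) hw'

variable [DirectSum.Decomposition 𝒱]

theorem koszul_of_mem {p : ℤ} {v : V} (hv : v ∈ 𝒱 p) :
    koszul 𝒱 v = (-1 : 𝕜) ^ (p - 1) • v := by
  have := DirectSum.decomposeLinearEquiv_apply_coe (R := 𝕜) 𝒱 p ⟨v, hv⟩
  simp only at this
  simp [koszul, this]

theorem koszul_mem {p : ℤ} {v : V} (hv : v ∈ 𝒱 p) : koszul 𝒱 v ∈ 𝒱 p := by
  rw [koszul_of_mem hv]
  exact Submodule.smul_mem _ _ hv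

theorem linearMap_ext_homogeneous (𝒱 : ℤ → Submodule 𝕜 V) [DirectSum.Decomposition 𝒱]
    {M : Type*} [AddCommGroup M] [Module 𝕜 M]
    {F G : V →ₗ[𝕜] M} (h : ∀ p, ∀ v ∈ 𝒱 p, F v = G v) : F = G := by
  ext v
  induction v using DirectSum.Decomposition.inductionOn 𝒱 with
  | zero => simp
  | homogeneous m => exact h _ m m.2
  | add m m' h1 h2 => rw [map_add, map_add, h1, h2]

theorem neg_one_zpow_mul_self (n : ℤ) : (-1 : 𝕜) ^ n * (-1 : 𝕜) ^ n = 1 := by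
  rw [← mul_zpow]
  simp

@[simp] theorem koszul_koszul (v : V) : koszul 𝒱 (koszul 𝒱 v) = v := by
  have : koszul 𝒱 ∘ₗ koszul 𝒱 = LinearMap.id := by
    refine linearMap_ext_homogeneous 𝒱 fun p v hv => ?_
    rw [LinearMap.comp_apply, koszul_of_mem hv, map_smul, koszul_of_mem hv, smul_smul,
      neg_one_zpow_mul_self, one_smul, LinearMap.id_apply]
  exact congrArg (fun F => F v) this

theorem tmap_koszul_tmap_koszul : tmap (koszul 𝒱) ∘ₗ tmap (koszul 𝒱) = LinearMap.id := by
  rw [tmap_comp_tmap, ← tmap_id]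
  congr 1
  ext v
  simp

/-- The signs (-1)^(p-1) of the letters multiply up, so T(koszul) is the parity operator of the
total degree. -/
theorem tmap_koszul_of_mem {n : ℤ} {x : TensorAlgebra 𝕜 V} (hx : x ∈ totalGrading 𝒱 n) :
    tmap (koszul 𝒱) x = (-1 : 𝕜) ^ n • x := by
  refine totalGrading_le (𝒱 := 𝒱)
    (fun n => LinearMap.eqLocus (tmap (koszul 𝒱)) ((-1 : 𝕜) ^ n • LinearMap.id)) ?_ ?_ n hx
  · simp
  · intro p n v hv w _ hw
    rw [LinearMap.mem_eqLocus] at hw ⊢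
    rw [tmap_cons, hw, koszul_of_mem hv]
    simp [smul_smul, zpow_add₀, mul_comm]

theorem mem_of_totalGrading_le (𝒱 : ℤ → Submodule 𝕜 V) [DirectSum.Decomposition 𝒱]
    (S : Submodule 𝕜 (TensorAlgebra 𝕜 V)) (h : ∀ n, totalGrading 𝒱 n ≤ S)
    (x : TensorAlgebra 𝕜 V) : x ∈ S := by
  have : x ∈ ⨆ n, totalGrading 𝒱 n := by
    refine submodule_eq_top_of_words _
      (Submodule.mem_iSup_of_mem 0 one_mem_totalGrading) (fun v w hw => ?_) x
    induction hw using Submodule.iSup_induction' with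
    | zero => simp
    | add y z _ _ hy hz => rw [mul_add]; exact add_mem hy hz
    | mem n y hy =>
      induction v using DirectSum.Decomposition.inductionOn 𝒱 with
      | zero => simp
      | homogeneous m =>
        exact Submodule.mem_iSup_of_mem _ (cons_mem_totalGrading m.2 hy)
      | add m m' h1 h2 => rw [map_add, add_mul]; exact add_mem h1 h2
  exact iSup_le h this

theorem linearMap_ext_totalGrading (𝒱 : ℤ → Submodule 𝕜 V) [DirectSum.Decomposition 𝒱]
    {M : Type*} [AddCommGroup M] [Module 𝕜 M]
    {F G : TensorAlgebra 𝕜 V →ₗ[𝕜] M} (h : ∀ n, ∀ x ∈ totalGrading 𝒱 n, F x = G x) : F = G := by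
  ext x
  exact mem_of_totalGrading_le 𝒱 (LinearMap.eqLocus F G) (fun n x hx => h n x hx) x

theorem HasDegree.tmap_koszul_comp [DirectSum.Decomposition 𝒲] {k : ℤ}
    {F : TensorAlgebra 𝕜 V →ₗ[𝕜] TensorAlgebra 𝕜 W} (hF : HasDegree 𝒱 𝒲 k F) :
    tmap (koszul 𝒲) ∘ₗ F = (-1 : 𝕜) ^ k • (F ∘ₗ tmap (koszul 𝒱)) := by
  refine linearMap_ext_totalGrading 𝒱 fun n x hx => ?_
  rw [LinearMap.comp_apply, tmap_koszul_of_mem (hF n x hx), LinearMap.smul_apply,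
    LinearMap.comp_apply, tmap_koszul_of_mem hx, map_smul, smul_smul, add_comm,
    zpow_add₀ (by simp)]

/-! ### Homogeneous components -/

variable (𝒱) in
/-- The algebra map that sends a homogeneous letter `v ∈ V_p` to `v t^{p-1}`. -/
def gradingCoaction : TensorAlgebra 𝕜 V →ₐ[𝕜] AddMonoidAlgebra (TensorAlgebra 𝕜 V) ℤ :=
  TensorAlgebra.lift 𝕜 (DirectSum.toModule 𝕜 ℤ _ (fun p =>
    AddMonoidAlgebra.lsingle (p - 1) ∘ₗ TensorAlgebra.ι 𝕜 ∘ₗ (𝒱 p).subtype) ∘ₗ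
    (DirectSum.decomposeLinearEquiv 𝒱).toLinearMap)

theorem gradingCoaction_ι {p : ℤ} {v : V} (hv : v ∈ 𝒱 p) :
    gradingCoaction 𝒱 (TensorAlgebra.ι 𝕜 v) =
      AddMonoidAlgebra.single (p - 1) (TensorAlgebra.ι 𝕜 v) := by
  have := DirectSum.decomposeLinearEquiv_apply_coe (R := 𝕜) 𝒱 p ⟨v, hv⟩
  simp only at this
  simp [gradingCoaction, this]

variable (𝒱) in
/-- The projection of `T(sV)` onto its part of degree `n`. -/
def totalComponent (n : ℤ) : Module.End 𝕜 (TensorAlgebra 𝕜 V) :=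
  Finsupp.lapply n ∘ₗ (AddMonoidAlgebra.coeffLinearEquiv 𝕜).toLinearMap ∘ₗ
    (gradingCoaction 𝒱).toLinearMap

theorem totalComponent_apply (n : ℤ) (x : TensorAlgebra 𝕜 V) :
    totalComponent 𝒱 n x = (gradingCoaction 𝒱 x).coeff n := rfl

theorem gradingCoaction_of_mem {n : ℤ} {x : TensorAlgebra 𝕜 V} (hx : x ∈ totalGrading 𝒱 n) :
    gradingCoaction 𝒱 x = AddMonoidAlgebra.single n x := by
  refine totalGrading_le (𝒱 := 𝒱) (fun n => LinearMap.eqLocus (gradingCoaction 𝒱).toLinearMap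
    (AddMonoidAlgebra.lsingle n)) ?_ ?_ n hx
  · rw [LinearMap.mem_eqLocus, AlgHom.toLinearMap_apply, map_one, AddMonoidAlgebra.lsingle_apply]
    rfl
  · intro p n v hv w _ hw
    simp only [LinearMap.mem_eqLocus, AlgHom.toLinearMap_apply,
      AddMonoidAlgebra.lsingle_apply] at hw ⊢
    rw [map_mul, hw, gradingCoaction_ι hv, AddMonoidAlgebra.single_mul_single]

theorem totalComponent_of_mem {n : ℤ} {x : TensorAlgebra 𝕜 V} (hx : x ∈ totalGrading 𝒱 n) :
    totalComponent 𝒱 n x = x := by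
  rw [totalComponent_apply, gradingCoaction_of_mem hx, AddMonoidAlgebra.coeff_single,
    Finsupp.single_eq_same]

theorem totalComponent_of_mem_ne {m n : ℤ} (h : m ≠ n) {x : TensorAlgebra 𝕜 V}
    (hx : x ∈ totalGrading 𝒱 n) : totalComponent 𝒱 m x = 0 := by
  rw [totalComponent_apply, gradingCoaction_of_mem hx, AddMonoidAlgebra.coeff_single,
    Finsupp.single_eq_of_ne h]

theorem totalComponent_mem (n : ℤ) (x : TensorAlgebra 𝕜 V) :
    totalComponent 𝒱 n x ∈ totalGrading 𝒱 n := by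
  refine mem_of_totalGrading_le 𝒱 ((totalGrading 𝒱 n).comap (totalComponent 𝒱 n))
    (fun m x hx => ?_) x
  rw [Submodule.mem_comap]
  by_cases h : n = m
  · subst h
    rwa [totalComponent_of_mem hx]
  · rw [totalComponent_of_mem_ne h hx]
    exact zero_mem _

/-- Having degree `k` becomes a commutation relation with the projections onto homogeneous parts.
For `k = 0` such a relation passes to inverses, which is how the degree of Σ_γ is controlled. -/
theorem hasDegree_iff [DirectSum.Decomposition 𝒲] {k : ℤ}
    {F : TensorAlgebra 𝕜 V →ₗ[𝕜] TensorAlgebra 𝕜 W} :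
    HasDegree 𝒱 𝒲 k F ↔
      ∀ n, totalComponent 𝒲 (n + k) ∘ₗ F = F ∘ₗ totalComponent 𝒱 n := by
  constructor
  · intro hF n
    refine linearMap_ext_totalGrading 𝒱 fun m x hx => ?_
    rw [LinearMap.comp_apply, LinearMap.comp_apply]
    by_cases h : n = m
    · subst h
      rw [totalComponent_of_mem hx, totalComponent_of_mem (hF _ _ hx)]
    · rw [totalComponent_of_mem_ne h hx, map_zero,
        totalComponent_of_mem_ne (by simpa using h) (hF _ _ hx)]
  · intro hF n x hx
    have := congrArg (fun G => G x) (hF n)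
    simp only [LinearMap.comp_apply, totalComponent_of_mem hx] at this
    rw [← this]
    exact totalComponent_mem _ _

theorem HasDegree.inverse {F : Module.End 𝕜 (TensorAlgebra 𝕜 V)} (hF : HasDegree 𝒱 𝒱 0 F)
    (hu : IsUnit F) : HasDegree 𝒱 𝒱 0 (Ring.inverse F) := by
  rw [hasDegree_iff] at hF ⊢
  intro n
  have h := hF n
  rw [add_zero] at h ⊢
  change totalComponent 𝒱 n * F = F * totalComponent 𝒱 n at h
  change totalComponent 𝒱 n * Ring.inverse F = Ring.inverse F * totalComponent 𝒱 n
  have h1 := Ring.inverse_mul_cancel F hu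
  have h2 := Ring.mul_inverse_cancel F hu
  calc totalComponent 𝒱 n * Ring.inverse F
      = Ring.inverse F * (F * totalComponent 𝒱 n) * Ring.inverse F := by
        rw [← mul_assoc, h1, one_mul]
    _ = Ring.inverse F * totalComponent 𝒱 n * (F * Ring.inverse F) := by
        rw [← h]
        simp only [mul_assoc]
    _ = Ring.inverse F * totalComponent 𝒱 n := by rw [h2, mul_one]

end Grading

/-! ### Contractions, group-like elements, and the induced form on the tensor coalgebra. -/

section Form

variable {𝕜 : Type u} [Field 𝕜]
variable {V : Type v} [AddCommGroup V] [Module 𝕜 V] {𝒱 : ℤ → Submodule 𝕜 V}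

/-- Contraction of the first letter of a word with a linear form. -/
def contract (f : V →ₗ[𝕜] 𝕜) : Module.End 𝕜 (TensorAlgebra 𝕜 V) :=
  (TensorProduct.lid 𝕜 (TensorAlgebra 𝕜 V)).toLinearMap ∘ₗ
    TensorProduct.map f LinearMap.id ∘ₗ splitHead 𝕜 V

theorem contractHead_apply (β : V →ₗ[𝕜] V →ₗ[𝕜] 𝕜) (v : V) :
    contractHead β v = contract (β v) := by
  change _ ∘ₗ TensorProduct.map (β v ∘ₗ proj₁ 𝕜 V) LinearMap.id ∘ₗ deconc 𝕜 V = _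
  have h : TensorProduct.map (β v ∘ₗ proj₁ 𝕜 V) (LinearMap.id : Module.End 𝕜 (TensorAlgebra 𝕜 V)) =
      TensorProduct.map (β v) LinearMap.id ∘ₗ TensorProduct.map (proj₁ 𝕜 V) LinearMap.id := by
    rw [← TensorProduct.map_comp, LinearMap.id_comp]
  rw [h]
  rfl

@[simp] theorem contract_one (f : V →ₗ[𝕜] 𝕜) : contract f 1 = 0 := by simp [contract]

@[simp] theorem contract_cons (f : V →ₗ[𝕜] 𝕜) (v : V) (x : TensorAlgebra 𝕜 V) :
    contract f (TensorAlgebra.ι 𝕜 v * x) = f v • x := by simp [contract]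

variable (𝕜 V) in
/-- The elements of `T(sV)` that are killed by any `n` successive contractions. -/
def contractionNilpotent : ℕ → Submodule 𝕜 (TensorAlgebra 𝕜 V)
  | 0 => ⊥
  | n + 1 => ⨅ f : V →ₗ[𝕜] 𝕜, (contractionNilpotent n).comap (contract f)

theorem contractionNilpotent_mono : Monotone (contractionNilpotent 𝕜 V) := by
  refine monotone_nat_of_le_succ fun n => ?_
  induction n with
  | zero => exact bot_le
  | succ n ih => exact iInf_mono fun f => Submodule.comap_mono ih

/-- A word of length `n` is killed by `n + 1` contractions. This filtration plays the role of word
length in the inductions below. -/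
theorem exists_mem_contractionNilpotent (x : TensorAlgebra 𝕜 V) :
    ∃ n, x ∈ contractionNilpotent 𝕜 V n := by
  rw [← Submodule.mem_iSup_of_directed _ contractionNilpotent_mono.directed_le]
  refine submodule_eq_top_of_words _ ?_ (fun v w hw => ?_) x
  · exact Submodule.mem_iSup_of_mem 1 (by simp [contractionNilpotent])
  · rw [Submodule.mem_iSup_of_directed _ contractionNilpotent_mono.directed_le] at hw
    obtain ⟨n, hn⟩ := hw
    refine Submodule.mem_iSup_of_mem (n + 1) ?_
    simp only [contractionNilpotent, Submodule.mem_iInf, Submodule.mem_comap, contract_cons]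
    exact fun f => Submodule.smul_mem _ _ hn

/-- The only group-like element of the tensor coalgebra is `1`. -/
theorem eq_one_of_groupLike {x : TensorAlgebra 𝕜 V} (h0 : counit 𝕜 V x = 1)
    (hx : deconc 𝕜 V x = x ⊗ₜ[𝕜] x) : x = 1 := by
  have hs : splitHead 𝕜 V x = proj₁ 𝕜 V x ⊗ₜ[𝕜] x := by simp [splitHead, hx]
  by_cases hp : proj₁ 𝕜 V x = 0
  · rw [eq_counit_add_splitHead x, hs, hp, h0]
    simp
  · exfalso
    -- Splitting off the head of a group-like `x` returns `x` as the tail, so contraction with an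
    -- `f` that is 1 on `proj₁ x` fixes `x`. Contractions being nilpotent on `x`, this forces `x =
    -- 0`, against counit 1.
    obtain ⟨f, hf⟩ := Module.Projective.exists_dual_eq_one 𝕜 hp
    have hc : contract f x = x := by simp [contract, hs, hf]
    obtain ⟨n, hn⟩ := exists_mem_contractionNilpotent x
    have hx0 : x = 0 := by
      induction n with
      | zero => simpa [contractionNilpotent] using hn
      | succ n ih =>
        simp only [contractionNilpotent, Submodule.mem_iInf, Submodule.mem_comap] at hn
        exact ih (hc ▸ hn f)
    simp [hx0] at h0

theorem tensorForm_one (β : V →ₗ[𝕜] V →ₗ[𝕜] 𝕜) (y : TensorAlgebra 𝕜 V) :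
    tensorForm β 1 y = counit 𝕜 V y := by
  simp [tensorForm]

/-- Prepending `v` is adjoint to contracting with `β v`. The lift in `tensorForm` takes values in
the opposite algebra precisely so that the first letter is contracted first. -/
theorem tensorForm_cons (β : V →ₗ[𝕜] V →ₗ[𝕜] 𝕜) (v : V) (x y : TensorAlgebra 𝕜 V) :
    tensorForm β (TensorAlgebra.ι 𝕜 v * x) y = tensorForm β x (contract (β v) y) := by
  simp [tensorForm, contractHead_apply]

@[simp] theorem tensorForm_one_one (β : V →ₗ[𝕜] V →ₗ[𝕜] 𝕜) : tensorForm β 1 1 = 1 := by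
  simp [tensorForm_one]

@[simp] theorem tensorForm_one_cons (β : V →ₗ[𝕜] V →ₗ[𝕜] 𝕜) (v : V) (x : TensorAlgebra 𝕜 V) :
    tensorForm β 1 (TensorAlgebra.ι 𝕜 v * x) = 0 := by
  simp [tensorForm_one]

@[simp] theorem tensorForm_cons_one (β : V →ₗ[𝕜] V →ₗ[𝕜] 𝕜) (v : V) (x : TensorAlgebra 𝕜 V) :
    tensorForm β (TensorAlgebra.ι 𝕜 v * x) 1 = 0 := by
  simp [tensorForm_cons]

@[simp] theorem tensorForm_cons_cons (β : V →ₗ[𝕜] V →ₗ[𝕜] 𝕜) (v u : V)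
    (x y : TensorAlgebra 𝕜 V) :
    tensorForm β (TensorAlgebra.ι 𝕜 v * x) (TensorAlgebra.ι 𝕜 u * y) =
      β v u * tensorForm β x y := by
  simp [tensorForm_cons]

theorem tensorForm_symm {β : V →ₗ[𝕜] V →ₗ[𝕜] 𝕜} (hβ : ∀ a b, β a b = β b a)
    (x y : TensorAlgebra 𝕜 V) : tensorForm β x y = tensorForm β y x := by
  have : tensorForm β = (tensorForm β).flip := by
    refine linearMap_ext_words ?_ fun v x hx => ?_
    · exact linearMap_ext_words (by simp) fun u y _ => by simp
    · refine linearMap_ext_words (by simp) fun u y _ => ?_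
      have := congrArg (fun F => F y) hx
      simp only [LinearMap.flip_apply] at this
      simp [hβ v u, this]
  exact congrArg (fun F => F x y) this

theorem tensorForm_tmap {W : Type v} [AddCommGroup W] [Module 𝕜 W] {β : V →ₗ[𝕜] V →ₗ[𝕜] 𝕜}
    {β' : W →ₗ[𝕜] W →ₗ[𝕜] 𝕜} {f : V →ₗ[𝕜] W} (hf : ∀ a b, β' (f a) (f b) = β a b)
    (x y : TensorAlgebra 𝕜 V) : tensorForm β' (tmap f x) (tmap f y) = tensorForm β x y := by
  have : (tensorForm β').compl₁₂ (tmap f) (tmap f) = tensorForm β := by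
    refine linearMap_ext_words ?_ fun v x hx => ?_
    · exact linearMap_ext_words (by simp) fun u y _ => by simp
    · refine linearMap_ext_words (by simp) fun u y _ => ?_
      have := congrArg (fun F => F y) hx
      simp only [LinearMap.compl₁₂_apply] at this
      simp [hf, this]
  exact congrArg (fun F => F x y) this

/-- Expand the tail factor of V ⊗ T(sV) in a basis. Contraction with `β v` pairs `v` with each
coefficient in `V`, so nondegeneracy kills every coefficient. -/
theorem splitHead_eq_zero {β : V →ₗ[𝕜] V →ₗ[𝕜] 𝕜} (hβ : ∀ a, (∀ b, β b a = 0) → a = 0)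
    {x : TensorAlgebra 𝕜 V} (hx : ∀ v, contract (β v) x = 0) : splitHead 𝕜 V x = 0 := by
  classical
  let b := Module.Basis.ofVectorSpace 𝕜 (TensorAlgebra 𝕜 V)
  let e := TensorProduct.equivFinsuppOfBasisRight (M := V) b
  have key : ∀ (f : V →ₗ[𝕜] 𝕜) (z : V ⊗[𝕜] TensorAlgebra 𝕜 V) (k),
      b.repr (TensorProduct.lid 𝕜 _ (TensorProduct.map f LinearMap.id z)) k = f (e z k) := by
    intro f z k
    induction z with
    | zero => simp
    | tmul v y => simp [e, mul_comm]
    | add y z hy hz => simp only [map_add, Finsupp.add_apply, hy, hz]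
  refine e.injective (Finsupp.ext fun k => ?_)
  rw [map_zero, Finsupp.zero_apply]
  refine hβ _ fun v => ?_
  rw [← key]
  have := hx v
  simp only [contract, LinearMap.comp_apply, LinearEquiv.coe_coe] at this
  rw [this]
  simp

/-- By adjunction, if `x` is orthogonal to everything then so is each contraction of `x` with some
`β v`. Induct on the number of contractions that kill `x`. -/
theorem tensorForm_nondegenerate {β : V →ₗ[𝕜] V →ₗ[𝕜] 𝕜} (hβ : ∀ a, (∀ b, β b a = 0) → a = 0)
    (x : TensorAlgebra 𝕜 V) (hx : ∀ y, tensorForm β y x = 0) : x = 0 := by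
  obtain ⟨n, hn⟩ := exists_mem_contractionNilpotent x
  induction n generalizing x with
  | zero => simpa [contractionNilpotent] using hn
  | succ n ih =>
    simp only [contractionNilpotent, Submodule.mem_iInf, Submodule.mem_comap] at hn
    refine eq_zero_of_splitHead (by simpa [tensorForm_one] using hx 1)
      (splitHead_eq_zero hβ fun v => ih _ (fun y => ?_) (hn _))
    rw [← tensorForm_cons]
    exact hx _

theorem tensorForm_graded {β : V →ₗ[𝕜] V →ₗ[𝕜] 𝕜}
    (hβ : ∀ m n : ℤ, m ≠ n → ∀ a ∈ 𝒱 m, ∀ b ∈ 𝒱 n, β a b = 0) (m n : ℤ) (hmn : m ≠ n)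
    (x : TensorAlgebra 𝕜 V) (hx : x ∈ totalGrading 𝒱 m) (y : TensorAlgebra 𝕜 V)
    (hy : y ∈ totalGrading 𝒱 n) : tensorForm β x y = 0 := by
  let S : ℤ → Submodule 𝕜 (TensorAlgebra 𝕜 V) := fun m =>
    ⨅ n : ℤ, ⨅ _ : m ≠ n, ⨅ y : totalGrading 𝒱 n, LinearMap.ker ((tensorForm β).flip y)
  have key : x ∈ S m := by
    refine totalGrading_le (𝒱 := 𝒱) S ?_ ?_ m hx
    · simp only [S, Submodule.mem_iInf, LinearMap.mem_ker, LinearMap.flip_apply, tensorForm_one]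
      exact fun n hn y => counit_of_mem_totalGrading hn.symm y.2
    · intro p m v hv x _ hS
      simp only [S, Submodule.mem_iInf, LinearMap.mem_ker, LinearMap.flip_apply] at hS ⊢
      intro n hn y
      let S' : ℤ → Submodule 𝕜 (TensorAlgebra 𝕜 V) := fun n =>
        ⨅ _ : p - 1 + m ≠ n, LinearMap.ker (tensorForm β (TensorAlgebra.ι 𝕜 v * x))
      have h' := totalGrading_le (𝒱 := 𝒱) S' (by simp [S']) (by
        intro q n u hu w hw _
        simp only [S', Submodule.mem_iInf, LinearMap.mem_ker, tensorForm_cons_cons]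
        intro hne
        -- Total degrees differ, so either the first letters or the tails already have different
        -- degrees.
        by_cases hpq : p = q
        · rw [hS n (by rintro rfl; exact hne (by rw [hpq])) ⟨w, hw⟩, mul_zero]
        · rw [hβ p q hpq v hv u hu, zero_mul]) n y.2
      simp only [S', Submodule.mem_iInf, LinearMap.mem_ker] at h'
      exact h' hn
  simp only [S, Submodule.mem_iInf, LinearMap.mem_ker, LinearMap.flip_apply] at key
  exact key n hmn ⟨y, hy⟩

end Form

section PerturbationLemma

/-! ### The homological perturbation lemma -/

section Ring

variable {R : Type*} [Ring R] {d δ h e s : R}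

/-- Multiplied by `1 - δ h` on the left and `1 - h δ` on the right, the claim collapses to `d δ + δ
d + δ δ = 0`. The left factor is a unit and the right one has the right inverse `1 + h s`, so both
can be cancelled. -/
theorem perturbation_mul_identity (hs : s = δ + δ * h * s) (hs' : s = δ + s * h * δ)
    (he : e = 1 + d * h + h * d) (hd : d * δ + δ * d + δ * δ = 0) (hu : IsUnit (1 - δ * h)) :
    s * e * s + s * d + d * s = 0 := by
  have h1 : (1 - δ * h) * s = δ := by
    linear_combination (norm := noncomm_ring) hs
  have h2 : s * (1 - h * δ) = δ := by
    linear_combination (norm := noncomm_ring) hs'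
  have h3 : (1 - h * δ) * (1 + h * s) = 1 := by
    linear_combination (norm := noncomm_ring) h * hs
  have h4 : (1 - δ * h) * (s * e * s + s * d + d * s) * (1 - h * δ) = 0 := by
    calc (1 - δ * h) * (s * e * s + s * d + d * s) * (1 - h * δ)
        = ((1 - δ * h) * s) * e * (s * (1 - h * δ)) + ((1 - δ * h) * s) * d * (1 - h * δ) +
          (1 - δ * h) * d * (s * (1 - h * δ)) := by noncomm_ring
      _ = d * δ + δ * d + δ * δ := by rw [h1, h2, he]; noncomm_ring
      _ = 0 := hd
  have h5 : (1 - δ * h) * (s * e * s + s * d + d * s) = 0 := by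
    calc _ = (1 - δ * h) * (s * e * s + s * d + d * s) * ((1 - h * δ) * (1 + h * s)) := by
          rw [h3, mul_one]
      _ = ((1 - δ * h) * (s * e * s + s * d + d * s) * (1 - h * δ)) * (1 + h * s) := by
          noncomm_ring
      _ = 0 := by rw [h4, zero_mul]
  exact (hu.mul_right_eq_zero).1 h5

end Ring

variable {𝕜 : Type*} [Field 𝕜] {M N : Type*} [AddCommGroup M] [Module 𝕜 M] [AddCommGroup N]
  [Module 𝕜 N]

variable (𝕜 M N) in
/-- A special contraction of a complex `(M, d)` to a complex `(N, dN)`, together with a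
perturbation `δ` of `d` to which the perturbation lemma applies. -/
structure PerturbedContraction where
  d : Module.End 𝕜 M
  h : Module.End 𝕜 M
  dN : Module.End 𝕜 N
  i : N →ₗ[𝕜] M
  p : M →ₗ[𝕜] N
  δ : Module.End 𝕜 M
  p_i : p ∘ₗ i = LinearMap.id
  p_d : p ∘ₗ d = dN ∘ₗ p
  i_d : i ∘ₗ dN = d ∘ₗ i
  homotopy : i ∘ₗ p = 1 + d * h + h * d
  h_i : h ∘ₗ i = 0
  p_h : p ∘ₗ h = 0
  h_h : h * h = 0
  d_δ : d * δ + δ * d + δ * δ = 0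
  isUnit : IsUnit (1 - δ * h)

namespace PerturbedContraction

variable (C : PerturbedContraction 𝕜 M N)

/-- The perturbed differential. -/
def D : Module.End 𝕜 M := C.d + C.δ

/-- `Σ = (1 - δ h)⁻¹ δ`. -/
def S : Module.End 𝕜 M := Ring.inverse (1 - C.δ * C.h) * C.δ

/-- The perturbed inclusion. -/
def I : N →ₗ[𝕜] M := C.i + C.h ∘ₗ C.S ∘ₗ C.i

/-- The perturbed projection. -/
def P : M →ₗ[𝕜] N := C.p + C.p ∘ₗ C.S ∘ₗ C.h

/-- The perturbed homotopy. -/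
def H : Module.End 𝕜 M := C.h + C.h * C.S * C.h

/-- The transferred differential. -/
def Dt : Module.End 𝕜 N := C.dN + C.p ∘ₗ C.S ∘ₗ C.i

theorem S_eq : C.S = C.δ + C.δ * C.h * C.S := by
  have h : (1 - C.δ * C.h) * C.S = C.δ := by
    rw [S, ← mul_assoc, Ring.mul_inverse_cancel _ C.isUnit, one_mul]
  linear_combination (norm := noncomm_ring) h

/-- From δ (1 - hδ) = (1 - δh) δ, the geometric recursion for Σ also unrolls on the right. -/
theorem S_eq' : C.S = C.δ + C.S * C.h * C.δ := by
  have h : C.S * (1 - C.h * C.δ) = C.δ := by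
    calc C.S * (1 - C.h * C.δ)
        = Ring.inverse (1 - C.δ * C.h) * (1 - C.δ * C.h) * C.δ := by rw [S]; noncomm_ring
      _ = C.δ := by rw [Ring.inverse_mul_cancel _ C.isUnit, one_mul]
  linear_combination (norm := noncomm_ring) h

theorem S_identity : C.S * (C.i ∘ₗ C.p) * C.S + C.S * C.d + C.d * C.S = 0 :=
  perturbation_mul_identity C.S_eq C.S_eq' C.homotopy C.d_δ C.isUnit

theorem I_eq : C.I = (1 + C.h * C.S) ∘ₗ C.i := rfl

theorem P_eq : C.P = C.p ∘ₗ (1 + C.S * C.h) := by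
  rw [LinearMap.comp_add]
  rfl

theorem h_comp_I : C.h ∘ₗ C.I = 0 := by
  have : C.h * (1 + C.h * C.S) = C.h + C.h * C.h * C.S := by noncomm_ring
  rw [I_eq, ← LinearMap.comp_assoc]
  change (C.h * (1 + C.h * C.S)) ∘ₗ C.i = 0
  rw [this, C.h_h, zero_mul, add_zero, C.h_i]

theorem P_comp_h : C.P ∘ₗ C.h = 0 := by
  have : (1 + C.S * C.h) * C.h = C.h + C.S * (C.h * C.h) := by noncomm_ring
  rw [P_eq, LinearMap.comp_assoc]
  change C.p ∘ₗ ((1 + C.S * C.h) * C.h) = 0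
  rw [this, C.h_h, mul_zero, add_zero, C.p_h]

theorem p_comp_I : C.p ∘ₗ C.I = LinearMap.id := by
  rw [I, LinearMap.comp_add, ← LinearMap.comp_assoc, C.p_h, LinearMap.zero_comp, add_zero, C.p_i]

theorem P_comp_I : C.P ∘ₗ C.I = LinearMap.id := by
  rw [P, LinearMap.add_comp, p_comp_I, LinearMap.comp_assoc, LinearMap.comp_assoc, h_comp_I]
  simp

theorem H_eq : C.H = (1 + C.h * C.S) * C.h := by rw [H]; noncomm_ring

theorem H_eq' : C.H = C.h * (1 + C.S * C.h) := by rw [H]; noncomm_ring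

/-- By `S_identity`, 1 + hΣ intertwines d + ipΣ with D; and d + ipΣ carries the image of i to
itself, acting there as the transferred differential. -/
theorem D_comp_I : C.D ∘ₗ C.I = C.I ∘ₗ C.Dt := by
  have key : C.D * (1 + C.h * C.S) =
      (1 + C.h * C.S) * (C.d + (C.i ∘ₗ C.p) * C.S) := by
    have h1 := C.S_identity
    have h2 := C.homotopy
    have h3 := C.S_eq
    rw [D]
    linear_combination (norm := noncomm_ring) - C.h * h1 - h2 * C.S - h3
  have h : C.i ∘ₗ C.Dt = (C.d + (C.i ∘ₗ C.p) * C.S) ∘ₗ C.i := by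
    rw [Dt, LinearMap.comp_add, C.i_d]
    rfl
  rw [I_eq, LinearMap.comp_assoc, h, ← LinearMap.comp_assoc, ← LinearMap.comp_assoc]
  exact congrArg (fun F => F ∘ₗ C.i) key

theorem P_comp_D : C.P ∘ₗ C.D = C.Dt ∘ₗ C.P := by
  have key : (1 + C.S * C.h) * C.D =
      (C.d + C.S * (C.i ∘ₗ C.p)) * (1 + C.S * C.h) := by
    have h1 := C.S_identity
    have h2 := C.homotopy
    have h3 := C.S_eq'
    rw [D]
    linear_combination (norm := noncomm_ring) - h1 * C.h - C.S * h2 - h3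
  have h : C.Dt ∘ₗ C.p = C.p ∘ₗ (C.d + C.S * (C.i ∘ₗ C.p)) := by
    rw [Dt, LinearMap.add_comp, ← C.p_d, LinearMap.comp_add]
    rfl
  rw [P_eq, ← LinearMap.comp_assoc, h, LinearMap.comp_assoc, LinearMap.comp_assoc]
  exact congrArg (fun F => C.p ∘ₗ F) key

theorem I_comp_P : C.I ∘ₗ C.P = 1 + C.D * C.H + C.H * C.D := by
  have h0 : C.I ∘ₗ C.P = (1 + C.h * C.S) * (C.i ∘ₗ C.p) * (1 + C.S * C.h) := by
    rw [I_eq, P_eq]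
    rfl
  have h1 := C.S_identity
  have h2 := C.homotopy
  have h3 := C.S_eq
  have h4 := C.S_eq'
  rw [h0, D, H]
  linear_combination (norm := noncomm_ring) C.h * h1 * C.h + h2 + h2 * C.S * C.h +
    C.h * C.S * h2 + h3 * C.h + C.h * h4

theorem P_comp_D_comp_I : C.P ∘ₗ C.D ∘ₗ C.I = C.Dt := by
  rw [D_comp_I, ← LinearMap.comp_assoc, P_comp_I, LinearMap.id_comp]

theorem Dt_comp_Dt (hD : C.D ∘ₗ C.D = 0) : C.Dt ∘ₗ C.Dt = 0 := by
  nth_rw 1 [← C.P_comp_D_comp_I]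
  rw [LinearMap.comp_assoc, LinearMap.comp_assoc, ← D_comp_I, ← LinearMap.comp_assoc C.I, hD]
  simp

/-! ### Transfer of coalgebra structures -/

section Coalgebra

variable {ΔM : M →ₗ[𝕜] M ⊗[𝕜] M} {ΔN : N →ₗ[𝕜] N ⊗[𝕜] N} {K : Module.End 𝕜 M}

/-- The perturbed homotopy on `M ⊗ M`. -/
def H₂ (K : Module.End 𝕜 M) : Module.End 𝕜 (M ⊗[𝕜] M) :=
  TensorProduct.map C.H (C.I ∘ₗ C.P) + TensorProduct.map K C.H

/-- The perturbed differential on `M ⊗ M`. -/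
def D₂ (K : Module.End 𝕜 M) : Module.End 𝕜 (M ⊗[𝕜] M) :=
  TensorProduct.map C.D 1 + TensorProduct.map K C.D

/-- Tensor product of homotopies: since K anticommutes with D and H, and D commutes with E = IP, the
cross terms cancel. What remains is (E - 1) ⊗ E + 1 ⊗ (E - 1), which telescopes to E ⊗ E - 1 ⊗ 1. -/
theorem D₂_mul_H₂ (hKK : K * K = 1) (hKD : K * C.D = -(C.D * K)) (hKH : K * C.H = -(C.H * K)) :
    TensorProduct.map (C.I ∘ₗ C.P) (C.I ∘ₗ C.P) =
      1 + C.D₂ K * C.H₂ K + C.H₂ K * C.D₂ K := by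
  have hE := C.I_comp_P
  have hDE : C.D * (C.I ∘ₗ C.P) = (C.I ∘ₗ C.P) * C.D := by
    change C.D ∘ₗ C.I ∘ₗ C.P = (C.I ∘ₗ C.P) ∘ₗ C.D
    rw [← LinearMap.comp_assoc, D_comp_I, LinearMap.comp_assoc, LinearMap.comp_assoc, P_comp_D]
  have neg_left : ∀ a b : Module.End 𝕜 M, TensorProduct.map (-a) b = -TensorProduct.map a b := by
    intro a b
    exact TensorProduct.ext' fun x y => by simp [TensorProduct.neg_tmul]
  set E : Module.End 𝕜 M := C.I ∘ₗ C.P with hE'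
  have h1 : C.D₂ K * C.H₂ K + C.H₂ K * C.D₂ K =
      TensorProduct.map (C.D * C.H + C.H * C.D) E +
        TensorProduct.map 1 (C.D * C.H + C.H * C.D) := by
    simp only [D₂, H₂, mul_add, add_mul, ← TensorProduct.map_mul, ← hE', hKK, hKD, hKH, hDE,
      neg_left, one_mul, mul_one, TensorProduct.map_add_left, TensorProduct.map_add_right]
    abel
  have h2 : C.D * C.H + C.H * C.D = E - 1 := by rw [hE]; abel
  rw [add_assoc, h1, h2]
  have h3 : TensorProduct.map E E = TensorProduct.map (E - 1) E + TensorProduct.map 1 E := by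
    rw [← TensorProduct.map_add_left, sub_add_cancel]
  have h4 : TensorProduct.map (1 : Module.End 𝕜 M) E =
      TensorProduct.map 1 (E - 1) + TensorProduct.map 1 1 := by
    rw [← TensorProduct.map_add_right, sub_add_cancel]
  rw [h3, h4, TensorProduct.map_one]
  abel

variable (hp : ΔN ∘ₗ C.p = TensorProduct.map C.p C.p ∘ₗ ΔM)
  (hh : ΔM ∘ₗ C.h = (TensorProduct.map C.h (C.i ∘ₗ C.p) + TensorProduct.map K C.h) ∘ₗ ΔM)
  (hD : ΔM ∘ₗ C.D = (TensorProduct.map C.D 1 + TensorProduct.map K C.D) ∘ₗ ΔM)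
  (hKK : K * K = 1) (hKD : K * C.D = -(C.D * K)) (hKH : K * C.H = -(C.H * K))

-- Apply 1 ⊗ p to (h ⊗ ip + K ⊗ h) Δ I = Δ h I = 0: the second summand dies by ph = 0, and pi = 1
-- simplifies the first.
include hh in
theorem map_h_p_comul_I : TensorProduct.map C.h C.p ∘ₗ ΔM ∘ₗ C.I = 0 := by
  have h1 : (TensorProduct.map C.h (C.i ∘ₗ C.p) + TensorProduct.map K C.h) ∘ₗ ΔM ∘ₗ C.I = 0 := by
    rw [← LinearMap.comp_assoc, ← hh, LinearMap.comp_assoc, h_comp_I, LinearMap.comp_zero]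
  have h2 : TensorProduct.map LinearMap.id C.p ∘ₗ
      (TensorProduct.map C.h (C.i ∘ₗ C.p) + TensorProduct.map K C.h) =
      TensorProduct.map C.h C.p := by
    rw [LinearMap.comp_add, ← TensorProduct.map_comp, ← TensorProduct.map_comp, C.p_h,
      ← LinearMap.comp_assoc, C.p_i]
    simp
  rw [← h2, LinearMap.comp_assoc, h1, LinearMap.comp_zero]

-- With the summand h ⊗ ip gone, K ⊗ h alone annihilates Δ I, and K is invertible.
include hh hKK in
theorem map_one_h_comul_I : TensorProduct.map (1 : Module.End 𝕜 M) C.h ∘ₗ ΔM ∘ₗ C.I = 0 := by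
  have h0 := C.map_h_p_comul_I hh
  have h1 : (TensorProduct.map C.h (C.i ∘ₗ C.p) + TensorProduct.map K C.h) ∘ₗ ΔM ∘ₗ C.I = 0 := by
    rw [← LinearMap.comp_assoc, ← hh, LinearMap.comp_assoc, h_comp_I, LinearMap.comp_zero]
  have h2 : TensorProduct.map C.h (C.i ∘ₗ C.p) =
      TensorProduct.map LinearMap.id C.i ∘ₗ TensorProduct.map C.h C.p := by
    rw [← TensorProduct.map_comp, LinearMap.id_comp]
  rw [LinearMap.add_comp, h2, LinearMap.comp_assoc, h0, LinearMap.comp_zero, zero_add] at h1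
  have h3 : TensorProduct.map (1 : Module.End 𝕜 M) C.h = TensorProduct.map K 1 ∘ₗ TensorProduct.map K C.h := by
    rw [← Module.End.mul_eq_comp, ← TensorProduct.map_mul, hKK, one_mul]
  rw [h3, LinearMap.comp_assoc, h1, LinearMap.comp_zero]

-- P differs from p by a term that factors through h on the right.
include hh hKK in
theorem map_right_P_comul_I {L : Type*} [AddCommGroup L] [Module 𝕜 L] (F : M →ₗ[𝕜] L) :
    TensorProduct.map F C.P ∘ₗ ΔM ∘ₗ C.I = TensorProduct.map F C.p ∘ₗ ΔM ∘ₗ C.I := by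
  have h : TensorProduct.map F C.P = TensorProduct.map F C.p +
      TensorProduct.map F (C.p ∘ₗ C.S) ∘ₗ TensorProduct.map 1 C.h := by
    rw [← TensorProduct.map_comp, P, TensorProduct.map_add_right]
    rfl
  rw [h, LinearMap.add_comp, LinearMap.comp_assoc, C.map_one_h_comul_I hh hKK,
    LinearMap.comp_zero, add_zero]

-- The perturbed homotopy factors as (1 + hΣ) h, so its tensor version vanishes on Δ I once both h ⊗
-- p and 1 ⊗ h do.
include hh hKK in
theorem H₂_comul_I : C.H₂ K ∘ₗ ΔM ∘ₗ C.I = 0 := by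
  have h1 : TensorProduct.map C.H (C.I ∘ₗ C.P) =
      TensorProduct.map (1 + C.h * C.S) C.I ∘ₗ TensorProduct.map C.h C.P := by
    rw [← TensorProduct.map_comp, H_eq]
    rfl
  have h2 : TensorProduct.map K C.H =
      TensorProduct.map K (1 + C.h * C.S) ∘ₗ TensorProduct.map 1 C.h := by
    rw [← TensorProduct.map_comp, H_eq]
    rfl
  rw [H₂, LinearMap.add_comp, h1, h2, LinearMap.comp_assoc, LinearMap.comp_assoc,
    C.map_right_P_comul_I hh hKK, C.map_h_p_comul_I hh, C.map_one_h_comul_I hh hKK]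
  simp

-- On Δ I each P may be replaced by the unperturbed p, and p is a coalgebra map with pI = 1.
include hh hKK hp in
theorem map_P_P_comul_I : TensorProduct.map C.P C.P ∘ₗ ΔM ∘ₗ C.I = ΔN := by
  have h : TensorProduct.map C.P C.p = TensorProduct.map C.p C.p +
      TensorProduct.map (C.p ∘ₗ C.S) LinearMap.id ∘ₗ TensorProduct.map C.h C.p := by
    rw [← TensorProduct.map_comp, P, TensorProduct.map_add_left]
    rfl
  rw [C.map_right_P_comul_I hh hKK, h, LinearMap.add_comp, LinearMap.comp_assoc (ΔM ∘ₗ C.I),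
    C.map_h_p_comul_I hh, LinearMap.comp_zero, add_zero, ← LinearMap.comp_assoc, ← hp,
    LinearMap.comp_assoc, p_comp_I, LinearMap.comp_id]

-- Evaluate the homotopy `D₂_mul_H₂` on Δ I. Both correction terms vanish, the second because D₂ Δ I
-- = Δ D I = Δ I D̃. So IP ⊗ IP fixes Δ I, and (P ⊗ P) Δ I is the coproduct of N.
include hp hh hD hKK hKD hKH in
theorem comul_I : ΔM ∘ₗ C.I = TensorProduct.map C.I C.I ∘ₗ ΔN := by
  have hH := C.H₂_comul_I hh hKK
  have hHD : C.H₂ K ∘ₗ C.D₂ K ∘ₗ ΔM ∘ₗ C.I = 0 := by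
    rw [← LinearMap.comp_assoc C.I ΔM (C.D₂ K), D₂, ← hD, LinearMap.comp_assoc, D_comp_I,
      ← LinearMap.comp_assoc C.Dt, ← LinearMap.comp_assoc C.Dt, hH, LinearMap.zero_comp]
  have key := congrArg (fun F => F ∘ₗ ΔM ∘ₗ C.I) (C.D₂_mul_H₂ hKK hKD hKH)
  simp only [LinearMap.add_comp, Module.End.mul_eq_comp, Module.End.one_eq_id,
    LinearMap.comp_assoc, hH, hHD, LinearMap.comp_zero, add_zero, LinearMap.id_comp] at key
  rw [← key, TensorProduct.map_comp, LinearMap.comp_assoc, C.map_P_P_comul_I hp hh hKK]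

-- From Ph = 0 and the co-Leibniz rule, (P ⊗ P) Δ kills the image of h, hence that of H; it also
-- intertwines D with a differential on N ⊗ N. So it kills DH + HD = IP - 1, that is, (P ⊗ P) Δ =
-- ((P ⊗ P) Δ I) P.
include hp hh hD hKK in
theorem comul_P {KN : Module.End 𝕜 N} (hKP : C.P ∘ₗ K = KN ∘ₗ C.P) :
    ΔN ∘ₗ C.P = TensorProduct.map C.P C.P ∘ₗ ΔM := by
  have h1 : TensorProduct.map C.P C.P ∘ₗ ΔM ∘ₗ C.h = 0 := by
    rw [hh, ← LinearMap.comp_assoc, LinearMap.comp_add, ← TensorProduct.map_comp,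
      ← TensorProduct.map_comp, P_comp_h]
    simp
  have h2 : TensorProduct.map C.P C.P ∘ₗ ΔM ∘ₗ C.H = 0 := by
    rw [H_eq']
    change TensorProduct.map C.P C.P ∘ₗ ΔM ∘ₗ C.h ∘ₗ (1 + C.S * C.h) = 0
    rw [← LinearMap.comp_assoc _ C.h, ← LinearMap.comp_assoc, h1, LinearMap.zero_comp]
  have h3 : TensorProduct.map C.P C.P ∘ₗ ΔM ∘ₗ C.D =
      (TensorProduct.map C.Dt LinearMap.id + TensorProduct.map KN C.Dt) ∘ₗ
        TensorProduct.map C.P C.P ∘ₗ ΔM := by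
    rw [hD, ← LinearMap.comp_assoc, ← LinearMap.comp_assoc]
    congr 1
    rw [LinearMap.comp_add, LinearMap.add_comp, ← TensorProduct.map_comp,
      ← TensorProduct.map_comp, ← TensorProduct.map_comp, ← TensorProduct.map_comp, P_comp_D, hKP]
    rfl
  have h4 : TensorProduct.map C.P C.P ∘ₗ ΔM ∘ₗ (C.I ∘ₗ C.P) = TensorProduct.map C.P C.P ∘ₗ ΔM := by
    have h5 : TensorProduct.map C.P C.P ∘ₗ ΔM ∘ₗ (C.D ∘ₗ C.H) = 0 := by
      rw [← LinearMap.comp_assoc _ C.D, ← LinearMap.comp_assoc, h3, LinearMap.comp_assoc,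
        LinearMap.comp_assoc, h2, LinearMap.comp_zero]
    have h6 : TensorProduct.map C.P C.P ∘ₗ ΔM ∘ₗ (C.H ∘ₗ C.D) = 0 := by
      rw [← LinearMap.comp_assoc _ C.H, ← LinearMap.comp_assoc, h2, LinearMap.zero_comp]
    rw [I_comp_P]
    simp only [LinearMap.comp_add, Module.End.mul_eq_comp, h5, h6, add_zero]
    rfl
  rw [← h4, ← C.map_P_P_comul_I hp hh hKK]
  rfl

-- Conjugate the coderivation D by the coalgebra maps P and I; PI = 1 reduces the untouched factors.
include hp hh hD hKK hKD hKH in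
theorem comul_Dt {KN : Module.End 𝕜 N} (hKP : C.P ∘ₗ K = KN ∘ₗ C.P) :
    ΔN ∘ₗ C.Dt = (TensorProduct.map C.Dt LinearMap.id + TensorProduct.map KN C.Dt) ∘ₗ ΔN := by
  have hI := C.comul_I hp hh hD hKK hKD hKH
  have hP := C.comul_P hp hh hD hKK hKP
  have hPKI : C.P ∘ₗ K ∘ₗ C.I = KN := by
    rw [← LinearMap.comp_assoc, hKP, LinearMap.comp_assoc, P_comp_I, LinearMap.comp_id]
  conv_lhs => rw [← P_comp_D_comp_I]
  rw [← LinearMap.comp_assoc, hP, LinearMap.comp_assoc, ← LinearMap.comp_assoc C.I, hD,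
    LinearMap.comp_assoc, hI, ← LinearMap.comp_assoc, ← LinearMap.comp_assoc]
  congr 1
  rw [LinearMap.comp_add, LinearMap.add_comp]
  simp only [← TensorProduct.map_comp, LinearMap.comp_assoc, P_comp_D_comp_I, hPKI,
    Module.End.one_eq_id, LinearMap.id_comp, P_comp_I]

end Coalgebra

/-! ### Intertwining two perturbations of the same contraction -/

section Intertwine

variable {C} {C' : PerturbedContraction 𝕜 M N} (hh : C'.h = C.h) {ρ : Module.End 𝕜 M} (hρ : ρ * C.D = C'.D * ρ)
  (hhh : C.h * ρ * C.h = 0)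

-- Expanding ip in hρ(ip) = 0 expresses hρ through a multiple of h on the right, so hρI = 0. Then
-- H'ρI = 0, and H'D'ρI = H'ρI D̃ = 0. Both corrections in I'P' = 1 + D'H' + H'D' therefore vanish
-- on ρI.
include hh hρ hhh in
theorem I_comp_P_intertwine (hhe : C.h * ρ * (C.i ∘ₗ C.p) = 0) :
    C'.I ∘ₗ C'.P ∘ₗ ρ ∘ₗ C.I = ρ ∘ₗ C.I := by
  have h1 : C.h * ρ = -(C.h * ρ * C.d * C.h) := by
    have h2 := C.homotopy
    linear_combination (norm := noncomm_ring) hhe - C.h * ρ * h2 - hhh * C.d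
  have h2 : C'.h ∘ₗ ρ ∘ₗ C.I = 0 := by
    rw [hh, ← LinearMap.comp_assoc]
    change (C.h * ρ) ∘ₗ C.I = 0
    rw [h1]
    change -((C.h * ρ * C.d) ∘ₗ C.h ∘ₗ C.I) = 0
    rw [h_comp_I, LinearMap.comp_zero, neg_zero]
  have h3 : C'.H ∘ₗ ρ ∘ₗ C.I = 0 := by
    rw [H_eq]
    change (1 + C'.h * C'.S) ∘ₗ (C'.h ∘ₗ ρ ∘ₗ C.I) = 0
    rw [h2, LinearMap.comp_zero]
  have h4 : C'.H ∘ₗ C'.D ∘ₗ ρ ∘ₗ C.I = 0 := by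
    rw [← LinearMap.comp_assoc C.I]
    change C'.H ∘ₗ (C'.D * ρ) ∘ₗ C.I = 0
    rw [← hρ]
    change C'.H ∘ₗ ρ ∘ₗ C.D ∘ₗ C.I = 0
    rw [D_comp_I]
    change (C'.H ∘ₗ ρ ∘ₗ C.I) ∘ₗ C.Dt = 0
    rw [h3, LinearMap.zero_comp]
  rw [← LinearMap.comp_assoc, I_comp_P]
  simp only [LinearMap.add_comp, Module.End.mul_eq_comp, LinearMap.comp_assoc, h3, h4,
    LinearMap.comp_zero, add_zero]
  rfl

-- Dual argument: ρh is a left multiple of h, hence P'ρh = 0, and P'ρ annihilates DH + HD.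
include hh hρ hhh in
theorem P_intertwine (heh : (C.i ∘ₗ C.p) * ρ * C.h = 0) :
    C'.P ∘ₗ ρ ∘ₗ C.I ∘ₗ C.P = C'.P ∘ₗ ρ := by
  have h1 : ρ * C.h = -(C.h * (C.d * ρ * C.h)) := by
    have h2 := C.homotopy
    linear_combination (norm := noncomm_ring) heh - h2 * ρ * C.h - C.d * hhh
  have h2 : C'.P ∘ₗ (ρ * C.h) = 0 := by
    rw [h1, ← hh, LinearMap.comp_neg]
    change -((C'.P ∘ₗ C'.h) ∘ₗ (C.d * ρ * C'.h)) = 0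
    rw [P_comp_h, LinearMap.zero_comp, neg_zero]
  have h3 : C'.P ∘ₗ ρ ∘ₗ C.H = 0 := by
    rw [H_eq']
    change (C'.P ∘ₗ (ρ * C.h)) ∘ₗ (1 + C.S * C.h) = 0
    rw [h2, LinearMap.zero_comp]
  have h4 : C'.P ∘ₗ ρ ∘ₗ C.D ∘ₗ C.H = 0 := by
    change C'.P ∘ₗ (ρ * C.D) ∘ₗ C.H = 0
    rw [hρ]
    change (C'.P ∘ₗ C'.D) ∘ₗ ρ ∘ₗ C.H = 0
    rw [P_comp_D, LinearMap.comp_assoc, h3, LinearMap.comp_zero]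
  have h5 : C'.P ∘ₗ ρ ∘ₗ C.H ∘ₗ C.D = 0 := by
    change (C'.P ∘ₗ ρ ∘ₗ C.H) ∘ₗ C.D = 0
    rw [h3, LinearMap.zero_comp]
  rw [I_comp_P]
  simp only [LinearMap.comp_add, Module.End.mul_eq_comp, h4, h5, add_zero]
  rfl

end Intertwine

end PerturbedContraction

end PerturbationLemma

/-! ### Operators acting on one letter at a time, and the tensor trick. -/

section LetterOperators

variable {𝕜 : Type u} [Field 𝕜]
variable {V : Type v} [AddCommGroup V] [Module 𝕜 V] {W : Type v} [AddCommGroup W] [Module 𝕜 W]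

theorem tmap_comp_insertOp {f : V →ₗ[𝕜] W} {k h g : Module.End 𝕜 V} {k' h' g' : Module.End 𝕜 W}
    (hk : f ∘ₗ k = k' ∘ₗ f) (hh : f ∘ₗ h = h' ∘ₗ f) (hg : f ∘ₗ g = g' ∘ₗ f) :
    tmap f ∘ₗ insertOp (tmap k) (h ∘ₗ proj₁ 𝕜 V) (tmap g) =
      insertOp (tmap k') (h' ∘ₗ proj₁ 𝕜 W) (tmap g') ∘ₗ tmap f := by
  have hk' : ∀ v, f (k v) = k' (f v) := fun v => congrArg (fun F => F v) hk
  have hh' : ∀ v, f (h v) = h' (f v) := fun v => congrArg (fun F => F v) hh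
  have hg' : ∀ x, tmap f (tmap g x) = tmap g' (tmap f x) := fun x => by
    rw [← LinearMap.comp_apply, ← LinearMap.comp_apply, tmap_comp_tmap, tmap_comp_tmap, hg]
  refine linearMap_ext_words (by simp [insertOp_proj₁_one]) fun v x hx => ?_
  simp only [LinearMap.comp_apply] at hx ⊢
  rw [insertOp_proj₁_cons, tmap_cons, insertOp_proj₁_cons, map_add, tmap_cons, tmap_cons, hx, hk',
    hh', hg']

theorem tmap_comp_insertOp_eq_zero {f : V →ₗ[𝕜] W} {k h g : Module.End 𝕜 V} (hf : f ∘ₗ h = 0) :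
    tmap f ∘ₗ insertOp (tmap k) (h ∘ₗ proj₁ 𝕜 V) (tmap g) = 0 := by
  have hf' : ∀ v, f (h v) = 0 := fun v => congrArg (fun F => F v) hf
  refine linearMap_ext_words (by simp [insertOp_proj₁_one]) fun v x hx => ?_
  simp only [LinearMap.comp_apply, LinearMap.zero_apply] at hx ⊢
  rw [insertOp_proj₁_cons, map_add, tmap_cons, tmap_cons, hx, hf']
  simp

theorem insertOp_comp_tmap_eq_zero {f : W →ₗ[𝕜] V} {k h g : Module.End 𝕜 V} (hf : h ∘ₗ f = 0) :
    insertOp (tmap k) (h ∘ₗ proj₁ 𝕜 V) (tmap g) ∘ₗ tmap f = 0 := by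
  have hf' : ∀ v, h (f v) = 0 := fun v => congrArg (fun F => F v) hf
  refine linearMap_ext_words (by simp [insertOp_proj₁_one]) fun v x hx => ?_
  simp only [LinearMap.comp_apply, LinearMap.zero_apply] at hx ⊢
  rw [tmap_cons, insertOp_proj₁_cons, hx, hf']
  simp

/-- If the two insertions hit the same letter, the factor hch appears. Otherwise the letter of the
later position carries gch or hcg, according to which insertion acts there. -/
theorem insertOp_comp_tmap_comp_insertOp {c k h g : Module.End 𝕜 V} (h1 : h ∘ₗ c ∘ₗ h = 0)
    (h2 : h ∘ₗ c ∘ₗ g = 0) (h3 : g ∘ₗ c ∘ₗ h = 0) :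
    insertOp (tmap k) (h ∘ₗ proj₁ 𝕜 V) (tmap g) ∘ₗ tmap c ∘ₗ
      insertOp (tmap k) (h ∘ₗ proj₁ 𝕜 V) (tmap g) = 0 := by
  have h1' : ∀ v, h (c (h v)) = 0 := fun v => congrArg (fun F => F v) h1
  have h2' : ∀ x, insertOp (tmap k) (h ∘ₗ proj₁ 𝕜 V) (tmap g) (tmap c (tmap g x)) = 0 := fun x => by
    have := insertOp_comp_tmap_eq_zero (k := k) (g := g) h2
    rw [← tmap_comp_tmap] at this
    exact congrArg (fun F => F x) this
  have h3' : ∀ x, tmap g (tmap c (insertOp (tmap k) (h ∘ₗ proj₁ 𝕜 V) (tmap g) x)) = 0 := fun x => by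
    have := tmap_comp_insertOp_eq_zero (f := g ∘ₗ c) (k := k) (g := g)
      (by rw [LinearMap.comp_assoc, h3])
    rw [← tmap_comp_tmap] at this
    exact congrArg (fun F => F x) this
  refine linearMap_ext_words (by simp [insertOp_proj₁_one]) fun v x hx => ?_
  simp only [LinearMap.comp_apply, LinearMap.zero_apply] at hx ⊢
  rw [insertOp_proj₁_cons, map_add, map_add, tmap_cons, tmap_cons, insertOp_proj₁_cons,
    insertOp_proj₁_cons, hx, h1', h2', h3']
  simp

variable {d h e k : Module.End 𝕜 V}

theorem insertOp_sq_eq_zero (hkk : k ∘ₗ k = LinearMap.id) (hdk : k ∘ₗ d = -(d ∘ₗ k))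
    (hdd : d ∘ₗ d = 0) :
    insertOp (tmap k) (d ∘ₗ proj₁ 𝕜 V) LinearMap.id ∘ₗ
      insertOp (tmap k) (d ∘ₗ proj₁ 𝕜 V) LinearMap.id = 0 := by
  have hkk' : ∀ v, k (k v) = v := fun v => congrArg (fun F => F v) hkk
  have hdk' : ∀ v, k (d v) = -(d (k v)) := fun v => congrArg (fun F => F v) hdk
  have hdd' : ∀ v, d (d v) = 0 := fun v => congrArg (fun F => F v) hdd
  refine linearMap_ext_words (by simp [insertOp_proj₁_one]) fun v x hx => ?_
  simp only [LinearMap.comp_apply, LinearMap.zero_apply] at hx ⊢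
  simp [insertOp_proj₁_cons, hx, hkk', hdk', hdd']

/-- The terms in which `d` and `h` act on different letters cancel by the signs and de = ed. The
rest, ∑ 1 ⊗ ⋯ ⊗ (dh + hd) ⊗ e ⊗ ⋯ with dh + hd = e - 1, telescopes to T(e) - 1. -/
theorem insertOp_homotopy (hkk : k ∘ₗ k = LinearMap.id) (hdk : k ∘ₗ d = -(d ∘ₗ k))
    (hhk : k ∘ₗ h = -(h ∘ₗ k)) (hde : d ∘ₗ e = e ∘ₗ d) (hke : k ∘ₗ e = e ∘ₗ k)
    (he : e = LinearMap.id + d ∘ₗ h + h ∘ₗ d) :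
    tmap e = 1 + insertOp (tmap k) (d ∘ₗ proj₁ 𝕜 V) LinearMap.id *
        insertOp (tmap k) (h ∘ₗ proj₁ 𝕜 V) (tmap e) +
      insertOp (tmap k) (h ∘ₗ proj₁ 𝕜 V) (tmap e) *
        insertOp (tmap k) (d ∘ₗ proj₁ 𝕜 V) LinearMap.id := by
  have hkk' : ∀ v, k (k v) = v := fun v => congrArg (fun F => F v) hkk
  have hdk' : ∀ v, k (d v) = -(d (k v)) := fun v => congrArg (fun F => F v) hdk
  have hhk' : ∀ v, k (h v) = -(h (k v)) := fun v => congrArg (fun F => F v) hhk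
  have he' : ∀ v, e v = v + d (h v) + h (d v) := fun v => congrArg (fun F => F v) he
  have hTd : ∀ x, insertOp (tmap k) (d ∘ₗ proj₁ 𝕜 V) LinearMap.id (tmap e x) =
      tmap e (insertOp (tmap k) (d ∘ₗ proj₁ 𝕜 V) LinearMap.id x) := fun x => by
    have := tmap_comp_insertOp (f := e) (k := k) (k' := k) (h := d) (h' := d) (g := LinearMap.id)
      (g' := LinearMap.id) hke.symm hde.symm rfl
    rw [tmap_id] at this
    exact (congrArg (fun F => F x) this).symm
  refine linearMap_ext_words (by simp [insertOp_proj₁_one]) fun v x hx => ?_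
  simp only [LinearMap.add_apply, Module.End.mul_apply, Module.End.one_apply] at hx ⊢
  simp only [insertOp_proj₁_cons, map_add, LinearMap.id_apply, hkk', hdk', hhk', tmap_cons, hTd]
  have hx' : tmap e x - x - insertOp (tmap k) (h ∘ₗ proj₁ 𝕜 V) (tmap e)
      (insertOp (tmap k) (d ∘ₗ proj₁ 𝕜 V) LinearMap.id x) =
      insertOp (tmap k) (d ∘ₗ proj₁ 𝕜 V) LinearMap.id
        (insertOp (tmap k) (h ∘ₗ proj₁ 𝕜 V) (tmap e) x) := by
    nth_rw 1 [hx]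
    abel
  rw [← hx', he' v]
  simp only [map_add, map_neg, mul_sub, add_mul, neg_mul]
  abel

end LetterOperators

/-! ### Parity and coderivations. -/

section Koszul

variable {𝕜 : Type u} [Field 𝕜]
variable {V : Type v} [AddCommGroup V] [Module 𝕜 V] {𝒱 : ℤ → Submodule 𝕜 V}
  [DirectSum.Decomposition 𝒱]
variable {W : Type v} [AddCommGroup W] [Module 𝕜 W] {𝒲 : ℤ → Submodule 𝕜 W}
  [DirectSum.Decomposition 𝒲]

theorem koszul_comp_of_odd {k : ℤ} (hk : Odd k) {f : V →ₗ[𝕜] W}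
    (hf : ∀ p, ∀ v ∈ 𝒱 p, f v ∈ 𝒲 (p + k)) : koszul 𝒲 ∘ₗ f = -(f ∘ₗ koszul 𝒱) := by
  refine linearMap_ext_homogeneous 𝒱 fun p v hv => ?_
  rw [LinearMap.comp_apply, LinearMap.neg_apply, LinearMap.comp_apply, koszul_of_mem hv,
    koszul_of_mem (hf p v hv), map_smul, show p + k - 1 = k + (p - 1) by ring,
    zpow_add₀ (by simp), hk.neg_one_zpow]
  simp

theorem koszul_comp_of_even {f : V →ₗ[𝕜] W} (hf : ∀ p, ∀ v ∈ 𝒱 p, f v ∈ 𝒲 p) :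
    koszul 𝒲 ∘ₗ f = f ∘ₗ koszul 𝒱 := by
  refine linearMap_ext_homogeneous 𝒱 fun p v hv => ?_
  rw [LinearMap.comp_apply, LinearMap.comp_apply, koszul_of_mem hv, koszul_of_mem (hf p v hv),
    map_smul]

theorem koszul_comp_koszul : koszul 𝒱 ∘ₗ koszul 𝒱 = LinearMap.id := by
  ext v
  simp

theorem HasDegree.koszul_anticomm {k : ℤ} (hk : Odd k) {F : Module.End 𝕜 (TensorAlgebra 𝕜 V)}
    (hF : HasDegree 𝒱 𝒱 k F) : tmap (koszul 𝒱) * F = -(F * tmap (koszul 𝒱)) := by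
  have := hF.tmap_koszul_comp
  rw [hk.neg_one_zpow] at this
  ext x
  simpa using LinearMap.congr_fun this x

theorem coderivation_comul (b : TensorAlgebra 𝕜 V →ₗ[𝕜] V) :
    IsOddCoderivation 𝒱 (coderivation 𝒱 b) := by
  have := deconc_insertOp (koszul 𝒱) LinearMap.id b
  rwa [tmap_id] at this

theorem counit_comp_coderivation (b : TensorAlgebra 𝕜 V →ₗ[𝕜] V) :
    counit 𝕜 V ∘ₗ coderivation 𝒱 b = 0 :=
  counit_insertOp _ _ _

theorem proj₁_comp_coderivation (b : TensorAlgebra 𝕜 V →ₗ[𝕜] V) :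
    proj₁ 𝕜 V ∘ₗ coderivation 𝒱 b = b := by
  have := proj₁_insertOp (koszul 𝒱) LinearMap.id b
  rwa [tmap_id] at this

theorem hasDegree_coderivation {k : ℤ} {b : TensorAlgebra 𝕜 V →ₗ[𝕜] V}
    (hb : ∀ n, ∀ x ∈ totalGrading 𝒱 n, b x ∈ 𝒱 (n + 1 + k)) :
    HasDegree 𝒱 𝒱 k (coderivation 𝒱 b) :=
  hasDegree_insertOp (fun _ _ hv => koszul_mem hv) hasDegree_id rfl hb

/-- A degree `1` coderivation of `T(sV)` with corestriction `b` squares to zero if `b D = 0`. -/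
theorem coderivation_sq {b : TensorAlgebra 𝕜 V →ₗ[𝕜] V}
    (hb : ∀ n, ∀ x ∈ totalGrading 𝒱 n, b x ∈ 𝒱 (n + 1 + 1)) (h : b ∘ₗ coderivation 𝒱 b = 0) :
    coderivation 𝒱 b ∘ₗ coderivation 𝒱 b = 0 := by
  have hK := (hasDegree_coderivation hb).koszul_anticomm odd_one
  have hΔ := coderivation_comul (𝒱 := 𝒱) b
  rw [IsOddCoderivation] at hΔ
  have h1 := counit_comp_coderivation (𝒱 := 𝒱) b
  have h2 := proj₁_comp_coderivation (𝒱 := 𝒱) b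
  have hKK := tmap_koszul_tmap_koszul (𝒱 := 𝒱)
  set D := coderivation 𝒱 b
  refine eq_zero_of_coLeibniz (g := LinearMap.id) (f := LinearMap.id) (k := LinearMap.id) ?_ rfl
    ?_ ?_
  -- The square of an odd coderivation is an unsigned one: the cross terms DK ⊗ D and KD ⊗ D cancel,
  -- and K squares to 1.
  · rw [← LinearMap.comp_assoc, hΔ, LinearMap.comp_assoc, hΔ, ← LinearMap.comp_assoc]
    congr 1
    have neg_left : ∀ a b : Module.End 𝕜 (TensorAlgebra 𝕜 V),
        TensorProduct.map (-a) b = -TensorProduct.map a b := fun a b =>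
      TensorProduct.ext' fun x y => by simp [TensorProduct.neg_tmul]
    have hK' : tmap (koszul 𝒱) ∘ₗ D = -(D ∘ₗ tmap (koszul 𝒱)) := hK
    simp only [LinearMap.comp_add, LinearMap.add_comp, ← TensorProduct.map_comp, hK', hKK,
      neg_left, LinearMap.id_comp, LinearMap.comp_id]
    abel
  · rw [← LinearMap.comp_assoc, h1, LinearMap.zero_comp]
  · rw [← LinearMap.comp_assoc, h2, h]

end Koszul

/-! ### The curved dg structures and their gauge covariance. -/

section DG

variable {𝕜 : Type u} [Field 𝕜]
variable {A : Type v} [Ring A] [Algebra 𝕜 A] {𝒜 : ℤ → Submodule 𝕜 A} [GradedAlgebra 𝒜]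

theorem Differential.koszul_comp {V : Type v} [AddCommGroup V] [Module 𝕜 V]
    {𝒱 : ℤ → Submodule 𝕜 V} [DirectSum.Decomposition 𝒱] (D : Differential 𝒱) :
    koszul 𝒱 ∘ₗ D.d = -(D.d ∘ₗ koszul 𝒱) :=
  koszul_comp_of_odd odd_one D.d_mem

theorem tensorDifferential_sq {V : Type v} [AddCommGroup V] [Module 𝕜 V]
    {𝒱 : ℤ → Submodule 𝕜 V} [DirectSum.Decomposition 𝒱] (D : Differential 𝒱) :
    tensorDifferential D ∘ₗ tensorDifferential D = 0 :=
  insertOp_sq_eq_zero koszul_comp_koszul D.koszul_comp (LinearMap.ext D.d_d)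

theorem hasDegree_tensorDifferential {V : Type v} [AddCommGroup V] [Module 𝕜 V]
    {𝒱 : ℤ → Submodule 𝕜 V} [DirectSum.Decomposition 𝒱] (D : Differential 𝒱) :
    HasDegree 𝒱 𝒱 1 (tensorDifferential D) :=
  hasDegree_coderivation fun _ _ hx => D.d_mem _ _ (proj₁_mem hx)

/-- The sign is the suspended one, (-1)^(p-1), so it is multiplicative only up to a global minus
sign. -/
theorem koszul_mul (a b : A) : koszul 𝒜 (a * b) = -(koszul 𝒜 a * koszul 𝒜 b) := by
  have : (LinearMap.mul 𝕜 A).compr₂ (koszul 𝒜) =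
      -(LinearMap.mul 𝕜 A).compl₁₂ (koszul 𝒜) (koszul 𝒜) := by
    refine linearMap_ext_homogeneous 𝒜 fun p a ha => linearMap_ext_homogeneous 𝒜 fun q b hb => ?_
    have h : (-1 : 𝕜) ^ (p + q - 1) = -((-1) ^ (p - 1) * (-1) ^ (q - 1)) := by
      rw [show p + q - 1 = 1 + (p - 1) + (q - 1) by ring, zpow_add₀ (by simp),
        zpow_add₀ (by simp)]
      simp
    simp [koszul_of_mem ha, koszul_of_mem hb, koszul_of_mem (SetLike.mul_mem_graded ha hb), h,
      smul_smul, mul_comm]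
  exact congrArg (fun F => F a b) this

/-- With the sign absorbed in `koszul`, the Leibniz rule holds for inhomogeneous elements, and later
identities become noncommutative algebra. -/
theorem DGDifferential.d_mul (E : DGDifferential 𝒜) (a b : A) :
    E.d (a * b) = E.d a * b - koszul 𝒜 a * E.d b := by
  have : (LinearMap.mul 𝕜 A).compr₂ E.d =
      (LinearMap.mul 𝕜 A).compl₁₂ E.d LinearMap.id -
        (LinearMap.mul 𝕜 A).compl₁₂ (koszul 𝒜) E.d := by
    refine linearMap_ext_homogeneous 𝒜 fun p a ha => LinearMap.ext fun b => ?_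
    have h : (-1 : 𝕜) ^ p = -((-1) ^ (p - 1)) := by
      nth_rw 1 [show p = 1 + (p - 1) by ring]
      rw [zpow_add₀ (by simp)]
      simp
    simp [koszul_of_mem ha, E.leibniz p a b ha, h, sub_eq_add_neg]
  exact congrArg (fun F => F a b) this

theorem koszul_d (E : DGDifferential 𝒜) (a : A) :
    koszul 𝒜 (E.d a) = -(E.d (koszul 𝒜 a)) :=
  congrArg (fun F => F a) E.koszul_comp

theorem koszul_of_mem_one {γ : A} (hγ : γ ∈ 𝒜 1) : koszul 𝒜 γ = γ := by
  simp [koszul_of_mem hγ]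

theorem koszul_of_mem_zero {a : A} (ha : a ∈ 𝒜 0) : koszul 𝒜 a = -a := by
  simp [koszul_of_mem ha]

section Components

variable (E : DGDifferential 𝒜) (γ : A)

/-- The linear component `a ↦ da + [γ, a]` of `D_γ`. -/
def covariantDerivative : Module.End 𝕜 A :=
  E.d + LinearMap.mulLeft 𝕜 γ + LinearMap.mulRight 𝕜 γ ∘ₗ koszul 𝒜

theorem covariantDerivative_apply (a : A) :
    covariantDerivative E γ a = E.d a + γ * a + koszul 𝒜 a * γ := rfl

theorem curvedDGComponents_one : curvedDGComponents E γ 1 = E.d γ + γ * γ := by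
  simp [curvedDGComponents, Algebra.TensorProduct.one_def]

theorem curvedDGComponents_cons (v : A) (x : TensorAlgebra 𝕜 A) :
    curvedDGComponents E γ (TensorAlgebra.ι 𝕜 v * x) =
      counit 𝕜 A x • covariantDerivative E γ v + koszul 𝒜 v * proj₁ 𝕜 A x := by
  have h : (koszul 𝒜 ∘ₗ proj₁ 𝕜 A) ∘ₗ LinearMap.mulLeft 𝕜 (TensorAlgebra.ι 𝕜 v) =
      (counit 𝕜 A).smulRight (koszul 𝒜 v) := by
    ext x
    simp
  have h' : curvedDGComponents E γ = (counit 𝕜 A).smulRight (E.d γ + γ * γ) +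
      covariantDerivative E γ ∘ₗ proj₁ 𝕜 A + LinearMap.mul' 𝕜 A ∘ₗ
        TensorProduct.map (koszul 𝒜 ∘ₗ proj₁ 𝕜 A) (proj₁ 𝕜 A) ∘ₗ deconc 𝕜 A := rfl
  simp only [h', LinearMap.add_apply, LinearMap.comp_apply, map_deconc_cons, h, map_counit_deconc]
  simp

variable {γ}

theorem curvature_mem (hγ : γ ∈ 𝒜 1) : E.d γ + γ * γ ∈ 𝒜 2 :=
  add_mem (E.d_mem 1 γ hγ) (SetLike.mul_mem_graded hγ hγ)

theorem covariantDerivative_mem (hγ : γ ∈ 𝒜 1) {p : ℤ} {a : A} (ha : a ∈ 𝒜 p) :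
    covariantDerivative E γ a ∈ 𝒜 (p + 1) := by
  refine add_mem (add_mem (E.d_mem p a ha) ?_) (SetLike.mul_mem_graded (koszul_mem ha) hγ)
  rw [add_comm]
  exact SetLike.mul_mem_graded hγ ha

theorem curvedDGComponents_mem (hγ : γ ∈ 𝒜 1) (n : ℤ) (x : TensorAlgebra 𝕜 A)
    (hx : x ∈ totalGrading 𝒜 n) : curvedDGComponents E γ x ∈ 𝒜 (n + 1 + 1) := by
  refine totalGrading_le (𝒱 := 𝒜) (fun n => (𝒜 (n + 1 + 1)).comap (curvedDGComponents E γ)) ?_ ?_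
    n hx
  · rw [Submodule.mem_comap, curvedDGComponents_one]
    exact curvature_mem E hγ
  · intro p n v hv w hw _
    rw [Submodule.mem_comap, curvedDGComponents_cons]
    refine add_mem ?_ ?_
    · have := counit_smul_mem hw (covariantDerivative_mem E hγ hv)
      rwa [show p - 1 + n + 1 + 1 = n + (p + 1) by ring]
    · have := SetLike.mul_mem_graded (koszul_mem hv) (proj₁_mem hw)
      rwa [show p - 1 + n + 1 + 1 = p + (n + 1) by ring]

theorem hasDegree_curvedDG (hγ : γ ∈ 𝒜 1) : HasDegree 𝒜 𝒜 1 (curvedDG E γ) :=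
  hasDegree_coderivation (curvedDGComponents_mem E hγ)

theorem koszul_curvature (hγ : γ ∈ 𝒜 1) :
    koszul 𝒜 (E.d γ + γ * γ) = -(E.d γ + γ * γ) := by
  rw [koszul_of_mem (curvature_mem E hγ), show (2 : ℤ) - 1 = 1 by norm_num, zpow_one]
  exact neg_one_smul 𝕜 _

/-- The Bianchi identity. -/
theorem covariantDerivative_curvature (hγ : γ ∈ 𝒜 1) :
    covariantDerivative E γ (E.d γ + γ * γ) = 0 := by
  rw [covariantDerivative_apply, koszul_curvature E hγ, map_add, E.d_d, E.d_mul,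
    koszul_of_mem_one hγ]
  noncomm_ring

theorem covariantDerivative_sq (hγ : γ ∈ 𝒜 1) (a : A) :
    covariantDerivative E γ (covariantDerivative E γ a) =
      (E.d γ + γ * γ) * a - a * (E.d γ + γ * γ) := by
  simp only [covariantDerivative_apply, map_add, E.d_d, E.d_mul, koszul_mul, koszul_d,
    koszul_of_mem_one hγ, koszul_koszul]
  noncomm_ring

theorem covariantDerivative_mul (hγ : γ ∈ 𝒜 1) (a b : A) :
    covariantDerivative E γ (koszul 𝒜 a * b) + koszul 𝒜 (covariantDerivative E γ a) * b +
      a * covariantDerivative E γ b = 0 := by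
  simp only [covariantDerivative_apply, map_add, E.d_mul, koszul_mul, koszul_d,
    koszul_of_mem_one hγ, koszul_koszul]
  noncomm_ring

/-- By word length, the equation is: the Bianchi identity (0), ∇² = [F, ·] (1), the Leibniz rule for
∇ (2), and associativity (3). -/
theorem curvedDGComponents_comp (hγ : γ ∈ 𝒜 1) :
    curvedDGComponents E γ ∘ₗ curvedDG E γ = 0 := by
  set b := curvedDGComponents E γ with hb
  have hΔ : deconc 𝕜 A ∘ₗ curvedDG E γ = (TensorProduct.map (curvedDG E γ) LinearMap.id +
      TensorProduct.map (tmap (koszul 𝒜)) (curvedDG E γ)) ∘ₗ deconc 𝕜 A :=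
    coderivation_comul (𝒱 := 𝒜) b
  have h1 : counit 𝕜 A ∘ₗ curvedDG E γ = 0 := counit_comp_coderivation (𝒱 := 𝒜) b
  have h2 : proj₁ 𝕜 A ∘ₗ curvedDG E γ = b := proj₁_comp_coderivation (𝒱 := 𝒜) b
  have h3 : b = (counit 𝕜 A).smulRight (E.d γ + γ * γ) +
      covariantDerivative E γ ∘ₗ proj₁ 𝕜 A + LinearMap.mul' 𝕜 A ∘ₗ
        TensorProduct.map (koszul 𝒜 ∘ₗ proj₁ 𝕜 A) (proj₁ 𝕜 A) ∘ₗ deconc 𝕜 A := rfl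
  -- The constant component drops out since D has no part of length 0, and the co-Leibniz rule
  -- distributes D over the two inputs of the product. The Koszul sign of the second term cancels
  -- the sign in the product.
  have h4 : b ∘ₗ curvedDG E γ = covariantDerivative E γ ∘ₗ b + LinearMap.mul' 𝕜 A ∘ₗ
      (TensorProduct.map (koszul 𝒜 ∘ₗ b) (proj₁ 𝕜 A) + TensorProduct.map (proj₁ 𝕜 A) b) ∘ₗ
        deconc 𝕜 A := by
    have h5 : (counit 𝕜 A).smulRight (E.d γ + γ * γ) ∘ₗ curvedDG E γ = 0 := by
      ext x
      have := congrArg (fun F => F x) h1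
      simp only [LinearMap.comp_apply, LinearMap.zero_apply] at this
      simp [this]
    have h6 : koszul 𝒜 ∘ₗ proj₁ 𝕜 A ∘ₗ tmap (koszul 𝒜) = proj₁ 𝕜 A := by
      rw [proj₁_comp_tmap, ← LinearMap.comp_assoc, koszul_comp_koszul, LinearMap.id_comp]
    conv_lhs => rw [h3]
    rw [LinearMap.add_comp, LinearMap.add_comp, h5, zero_add, LinearMap.comp_assoc, h2,
      LinearMap.comp_assoc, LinearMap.comp_assoc, hΔ, ← LinearMap.comp_assoc (deconc 𝕜 A)]
    simp only [LinearMap.comp_add, LinearMap.add_comp, ← TensorProduct.map_comp,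
      LinearMap.comp_assoc, h2, h6, LinearMap.comp_id]
  rw [h4]
  refine linearMap_ext_words ?_ fun v x _ => ?_
  · simp [hb, curvedDGComponents_one, covariantDerivative_curvature E hγ,
      Algebra.TensorProduct.one_def]
  · have h7 : (koszul 𝒜 ∘ₗ b) ∘ₗ LinearMap.mulLeft 𝕜 (TensorAlgebra.ι 𝕜 v) =
        (counit 𝕜 A).smulRight (koszul 𝒜 (covariantDerivative E γ v)) -
          LinearMap.mulLeft 𝕜 v ∘ₗ koszul 𝒜 ∘ₗ proj₁ 𝕜 A := by
      ext y
      simp [hb, curvedDGComponents_cons, koszul_mul, sub_eq_add_neg]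
    have h8 : ∀ z, LinearMap.mul' 𝕜 A (TensorProduct.map
        ((counit 𝕜 A).smulRight (koszul 𝒜 (covariantDerivative E γ v)) -
          LinearMap.mulLeft 𝕜 v ∘ₗ koszul 𝒜 ∘ₗ proj₁ 𝕜 A) (proj₁ 𝕜 A) z) =
        LinearMap.mul' 𝕜 A (TensorProduct.map
          ((counit 𝕜 A).smulRight (koszul 𝒜 (covariantDerivative E γ v))) (proj₁ 𝕜 A) z) -
        v * LinearMap.mul' 𝕜 A
          (TensorProduct.map (koszul 𝒜 ∘ₗ proj₁ 𝕜 A) (proj₁ 𝕜 A) z) := by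
      intro z
      induction z with
      | zero => simp
      | tmul y z => simp [sub_mul, mul_assoc]
      | add y z hy hz => simp only [map_add, mul_add, hy, hz]; abel
    have h9 : b x = counit 𝕜 A x • (E.d γ + γ * γ) + covariantDerivative E γ (proj₁ 𝕜 A x) +
      LinearMap.mul' 𝕜 A
          (TensorProduct.map (koszul 𝒜 ∘ₗ proj₁ 𝕜 A) (proj₁ 𝕜 A) (deconc 𝕜 A x)) := rfl
    have h10 : v * covariantDerivative E γ (proj₁ 𝕜 A x) =
        -(covariantDerivative E γ (koszul 𝒜 v * proj₁ 𝕜 A x) +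
          koszul 𝒜 (covariantDerivative E γ v) * proj₁ 𝕜 A x) := by
      rw [eq_neg_iff_add_eq_zero, add_comm]
      exact covariantDerivative_mul E hγ v (proj₁ 𝕜 A x)
    have h11 := covariantDerivative_sq E hγ v
    have h12 : b (TensorAlgebra.ι 𝕜 v * x) = _ := curvedDGComponents_cons E γ v x
    have h13 : b 1 = _ := curvedDGComponents_one E γ
    simp only [LinearMap.add_apply, LinearMap.comp_apply, map_add, map_deconc_cons, h7, h8,
      proj₁_comp_cons, map_counit_deconc, LinearMap.mul'_apply, h12, h13, LinearMap.zero_apply,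
      map_smul, h11, koszul_curvature E hγ, proj₁_cons, proj₁_one, zero_mul]
    rw [h9]
    simp only [mul_add, smul_sub, smul_add, mul_smul_comm, neg_mul, smul_neg]
    rw [h10]
    abel

theorem isCurvedAInfinity_curvedDG (hγ : γ ∈ 𝒜 1) : IsCurvedAInfinity 𝒜 (curvedDG E γ) where
  degree := hasDegree_curvedDG E hγ
  coderivation := coderivation_comul _
  sq := coderivation_sq (curvedDGComponents_mem E hγ) (curvedDGComponents_comp E hγ)

end Components

/-! ### Gauge transformations -/

theorem conj_apply (g : Aˣ) (a : A) : conj 𝕜 g a = g * a * (g⁻¹ : Aˣ) := by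
  simp [conj, mul_assoc]

theorem conj_one : conj 𝕜 (1 : Aˣ) = LinearMap.id := by
  ext a
  simp [conj_apply]

theorem conj_comp_conj (g h : Aˣ) : conj 𝕜 g ∘ₗ conj 𝕜 h = conj 𝕜 (g * h) := by
  ext a
  simp [conj_apply, mul_assoc]

theorem gaugeRep_one : gaugeRep 𝕜 (1 : Aˣ) = LinearMap.id := by
  rw [gaugeRep, conj_one, tmap_id]

theorem gaugeRep_comp (g h : Aˣ) : gaugeRep 𝕜 g ∘ₗ gaugeRep 𝕜 h = gaugeRep 𝕜 (g * h) := by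
  rw [gaugeRep, gaugeRep, tmap_comp_tmap, conj_comp_conj, gaugeRep]

theorem DGDifferential.d_inv (E : DGDifferential 𝒜) {g : Aˣ} (hg : (g : A) ∈ 𝒜 0) :
    (g : A) * E.d (g⁻¹ : Aˣ) = -(E.d g * (g⁻¹ : Aˣ)) := by
  have h1 : E.d (1 : A) = 0 := by
    have h := E.d_mul 1 1
    rw [koszul_of_mem_zero SetLike.GradedOne.one_mem] at h
    simpa using h
  have h2 := E.d_mul g (g⁻¹ : Aˣ)
  rw [Units.mul_inv, h1, koszul_of_mem_zero hg] at h2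
  linear_combination (norm := noncomm_ring) -h2

theorem DGDifferential.d_inv' (E : DGDifferential 𝒜) {g : Aˣ} (hg : (g : A) ∈ 𝒜 0) :
    E.d (g⁻¹ : Aˣ) = -((g⁻¹ : Aˣ) * E.d g * (g⁻¹ : Aˣ)) := by
  calc E.d ((g⁻¹ : Aˣ) : A) = (g⁻¹ : Aˣ) * (g * E.d (g⁻¹ : Aˣ)) := by
        rw [Units.inv_mul_cancel_left]
    _ = _ := by rw [E.d_inv hg]; noncomm_ring

/-- Differentiating g g⁻¹ = 1 cancels the derivatives of `g` in the curvature of the transformed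
connection. -/
theorem DGDifferential.conj_curvature (E : DGDifferential 𝒜) {g : Aˣ} (hg : (g : A) ∈ 𝒜 0)
    (γ : A) (hγ : γ ∈ 𝒜 1) :
    conj 𝕜 g (E.d γ + γ * γ) =
      E.d (gaugeAct E g γ) + gaugeAct E g γ * gaugeAct E g γ := by
  have h := E.d_inv hg
  have h' := E.d_inv' hg
  have hd : koszul 𝒜 (E.d g) = E.d g := by
    rw [koszul_d, koszul_of_mem_zero hg, map_neg, neg_neg]
  rw [gaugeAct, h]
  simp only [conj_apply, map_add, map_neg, E.d_mul, E.d_d, koszul_of_mem_zero hg, h',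
    hd, koszul_of_mem_one hγ, mul_add, add_mul, mul_sub, mul_assoc, neg_mul, mul_neg,
    Units.inv_mul_cancel_left, neg_neg, zero_mul]
  abel

section Gauge

variable {g : Aˣ} (hg : (g : A) ∈ 𝒜 0) (hg' : ((g⁻¹ : Aˣ) : A) ∈ 𝒜 0)

include hg hg'

theorem conj_mem (p : ℤ) (a : A) (ha : a ∈ 𝒜 p) : conj 𝕜 g a ∈ 𝒜 p := by
  rw [conj_apply]
  have := SetLike.mul_mem_graded (SetLike.mul_mem_graded hg ha) hg'
  rwa [zero_add, add_zero] at this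

theorem hasDegree_gaugeRep : HasDegree 𝒜 𝒜 0 (gaugeRep 𝕜 g) :=
  hasDegree_tmap (conj_mem hg hg')

theorem koszul_conj (a : A) : koszul 𝒜 (conj 𝕜 g a) = conj 𝕜 g (koszul 𝒜 a) :=
  congrArg (fun F => F a) (koszul_comp_of_even (conj_mem (𝕜 := 𝕜) hg hg'))

variable (E : DGDifferential 𝒜)

theorem conj_covariantDerivative (γ a : A) :
    conj 𝕜 g (covariantDerivative E γ a) =
      covariantDerivative E (gaugeAct E g γ) (conj 𝕜 g a) := by
  have h := E.d_inv hg
  have h' := E.d_inv' hg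
  rw [covariantDerivative_apply, covariantDerivative_apply, koszul_conj hg hg', gaugeAct, h]
  simp only [conj_apply, E.d_mul, koszul_of_mem_zero hg, h', mul_add, add_mul, mul_sub, mul_assoc,
    neg_mul, mul_neg, Units.inv_mul_cancel_left, neg_neg]
  abel

theorem conj_comp_curvedDGComponents (γ : A) (hγ : γ ∈ 𝒜 1) :
    conj 𝕜 g ∘ₗ curvedDGComponents E γ =
      curvedDGComponents E (gaugeAct E g γ) ∘ₗ gaugeRep 𝕜 g := by
  refine linearMap_ext_words ?_ fun v x _ => ?_
  · simp only [LinearMap.comp_apply, gaugeRep, tmap_one, curvedDGComponents_one]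
    exact E.conj_curvature hg γ hγ
  · have h1 : counit 𝕜 A (tmap (conj 𝕜 g) x) = counit 𝕜 A x := counit_tmap _ _
    have h2 : proj₁ 𝕜 A (tmap (conj 𝕜 g) x) = conj 𝕜 g (proj₁ 𝕜 A x) :=
      LinearMap.congr_fun (proj₁_comp_tmap (conj 𝕜 g)) x
    simp only [LinearMap.comp_apply, gaugeRep, tmap_cons, curvedDGComponents_cons, h1, h2,
      ← conj_covariantDerivative hg hg' E, koszul_conj hg hg', map_add, map_smul]
    congr 1
    simp [conj_apply, mul_assoc]

/-- The difference of the two sides obeys a co-Leibniz rule along ρ(g), because ρ(g) is a coalgebra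
map of degree 0. It therefore vanishes as soon as its corestriction does, which is
`conj_comp_curvedDGComponents`. -/
theorem gaugeRep_comp_curvedDG (γ : A) (hγ : γ ∈ 𝒜 1) :
    gaugeRep 𝕜 g ∘ₗ curvedDG E γ = curvedDG E (gaugeAct E g γ) ∘ₗ gaugeRep 𝕜 g := by
  have hρ : deconc 𝕜 A ∘ₗ gaugeRep 𝕜 g =
      TensorProduct.map (gaugeRep 𝕜 g) (gaugeRep 𝕜 g) ∘ₗ deconc 𝕜 A := deconc_comp_tmap (conj 𝕜 g)
  have hε : counit 𝕜 A ∘ₗ gaugeRep 𝕜 g = _ := counit_comp_tmap (conj 𝕜 g)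
  have hp : proj₁ 𝕜 A ∘ₗ gaugeRep 𝕜 g = _ := proj₁_comp_tmap (conj 𝕜 g)
  have hΔ : ∀ γ, deconc 𝕜 A ∘ₗ curvedDG E γ = (TensorProduct.map (curvedDG E γ) LinearMap.id +
      TensorProduct.map (tmap (koszul 𝒜)) (curvedDG E γ)) ∘ₗ deconc 𝕜 A := fun γ =>
    coderivation_comul (𝒱 := 𝒜) (curvedDGComponents E γ)
  have hε' : ∀ γ, counit 𝕜 A ∘ₗ curvedDG E γ = 0 := fun γ => counit_comp_coderivation _
  have hp' : ∀ γ, proj₁ 𝕜 A ∘ₗ curvedDG E γ = _ := fun γ =>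
    proj₁_comp_coderivation (𝒱 := 𝒜) (curvedDGComponents E γ)
  have hK : tmap (koszul 𝒜) ∘ₗ gaugeRep 𝕜 g = gaugeRep 𝕜 g ∘ₗ tmap (koszul 𝒜) := by
    have := (hasDegree_gaugeRep (𝕜 := 𝕜) hg hg').tmap_koszul_comp
    rwa [zpow_zero, one_smul] at this
  rw [← sub_eq_zero]
  have sub_right : ∀ a b c : Module.End 𝕜 (TensorAlgebra 𝕜 A),
      TensorProduct.map a (b - c) = TensorProduct.map a b - TensorProduct.map a c := fun a b c =>
    TensorProduct.ext' fun x y => by simp [TensorProduct.tmul_sub]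
  have sub_left : ∀ a b c : Module.End 𝕜 (TensorAlgebra 𝕜 A),
      TensorProduct.map (a - b) c = TensorProduct.map a c - TensorProduct.map b c := fun a b c =>
    TensorProduct.ext' fun x y => by simp [TensorProduct.sub_tmul]
  refine eq_zero_of_coLeibniz (g := gaugeRep 𝕜 g) (f := gaugeRep 𝕜 g ∘ₗ tmap (koszul 𝒜))
    (k := conj 𝕜 g ∘ₗ koszul 𝒜) ?_ ?_ ?_ ?_
  · rw [LinearMap.comp_sub, ← LinearMap.comp_assoc, hρ, LinearMap.comp_assoc, hΔ,
      ← LinearMap.comp_assoc (gaugeRep 𝕜 g), hΔ, LinearMap.comp_assoc (gaugeRep 𝕜 g), hρ,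
      ← LinearMap.comp_assoc, ← LinearMap.comp_assoc, ← LinearMap.sub_comp]
    congr 1
    simp only [LinearMap.comp_add, LinearMap.add_comp, ← TensorProduct.map_comp, hK,
      LinearMap.id_comp, LinearMap.comp_id, sub_left, sub_right]
    abel
  · rw [← LinearMap.comp_assoc, hp, LinearMap.comp_assoc, proj₁_comp_tmap, LinearMap.comp_assoc]
  · rw [LinearMap.comp_sub, ← LinearMap.comp_assoc, hε, hε', ← LinearMap.comp_assoc, hε',
      LinearMap.zero_comp, sub_zero]
  · rw [LinearMap.comp_sub, ← LinearMap.comp_assoc, hp, LinearMap.comp_assoc, hp',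
      ← LinearMap.comp_assoc, hp', conj_comp_curvedDGComponents hg hg' E γ hγ, sub_self]

end Gauge

end DG

/-! ### Transfer of structure from T(sA) to T(sB). -/

section Transfer

variable {𝕜 : Type u} [Field 𝕜]
variable {A : Type v} [Ring A] [Algebra 𝕜 A] {𝒜 : ℤ → Submodule 𝕜 A} [GradedAlgebra 𝒜]
variable {B : Type v} [AddCommGroup B] [Module 𝕜 B] {ℬ : ℤ → Submodule 𝕜 B}
variable {E : DGDifferential 𝒜} {dB : Differential ℬ}

theorem tensorDifferential_eq {V : Type v} [AddCommGroup V] [Module 𝕜 V] {𝒱 : ℤ → Submodule 𝕜 V}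
    [DirectSum.Decomposition 𝒱] (D : Differential 𝒱) :
    tensorDifferential D =
      insertOp (tmap (koszul 𝒱)) (D.d ∘ₗ proj₁ 𝕜 V) (tmap LinearMap.id) := by
  rw [tmap_id]
  rfl

theorem tmap_comp_tensorDifferential {V W : Type v} [AddCommGroup V] [Module 𝕜 V]
    [AddCommGroup W] [Module 𝕜 W] {𝒱 : ℤ → Submodule 𝕜 V} {𝒲 : ℤ → Submodule 𝕜 W}
    [DirectSum.Decomposition 𝒱] [DirectSum.Decomposition 𝒲] {D : Differential 𝒱}
    {D' : Differential 𝒲} {f : V →ₗ[𝕜] W} (hf : ∀ p, ∀ v ∈ 𝒱 p, f v ∈ 𝒲 p)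
    (hd : ∀ v, f (D.d v) = D'.d (f v)) :
    tmap f ∘ₗ tensorDifferential D = tensorDifferential D' ∘ₗ tmap f := by
  rw [tensorDifferential_eq, tensorDifferential_eq]
  exact tmap_comp_insertOp (koszul_comp_of_even hf).symm (LinearMap.ext hd) rfl

theorem groupLike_image {V W : Type v} [AddCommGroup V] [Module 𝕜 V]
    [AddCommGroup W] [Module 𝕜 W] {F : TensorAlgebra 𝕜 V →ₗ[𝕜] TensorAlgebra 𝕜 W}
    (hF : IsCoalgebraMap F) : F 1 = 1 := by
  refine eq_one_of_groupLike ?_ ?_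
  · simpa using LinearMap.congr_fun hF.counit 1
  · simpa [Algebra.TensorProduct.one_def] using LinearMap.congr_fun hF.comul 1

variable (c : SpecialContraction E.toDifferential dB)

theorem hasDegree_tensorHomotopy : HasDegree 𝒜 𝒜 (-1) (tensorHomotopy c) := by
  refine hasDegree_insertOp (fun _ _ hv => koszul_mem hv)
    (hasDegree_tmap fun p v hv => c.i_mem p _ (c.p_mem p v hv)) (tmap_one _) fun n x hx => ?_
  exact c.H_mem _ _ (proj₁_mem hx)

theorem mul_sub_add_sub_mul_add_sq {R : Type*} [Ring R] {D d : R} (hD : D * D = 0)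
    (hd : d * d = 0) : d * (D - d) + (D - d) * d + (D - d) * (D - d) = 0 := by
  linear_combination (norm := noncomm_ring) hD - hd

theorem perturbation_sq {γ : A} (hγ : γ ∈ 𝒜 1) :
    tensorDifferential E.toDifferential * perturbation E γ +
      perturbation E γ * tensorDifferential E.toDifferential +
      perturbation E γ * perturbation E γ = 0 := by
  have h1 : curvedDG E γ * curvedDG E γ = 0 := (isCurvedAInfinity_curvedDG E hγ).sq
  have h2 : tensorDifferential E.toDifferential * tensorDifferential E.toDifferential = 0 :=
    tensorDifferential_sq _
  exact mul_sub_add_sub_mul_add_sq h1 h2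

theorem deconc_tensorHomotopy :
    deconc 𝕜 A ∘ₗ tensorHomotopy c =
      (TensorProduct.map (tensorHomotopy c) (tmap c.i ∘ₗ tmap c.p) +
        TensorProduct.map (tmap (koszul 𝒜)) (tensorHomotopy c)) ∘ₗ deconc 𝕜 A := by
  rw [tmap_comp_tmap]
  exact deconc_insertOp _ _ _

/-- Moving `H` past c(g) produces HH, Hip or ipH. This avoids any commutation between c(g) and ip.
-/
theorem tensorHomotopy_gaugeRep_tensorHomotopy {g : Aˣ}
    (hH : ∀ a, c.H (conj 𝕜 g a) = conj 𝕜 g (c.H a)) :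
    tensorHomotopy c * gaugeRep 𝕜 g * tensorHomotopy c = 0 :=
  insertOp_comp_tmap_comp_insertOp (LinearMap.ext fun a => by simp [hH, c.H_H])
    (LinearMap.ext fun a => by simp [hH, c.H_i])
    (LinearMap.ext fun a => by simp [← hH, c.p_H])

section Degree

variable {γ : A} (hγ : γ ∈ 𝒜 1) (h : IsTransferable c γ)

include hγ in
theorem hasDegree_perturbation : HasDegree 𝒜 𝒜 1 (perturbation E γ) :=
  (hasDegree_curvedDG E hγ).sub (hasDegree_tensorDifferential _)

-- δ_γ T(H) has degree 0, so the inverse of 1 - δ_γ T(H) does too.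
include hγ h in
theorem hasDegree_sigma : HasDegree 𝒜 𝒜 1 (sigma c γ) := by
  have hδ := hasDegree_perturbation (E := E) hγ
  have h0 : HasDegree 𝒜 𝒜 0 (perturbation E γ ∘ₗ tensorHomotopy c) :=
    hδ.comp_of_eq (hasDegree_tensorHomotopy c) (by norm_num)
  have h1 : HasDegree 𝒜 𝒜 0 (1 - perturbation E γ * tensorHomotopy c) := hasDegree_id.sub h0
  have h2 : HasDegree 𝒜 𝒜 0 (Ring.inverse (1 - perturbation E γ * tensorHomotopy c)) :=
    h1.inverse h
  have h3 : HasDegree 𝒜 𝒜 1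
      (Ring.inverse (1 - perturbation E γ * tensorHomotopy c) ∘ₗ perturbation E γ) :=
    h2.comp_of_eq hδ (by norm_num)
  exact h3

include hγ h in
theorem hasDegree_transferI : HasDegree ℬ 𝒜 0 (transferI c γ) := by
  have hi : HasDegree ℬ 𝒜 0 (tmap c.i) := hasDegree_tmap c.i_mem
  have h1 : HasDegree ℬ 𝒜 1 (sigma c γ ∘ₗ tmap c.i) :=
    (hasDegree_sigma c hγ h).comp_of_eq hi (by norm_num)
  have h2 : HasDegree ℬ 𝒜 0 (tensorHomotopy c ∘ₗ sigma c γ ∘ₗ tmap c.i) :=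
    (hasDegree_tensorHomotopy c).comp_of_eq h1 (by norm_num)
  exact hi.add h2

include hγ h in
theorem hasDegree_transferP : HasDegree 𝒜 ℬ 0 (transferP c γ) := by
  have hp : HasDegree 𝒜 ℬ 0 (tmap c.p) := hasDegree_tmap c.p_mem
  have h1 : HasDegree 𝒜 𝒜 0 (sigma c γ ∘ₗ tensorHomotopy c) :=
    (hasDegree_sigma c hγ h).comp_of_eq (hasDegree_tensorHomotopy c) (by norm_num)
  have h2 : HasDegree 𝒜 ℬ 0 (tmap c.p ∘ₗ sigma c γ ∘ₗ tensorHomotopy c) :=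
    hp.comp_of_eq h1 (by norm_num)
  exact hp.add h2

end Degree

variable [DirectSum.Decomposition ℬ]

/-- The special contraction `(T(p), T(i), T(H))` with the perturbation `δ_γ` of `T(d)`. -/
def perturbedContraction {γ : A} (hγ : γ ∈ 𝒜 1) (h : IsTransferable c γ) :
    PerturbedContraction 𝕜 (TensorAlgebra 𝕜 A) (TensorAlgebra 𝕜 B) where
  d := tensorDifferential E.toDifferential
  h := tensorHomotopy c
  dN := tensorDifferential dB
  i := tmap c.i
  p := tmap c.p
  δ := perturbation E γ
  p_i := by
    rw [tmap_comp_tmap, ← tmap_id]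
    exact congrArg tmap (LinearMap.ext c.p_i)
  p_d := tmap_comp_tensorDifferential c.p_mem c.p_d
  i_d := tmap_comp_tensorDifferential c.i_mem c.i_d
  homotopy := by
    rw [tmap_comp_tmap]
    refine insertOp_homotopy koszul_comp_koszul E.koszul_comp (koszul_comp_of_odd (k := -1)
      (by decide) fun p v hv => c.H_mem p v hv) ?_ ?_ ?_
    · ext a
      simp [c.p_d, c.i_d]
    · exact koszul_comp_of_even fun p v hv => c.i_mem p _ (c.p_mem p v hv)
    · ext a
      have := c.homotopy a
      simp only [LinearMap.comp_apply, LinearMap.add_apply, LinearMap.id_apply]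
      rw [add_assoc, ← this]
      abel
  h_i := insertOp_comp_tmap_eq_zero (LinearMap.ext c.H_i)
  p_h := tmap_comp_insertOp_eq_zero (LinearMap.ext c.p_H)
  h_h := by
    have := insertOp_comp_tmap_comp_insertOp (c := LinearMap.id) (h := c.H) (g := c.i ∘ₗ c.p)
      (k := koszul 𝒜) (LinearMap.ext c.H_H) (LinearMap.ext fun a => c.H_i _)
      (LinearMap.ext fun a => by simp [c.p_H])
    rwa [tmap_id, LinearMap.id_comp] at this
  d_δ := perturbation_sq hγ
  isUnit := h

section Facts

variable {γ : A} (hγ : γ ∈ 𝒜 1) (h : IsTransferable c γ)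

theorem perturbedContraction_h : (perturbedContraction c hγ h).h = tensorHomotopy c := rfl

theorem perturbedContraction_I : (perturbedContraction c hγ h).I = transferI c γ := rfl

theorem perturbedContraction_P : (perturbedContraction c hγ h).P = transferP c γ := rfl

theorem perturbedContraction_D : (perturbedContraction c hγ h).D = curvedDG E γ :=
  add_sub_cancel _ _

include hγ h in
theorem hasDegree_transferD : HasDegree ℬ ℬ 1 (transferD c γ) := by
  have hi : HasDegree ℬ 𝒜 0 (tmap c.i) := hasDegree_tmap c.i_mem
  have hp : HasDegree 𝒜 ℬ 0 (tmap c.p) := hasDegree_tmap c.p_mem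
  have h1 : HasDegree ℬ 𝒜 1 (sigma c γ ∘ₗ tmap c.i) :=
    (hasDegree_sigma c hγ h).comp_of_eq hi (by norm_num)
  have h2 : HasDegree ℬ ℬ 1 (tmap c.p ∘ₗ sigma c γ ∘ₗ tmap c.i) :=
    hp.comp_of_eq h1 (by norm_num)
  exact (hasDegree_tensorDifferential dB).add h2

theorem koszul_mul_curvedDG :
    tmap (koszul 𝒜) * (perturbedContraction c hγ h).D =
      -((perturbedContraction c hγ h).D * tmap (koszul 𝒜)) := by
  rw [perturbedContraction_D]
  exact (hasDegree_curvedDG E hγ).koszul_anticomm odd_one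

theorem koszul_mul_H :
    tmap (koszul 𝒜) * (perturbedContraction c hγ h).H =
      -((perturbedContraction c hγ h).H * tmap (koszul 𝒜)) := by
  have h1 : HasDegree 𝒜 𝒜 0 (tensorHomotopy c ∘ₗ sigma c γ) :=
    (hasDegree_tensorHomotopy c).comp_of_eq (hasDegree_sigma c hγ h) (by norm_num)
  have h2 : HasDegree 𝒜 𝒜 (-1) ((tensorHomotopy c ∘ₗ sigma c γ) ∘ₗ tensorHomotopy c) :=
    h1.comp_of_eq (hasDegree_tensorHomotopy c) (by norm_num)
  have h3 : HasDegree 𝒜 𝒜 (-1) (perturbedContraction c hγ h).H :=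
    (hasDegree_tensorHomotopy c).add h2
  exact h3.koszul_anticomm (by decide)

theorem deconc_perturbedContraction_D :
    deconc 𝕜 A ∘ₗ (perturbedContraction c hγ h).D =
      (TensorProduct.map (perturbedContraction c hγ h).D 1 +
        TensorProduct.map (tmap (koszul 𝒜)) (perturbedContraction c hγ h).D) ∘ₗ deconc 𝕜 A := by
  rw [perturbedContraction_D]
  exact coderivation_comul _

include hγ h in
theorem transferP_comp_koszul :
    transferP c γ ∘ₗ tmap (koszul 𝒜) = tmap (koszul ℬ) ∘ₗ transferP c γ := by
  have := (hasDegree_transferP c hγ h).tmap_koszul_comp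
  rw [zpow_zero, one_smul] at this
  exact this.symm

theorem counit_comp_perturbation : counit 𝕜 A ∘ₗ perturbation E γ = 0 := by
  rw [perturbation, LinearMap.comp_sub]
  have h1 : counit 𝕜 A ∘ₗ curvedDG E γ = 0 := counit_comp_coderivation _
  have h2 : counit 𝕜 A ∘ₗ tensorDifferential E.toDifferential = 0 := counit_comp_coderivation _
  rw [h1, h2, sub_zero]

include hγ h in
theorem isCoalgebraMap_transferI : IsCoalgebraMap (transferI c γ) where
  comul := (perturbedContraction c hγ h).comul_I (deconc_comp_tmap c.p) (deconc_tensorHomotopy c)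
    (deconc_perturbedContraction_D c hγ h) tmap_koszul_tmap_koszul
    (koszul_mul_curvedDG c hγ h) (koszul_mul_H c hγ h)
  counit := by
    have h1 : counit 𝕜 A ∘ₗ tensorHomotopy c = 0 := counit_insertOp _ _ _
    rw [transferI, LinearMap.comp_add, counit_comp_tmap, ← LinearMap.comp_assoc, h1,
      LinearMap.zero_comp, add_zero]

include hγ h in
theorem isCoalgebraMap_transferP : IsCoalgebraMap (transferP c γ) where
  comul := (perturbedContraction c hγ h).comul_P (deconc_comp_tmap c.p) (deconc_tensorHomotopy c)
    (deconc_perturbedContraction_D c hγ h) tmap_koszul_tmap_koszul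
    (transferP_comp_koszul c hγ h)
  counit := by
    have h1 : counit 𝕜 A ∘ₗ sigma c γ = 0 := by
      -- Put δ_γ leftmost in Σ_γ: its image has no part of length 0.
      have h2 : sigma c γ = perturbation E γ ∘ₗ (1 + tensorHomotopy c * sigma c γ) := by
        have h3 : sigma c γ = perturbation E γ + perturbation E γ * tensorHomotopy c * sigma c γ :=
          (perturbedContraction c hγ h).S_eq
        rw [LinearMap.comp_add]
        exact h3
      rw [h2, ← LinearMap.comp_assoc, counit_comp_perturbation, LinearMap.zero_comp]
    rw [transferP, LinearMap.comp_add, counit_comp_tmap, ← LinearMap.comp_assoc, counit_comp_tmap,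
      ← LinearMap.comp_assoc, h1, LinearMap.zero_comp, add_zero]

include hγ h in
theorem transferP_comp_transferI : transferP c γ ∘ₗ transferI c γ = LinearMap.id :=
  (perturbedContraction c hγ h).P_comp_I

include hγ h in
theorem transferP_comp_curvedDG_comp_transferI :
    transferP c γ ∘ₗ curvedDG E γ ∘ₗ transferI c γ = transferD c γ := by
  have := (perturbedContraction c hγ h).P_comp_D_comp_I
  rwa [perturbedContraction_D] at this

include hγ h in
theorem isCurvedAInfinity_transferD : IsCurvedAInfinity ℬ (transferD c γ) where
  degree := hasDegree_transferD c hγ h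
  coderivation := (perturbedContraction c hγ h).comul_Dt (deconc_comp_tmap c.p)
    (deconc_tensorHomotopy c) (deconc_perturbedContraction_D c hγ h) tmap_koszul_tmap_koszul
    (koszul_mul_curvedDG c hγ h) (koszul_mul_H c hγ h) (transferP_comp_koszul c hγ h)
  sq := (perturbedContraction c hγ h).Dt_comp_Dt (by
    rw [perturbedContraction_D]
    exact (isCurvedAInfinity_curvedDG E hγ).sq)

end Facts

/-! ### Gauge transformations on the transferred side. -/

section GaugeInvariance

variable {γ γ' : A} (hγ : γ ∈ 𝒜 1) (hγ' : γ' ∈ 𝒜 1) (h : IsTransferable c γ)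
  (h' : IsTransferable c γ') {g : Aˣ} (hg : (g : A) ∈ 𝒜 0) (hg' : ((g⁻¹ : Aˣ) : A) ∈ 𝒜 0)
  (hgγ : gaugeAct E g γ = γ') (hH : ∀ a, c.H (conj 𝕜 g a) = conj 𝕜 g (c.H a))

include hγ h hg hg' hgγ in
theorem gaugeRep_mul_perturbedContraction_D :
    gaugeRep 𝕜 g * (perturbedContraction c hγ h).D =
      (perturbedContraction c hγ' h').D * gaugeRep 𝕜 g := by
  rw [perturbedContraction_D, perturbedContraction_D, ← hgγ]
  exact gaugeRep_comp_curvedDG hg hg' E γ hγ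

include hγ hγ' h h' hg hg' hgγ hH in
/-- `ρ(g)` maps the image of `I_γ` to the image of `I_γ'`. -/
theorem transferI_comp_transferRep :
    transferI c γ' ∘ₗ transferRep c γ γ' g = gaugeRep 𝕜 g ∘ₗ transferI c γ := by
  have h1 : tensorHomotopy c * gaugeRep 𝕜 g * (tmap c.i ∘ₗ tmap c.p) = 0 := by
    have h2 : tensorHomotopy c ∘ₗ tmap (conj 𝕜 g ∘ₗ c.i ∘ₗ c.p) = 0 :=
      insertOp_comp_tmap_eq_zero (LinearMap.ext fun a => by simp [hH, c.H_i])
    rw [← tmap_comp_tmap, ← tmap_comp_tmap] at h2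
    exact h2
  have key := PerturbedContraction.I_comp_P_intertwine (C := perturbedContraction c hγ h)
    (C' := perturbedContraction c hγ' h')
    ((perturbedContraction_h c hγ' h').trans (perturbedContraction_h c hγ h).symm)
    (gaugeRep_mul_perturbedContraction_D c hγ hγ' h h' hg hg' hgγ)
    (tensorHomotopy_gaugeRep_tensorHomotopy c hH) h1
  simp only [perturbedContraction_I, perturbedContraction_P] at key
  rw [transferRep]
  exact key

include hγ hγ' h h' hg hg' hgγ hH in
theorem transferRep_comp_transferP :
    transferRep c γ γ' g ∘ₗ transferP c γ = transferP c γ' ∘ₗ gaugeRep 𝕜 g := by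
  have h1 : (tmap c.i ∘ₗ tmap c.p) * gaugeRep 𝕜 g * tensorHomotopy c = 0 := by
    have h2 : tmap ((c.i ∘ₗ c.p) ∘ₗ conj 𝕜 g) ∘ₗ tensorHomotopy c = 0 :=
      tmap_comp_insertOp_eq_zero (LinearMap.ext fun a => by simp [← hH, c.p_H])
    rw [← tmap_comp_tmap, ← tmap_comp_tmap] at h2
    exact h2
  have key := PerturbedContraction.P_intertwine (C := perturbedContraction c hγ h)
    (C' := perturbedContraction c hγ' h')
    ((perturbedContraction_h c hγ' h').trans (perturbedContraction_h c hγ h).symm)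
    (gaugeRep_mul_perturbedContraction_D c hγ hγ' h h' hg hg' hgγ)
    (tensorHomotopy_gaugeRep_tensorHomotopy c hH) h1
  simp only [perturbedContraction_I, perturbedContraction_P] at key
  rw [transferRep, LinearMap.comp_assoc, LinearMap.comp_assoc]
  exact key

include hγ hγ' h h' in
theorem isCoalgebraMap_transferRep : IsCoalgebraMap (transferRep c γ γ' g) :=
  (isCoalgebraMap_transferP c hγ' h').comp
    ((isCoalgebraMap_tmap _).comp (isCoalgebraMap_transferI c hγ h))

omit [DirectSum.Decomposition ℬ] in
include hγ hγ' h h' hg hg' in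
theorem hasDegree_transferRep : HasDegree ℬ ℬ 0 (transferRep c γ γ' g) := by
  have h1 : HasDegree ℬ 𝒜 0 (gaugeRep 𝕜 g ∘ₗ transferI c γ) :=
    (hasDegree_gaugeRep hg hg').comp_of_eq (hasDegree_transferI c hγ h) (by norm_num)
  exact (hasDegree_transferP c hγ' h').comp_of_eq h1 (by norm_num)

-- After pulling back along I_γ', the map ρ̃(g) becomes ρ(g) I_γ, and ρ(g) is an isometry of T(sA).
include hγ hγ' h h' hg hg' hgγ hH in
theorem transferForm_transferRep {β : A →ₗ[𝕜] A →ₗ[𝕜] 𝕜}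
    (hβ : ∀ a b, β (conj 𝕜 g a) (conj 𝕜 g b) = β a b) (x y : TensorAlgebra 𝕜 B) :
    transferForm c β γ' (transferRep c γ γ' g x) (transferRep c γ γ' g y) =
      transferForm c β γ x y := by
  have hI : ∀ x, transferI c γ' (transferRep c γ γ' g x) = gaugeRep 𝕜 g (transferI c γ x) :=
    fun x => LinearMap.congr_fun
      (transferI_comp_transferRep c hγ hγ' h h' hg hg' hgγ hH) x
  simp only [transferForm, LinearMap.compl₁₂_apply, hI]
  exact tensorForm_tmap hβ _ _

-- The intertwining of the first factor with I removes the inner I_γ' P_γ', so nothing is needed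
-- about how `k` acts on γ'.
include hγ hγ' h h' hg hg' hgγ hH in
theorem transferRep_comp_transferRep {γ'' : A} {k : Aˣ} :
    transferRep c γ' γ'' k ∘ₗ transferRep c γ γ' g = transferRep c γ γ'' (k * g) := by
  have hI := transferI_comp_transferRep c hγ hγ' h h' hg hg' hgγ hH
  rw [transferRep, LinearMap.comp_assoc, LinearMap.comp_assoc, hI, ← LinearMap.comp_assoc
    (transferI c γ), gaugeRep_comp, transferRep]

include hγ h in
theorem transferRep_one : transferRep c γ γ (1 : Aˣ) = LinearMap.id := by
  rw [transferRep, gaugeRep_one, LinearMap.id_comp, transferP_comp_transferI c hγ h]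

include hγ hγ' h h' hg hg' hgγ hH in
theorem transferRep_comp_transferD_comp_transferRep :
    transferRep c γ γ' g ∘ₗ transferD c γ ∘ₗ transferRep c γ' γ g⁻¹ = transferD c γ' := by
  have hP := transferRep_comp_transferP c hγ hγ' h h' hg hg' hgγ hH
  have hI := transferI_comp_transferRep c hγ hγ' h h' hg hg' hgγ hH
  have h1 : transferRep c γ γ' g ∘ₗ transferRep c γ' γ g⁻¹ = LinearMap.id := by
    rw [transferRep.eq_def c γ' γ g⁻¹, ← LinearMap.comp_assoc, hP, LinearMap.comp_assoc,
      ← LinearMap.comp_assoc (transferI c γ'), gaugeRep_comp, mul_inv_cancel, gaugeRep_one,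
      LinearMap.id_comp, transferP_comp_transferI c hγ' h']
  have hD := gaugeRep_comp_curvedDG hg hg' E γ hγ
  rw [hgγ] at hD
  rw [← transferP_comp_curvedDG_comp_transferI c hγ h]
  simp only [← LinearMap.comp_assoc]
  rw [hP, LinearMap.comp_assoc _ _ (transferP c γ'), hD, ← LinearMap.comp_assoc,
    LinearMap.comp_assoc _ (gaugeRep 𝕜 g), ← hI]
  simp only [LinearMap.comp_assoc]
  rw [h1, LinearMap.comp_id, transferP_comp_curvedDG_comp_transferI c hγ' h']

end GaugeInvariance

theorem isPartiallyIsometric_of_isometric {V W : Type v} [AddCommGroup V] [Module 𝕜 V]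
    [AddCommGroup W] [Module 𝕜 W]
    {bV : TensorAlgebra 𝕜 V →ₗ[𝕜] TensorAlgebra 𝕜 V →ₗ[𝕜] 𝕜}
    {bW : TensorAlgebra 𝕜 W →ₗ[𝕜] TensorAlgebra 𝕜 W →ₗ[𝕜] 𝕜}
    {F : TensorAlgebra 𝕜 V →ₗ[𝕜] TensorAlgebra 𝕜 W} (hF : Function.Injective F)
    (h : ∀ x y, bW (F x) (F y) = bV x y) : IsPartiallyIsometric bV bW F := by
  refine ⟨⊤, ?_, fun x _ y _ => h x y⟩
  rw [LinearMap.ker_eq_bot.2 hF]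
  exact isCompl_top_bot

/-- The image of a right inverse is a complement of the kernel, and `F` inverts `G` there. Applied
to P_γ and I_γ, the isometry condition is the definition of the form on T(sB). -/
theorem isPartiallyIsometric_of_rightInverse {V W : Type v} [AddCommGroup V] [Module 𝕜 V]
    [AddCommGroup W] [Module 𝕜 W]
    {bV : TensorAlgebra 𝕜 V →ₗ[𝕜] TensorAlgebra 𝕜 V →ₗ[𝕜] 𝕜}
    {bW : TensorAlgebra 𝕜 W →ₗ[𝕜] TensorAlgebra 𝕜 W →ₗ[𝕜] 𝕜}
    {F : TensorAlgebra 𝕜 V →ₗ[𝕜] TensorAlgebra 𝕜 W}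
    {G : TensorAlgebra 𝕜 W →ₗ[𝕜] TensorAlgebra 𝕜 V} (hFG : F ∘ₗ G = LinearMap.id)
    (h : ∀ x y, bV (G x) (G y) = bW x y) : IsPartiallyIsometric bV bW F := by
  have hFG' : ∀ x, F (G x) = x := LinearMap.congr_fun hFG
  have hc : IsCompl (LinearMap.range G) (LinearMap.ker F) := by
    refine IsCompl.of_le (fun x hx => ?_) fun x _ => ?_
    · obtain ⟨⟨y, rfl⟩, hy⟩ := hx
      rw [SetLike.mem_coe, LinearMap.mem_ker, hFG'] at hy
      rw [hy, map_zero]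
      exact zero_mem _
    · rw [← add_sub_cancel (G (F x)) x]
      exact Submodule.add_mem_sup (LinearMap.mem_range_self G _) (by simp [hFG'])
  refine ⟨LinearMap.range G, hc, ?_⟩
  rintro _ ⟨x, rfl⟩ _ ⟨y, rfl⟩
  rw [hFG', hFG', h]

end Transfer

/-! ### Assembly of the two gauge theories and of the natural transformation. -/

section Theories

variable {𝕜 : Type u} [Field 𝕜]
variable {A : Type v} [Ring A] [Algebra 𝕜 A] {𝒜 : ℤ → Submodule 𝕜 A} [GradedAlgebra 𝒜]
variable {B : Type v} [AddCommGroup B] [Module 𝕜 B] {ℬ : ℤ → Submodule 𝕜 B}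
variable {E : DGDifferential 𝒜} {dB : Differential ℬ}
variable {G : Subgroup Aˣ} (hG : ∀ g ∈ G, (g : A) ∈ 𝒜 0) {β : A →ₗ[𝕜] A →ₗ[𝕜] 𝕜} {Γ : Set A}

omit [GradedAlgebra 𝒜] in
theorem isGradedInnerProduct_tensorForm (β_symm : ∀ a b, β a b = β b a)
    (β_nondegenerate : ∀ a, (∀ b, β a b = 0) → a = 0)
    (β_graded : ∀ m n : ℤ, m ≠ n → ∀ a ∈ 𝒜 m, ∀ b ∈ 𝒜 n, β a b = 0) :
    IsGradedInnerProduct 𝒜 (tensorForm β) where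
  symm := tensorForm_symm β_symm
  nondegenerate x hx :=
    tensorForm_nondegenerate (fun a ha => β_nondegenerate a fun b => by rw [β_symm, ha]) x
      fun y => by rw [tensorForm_symm β_symm, hx]
  graded := tensorForm_graded β_graded

/-- Use the adjointness of left and right multiplication by `g` once in each argument; g⁻¹ cancels
both times. -/
theorem form_conj (β_symm : ∀ a b, β a b = β b a)
    (β_adjoint : ∀ g ∈ G, ∀ a b, β (g * a) b = β a (b * g)) {g : Aˣ} (hg : g ∈ G) (a b : A) :
    β (conj 𝕜 g a) (conj 𝕜 g b) = β a b := by
  rw [conj_apply, conj_apply, mul_assoc, β_adjoint g hg, Units.inv_mul_cancel_right, β_symm,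
    β_adjoint g hg, Units.inv_mul_cancel_right, β_symm]

theorem isMorphism_gaugeTheoryA (β_symm : ∀ a b, β a b = β b a)
    (β_adjoint : ∀ g ∈ G, ∀ a b, β (g * a) b = β a (b * g)) (hΓ : ∀ γ ∈ Γ, γ ∈ 𝒜 1)
    {x y : GaugeGroupoid E G hG Γ} (f : x ⟶ y) :
    GradedTriple.IsMorphism ((gaugeTheoryA E β G hG Γ).map f) := by
  obtain ⟨⟨g, hg⟩, hf⟩ := f
  have h0 := hG g hg
  have h0' := hG g⁻¹ (inv_mem hg)
  have h1 : gaugeRep 𝕜 g⁻¹ ∘ₗ gaugeRep 𝕜 g = LinearMap.id := by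
    rw [gaugeRep_comp, inv_mul_cancel, gaugeRep_one]
  have h2 : gaugeRep 𝕜 g ∘ₗ gaugeRep 𝕜 g⁻¹ = LinearMap.id := by
    rw [gaugeRep_comp, mul_inv_cancel, gaugeRep_one]
  have hinj : ∀ {F F' : Module.End 𝕜 (TensorAlgebra 𝕜 A)}, F' ∘ₗ F = LinearMap.id →
      Function.Injective F := fun h => Function.LeftInverse.injective (LinearMap.congr_fun h)
  have hd : HasDegree 𝒜 𝒜 0 (gaugeRep 𝕜 g) := hasDegree_gaugeRep h0 h0'
  have hd' : HasDegree 𝒜 𝒜 0 (gaugeRep 𝕜 g⁻¹) := hasDegree_gaugeRep h0' (by rwa [inv_inv])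
  have hc : ∀ g : Aˣ, IsCoalgebraMap (gaugeRep 𝕜 g) := fun _ => isCoalgebraMap_tmap _
  have hu : ∀ g : Aˣ, gaugeRep 𝕜 g 1 = 1 := fun _ => tmap_one _
  have hi : IsPartiallyIsometric (tensorForm β) (tensorForm β) (gaugeRep 𝕜 g) :=
    isPartiallyIsometric_of_isometric (hinj h1) (tensorForm_tmap (form_conj β_symm β_adjoint hg))
  have hi' : IsPartiallyIsometric (tensorForm β) (tensorForm β) (gaugeRep 𝕜 g⁻¹) :=
    isPartiallyIsometric_of_isometric (hinj h2)
      (tensorForm_tmap (form_conj β_symm β_adjoint (inv_mem hg)))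
  have hs : gaugeRep 𝕜 g ∘ₗ curvedDG E x.γ ∘ₗ gaugeRep 𝕜 g⁻¹ = curvedDG E y.γ := by
    have h3 := gaugeRep_comp_curvedDG h0 h0' E x.γ (hΓ _ x.mem)
    rw [show gaugeAct E g x.γ = y.γ from hf] at h3
    rw [← LinearMap.comp_assoc, h3, LinearMap.comp_assoc, h2, LinearMap.comp_id]
  exact
    { degree_φ := hd
      degree_ψ := hd'
      coalgebraMap_φ := hc g
      coalgebraMap_ψ := hc g⁻¹
      unit_φ := hu g
      unit_ψ := hu g⁻¹
      partiallyIsometric_φ := hi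
      partiallyIsometric_ψ := hi'
      structures := by
        rintro _ rfl
        exact hs }

theorem isAlgebraicGaugeTheory_gaugeTheoryA (β_symm : ∀ a b, β a b = β b a)
    (β_nondegenerate : ∀ a, (∀ b, β a b = 0) → a = 0)
    (β_graded : ∀ m n : ℤ, m ≠ n → ∀ a ∈ 𝒜 m, ∀ b ∈ 𝒜 n, β a b = 0)
    (β_adjoint : ∀ g ∈ G, ∀ a b, β (g * a) b = β a (b * g)) (hΓ : ∀ γ ∈ Γ, γ ∈ 𝒜 1) :
    IsAlgebraicGaugeTheory (gaugeTheoryA E β G hG Γ) where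
  isObject x :=
    have hform : IsGradedInnerProduct 𝒜 (tensorForm β) :=
      isGradedInnerProduct_tensorForm β_symm β_nondegenerate β_graded
    have hD : IsCurvedAInfinity 𝒜 (curvedDG E x.γ) := isCurvedAInfinity_curvedDG E (hΓ _ x.mem)
    { form := hform
      structures := by
        rintro _ rfl
        exact hD }
  isMorphism := isMorphism_gaugeTheoryA hG β_symm β_adjoint hΓ
  map_id x := by
    have h : gaugeRep 𝕜 (1 : Aˣ) = LinearMap.id := gaugeRep_one
    have h' : gaugeRep 𝕜 (1 : Aˣ)⁻¹ = LinearMap.id := by rw [inv_one, h]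
    exact GradedTriple.Hom.ext h h'
  map_comp {x y z} f g := by
    obtain ⟨⟨f, _⟩, _⟩ := f
    obtain ⟨⟨g, _⟩, _⟩ := g
    have h : gaugeRep 𝕜 (g * f) = gaugeRep 𝕜 g ∘ₗ gaugeRep 𝕜 f := (gaugeRep_comp _ _).symm
    have h' : gaugeRep 𝕜 (g * f)⁻¹ = gaugeRep 𝕜 f⁻¹ ∘ₗ gaugeRep 𝕜 g⁻¹ := by
      rw [gaugeRep_comp, mul_inv_rev]
    exact GradedTriple.Hom.ext h h'

variable (c : SpecialContraction E.toDifferential dB)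

theorem isGradedInnerProduct_transferForm (β_symm : ∀ a b, β a b = β b a)
    (β_graded : ∀ m n : ℤ, m ≠ n → ∀ a ∈ 𝒜 m, ∀ b ∈ 𝒜 n, β a b = 0) {γ : A} (hγ : γ ∈ 𝒜 1)
    (h : IsTransferable c γ) (hform : ∀ x, (∀ y, transferForm c β γ x y = 0) → x = 0) :
    IsGradedInnerProduct ℬ (transferForm c β γ) where
  symm _ _ := tensorForm_symm β_symm _ _
  nondegenerate := hform
  graded m n hmn x hx y hy := by
    have hI := hasDegree_transferI c hγ h
    have hx' := hI m x hx
    have hy' := hI n y hy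
    rw [add_zero] at hx' hy'
    exact tensorForm_graded β_graded m n hmn _ hx' _ hy'

theorem transferForm_apply (γ : A) (x y : TensorAlgebra 𝕜 B) :
    transferForm c β γ x y = tensorForm β (transferI c γ x) (transferI c γ y) :=
  rfl

variable [DirectSum.Decomposition ℬ]

attribute [local irreducible] transferRep transferP transferI transferD transferForm

theorem isMorphism_gaugeTheoryB (β_symm : ∀ a b, β a b = β b a)
    (β_adjoint : ∀ g ∈ G, ∀ a b, β (g * a) b = β a (b * g)) (hΓ : ∀ γ ∈ Γ, γ ∈ 𝒜 1)
    (hΓ_transfer : ∀ γ ∈ Γ, IsTransferable c γ)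
    (hH : ∀ g ∈ G, ∀ a, c.H (conj 𝕜 g a) = conj 𝕜 g (c.H a))
    {x y : GaugeGroupoid E G hG Γ} (f : x ⟶ y) :
    GradedTriple.IsMorphism ((gaugeTheoryB c β G hG Γ).map f) := by
  -- The second map of the pair transfers g⁻¹, so the relation g⁻¹ · γ' = γ is needed as well.
  have hf' := (Groupoid.inv f).2
  obtain ⟨⟨g, hg⟩, hf⟩ := f
  change gaugeAct E g⁻¹ y.γ = x.γ at hf'
  change gaugeAct E g x.γ = y.γ at hf
  have h0 := hG g hg
  have h0' := hG g⁻¹ (inv_mem hg)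
  have h0'' : ((g⁻¹⁻¹ : Aˣ) : A) ∈ 𝒜 0 := by rwa [inv_inv]
  have hx := hΓ _ x.mem
  have hy := hΓ _ y.mem
  have tx := hΓ_transfer _ x.mem
  have ty := hΓ_transfer _ y.mem
  have h1 : transferRep c y.γ x.γ g⁻¹ ∘ₗ transferRep c x.γ y.γ g = LinearMap.id := by
    rw [transferRep_comp_transferRep c hx hy tx ty h0 h0' hf (hH g hg), inv_mul_cancel,
      transferRep_one c hx tx]
  have h2 : transferRep c x.γ y.γ g ∘ₗ transferRep c y.γ x.γ g⁻¹ = LinearMap.id := by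
    rw [transferRep_comp_transferRep c hy hx ty tx h0' h0'' hf' (hH _ (inv_mem hg)),
      mul_inv_cancel, transferRep_one c hy ty]
  have c1 := isCoalgebraMap_transferRep c hx hy tx ty (g := g)
  have c2 := isCoalgebraMap_transferRep c hy hx ty tx (g := g⁻¹)
  have hinj : ∀ {F F' : Module.End 𝕜 (TensorAlgebra 𝕜 B)}, F' ∘ₗ F = LinearMap.id →
      Function.Injective F := fun h => Function.LeftInverse.injective (LinearMap.congr_fun h)
  have d1 : HasDegree ℬ ℬ 0 (transferRep c x.γ y.γ g) :=
    hasDegree_transferRep c hx hy tx ty h0 h0'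
  have d2 : HasDegree ℬ ℬ 0 (transferRep c y.γ x.γ g⁻¹) :=
    hasDegree_transferRep c hy hx ty tx h0' h0''
  have u1 : transferRep c x.γ y.γ g 1 = 1 := groupLike_image c1
  have u2 : transferRep c y.γ x.γ g⁻¹ 1 = 1 := groupLike_image c2
  have i1 : IsPartiallyIsometric (transferForm c β x.γ) (transferForm c β y.γ)
      (transferRep c x.γ y.γ g) :=
    isPartiallyIsometric_of_isometric (hinj h1)
      (transferForm_transferRep c hx hy tx ty h0 h0' hf (hH g hg)
        (form_conj β_symm β_adjoint hg))
  have i2 : IsPartiallyIsometric (transferForm c β y.γ) (transferForm c β x.γ)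
      (transferRep c y.γ x.γ g⁻¹) :=
    isPartiallyIsometric_of_isometric (hinj h2)
      (transferForm_transferRep c hy hx ty tx h0' h0'' hf' (hH _ (inv_mem hg))
        (form_conj β_symm β_adjoint (inv_mem hg)))
  have hs : transferRep c x.γ y.γ g ∘ₗ transferD c x.γ ∘ₗ transferRep c y.γ x.γ g⁻¹ =
      transferD c y.γ :=
    transferRep_comp_transferD_comp_transferRep c hx hy tx ty h0 h0' hf (hH g hg)
  exact
    { degree_φ := d1
      degree_ψ := d2
      coalgebraMap_φ := c1
      coalgebraMap_ψ := c2
      unit_φ := u1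
      unit_ψ := u2
      partiallyIsometric_φ := i1
      partiallyIsometric_ψ := i2
      structures := by
        rintro _ rfl
        exact hs }

theorem isAlgebraicGaugeTheory_gaugeTheoryB (β_symm : ∀ a b, β a b = β b a)
    (β_graded : ∀ m n : ℤ, m ≠ n → ∀ a ∈ 𝒜 m, ∀ b ∈ 𝒜 n, β a b = 0)
    (β_adjoint : ∀ g ∈ G, ∀ a b, β (g * a) b = β a (b * g)) (hΓ : ∀ γ ∈ Γ, γ ∈ 𝒜 1)
    (hΓ_transfer : ∀ γ ∈ Γ, IsTransferable c γ)
    (hΓ_form : ∀ γ ∈ Γ, ∀ x, (∀ y, transferForm c β γ x y = 0) → x = 0)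
    (hH : ∀ g ∈ G, ∀ a, c.H (conj 𝕜 g a) = conj 𝕜 g (c.H a)) :
    IsAlgebraicGaugeTheory (gaugeTheoryB c β G hG Γ) where
  isObject x :=
    { form := isGradedInnerProduct_transferForm c β_symm β_graded (hΓ _ x.mem)
        (hΓ_transfer _ x.mem) (hΓ_form _ x.mem)
      structures := by
        rintro _ rfl
        exact isCurvedAInfinity_transferD c (hΓ _ x.mem) (hΓ_transfer _ x.mem) }
  isMorphism := isMorphism_gaugeTheoryB hG c β_symm β_adjoint hΓ hΓ_transfer hH
  map_id x := by
    have h := transferRep_one c (hΓ _ x.mem) (hΓ_transfer _ x.mem)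
    have h' : transferRep c x.γ x.γ (1 : Aˣ)⁻¹ = LinearMap.id := by rw [inv_one, h]
    exact GradedTriple.Hom.ext h h'
  map_comp {x y z} f g := by
    have hf := (Groupoid.inv f).2
    have hg := (Groupoid.inv g).2
    obtain ⟨⟨f, hf₀⟩, hf₁⟩ := f
    obtain ⟨⟨g, hg₀⟩, hg₁⟩ := g
    change gaugeAct E g⁻¹ z.γ = y.γ at hg
    change gaugeAct E f x.γ = y.γ at hf₁
    have h : transferRep c x.γ z.γ (g * f) = transferRep c y.γ z.γ g ∘ₗ transferRep c x.γ y.γ f :=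
      (transferRep_comp_transferRep c (hΓ _ x.mem) (hΓ _ y.mem) (hΓ_transfer _ x.mem)
        (hΓ_transfer _ y.mem) (hG _ hf₀) (hG _ (inv_mem hf₀)) hf₁ (hH f hf₀)).symm
    have h' : transferRep c z.γ x.γ (g * f)⁻¹ =
        transferRep c y.γ x.γ f⁻¹ ∘ₗ transferRep c z.γ y.γ g⁻¹ := by
      rw [transferRep_comp_transferRep c (hΓ _ z.mem) (hΓ _ y.mem) (hΓ_transfer _ z.mem)
        (hΓ_transfer _ y.mem) (hG _ (inv_mem hg₀)) (by simpa using hG _ hg₀) hg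
        (hH _ (inv_mem hg₀)), mul_inv_rev]
    exact GradedTriple.Hom.ext h h'

theorem isMorphism_transferPair (hΓ : ∀ γ ∈ Γ, γ ∈ 𝒜 1)
    (hΓ_transfer : ∀ γ ∈ Γ, IsTransferable c γ) (x : GaugeGroupoid E G hG Γ) :
    GradedTriple.IsMorphism (transferPair c β G hG Γ x) := by
  have hx := hΓ _ x.mem
  have tx := hΓ_transfer _ x.mem
  have hPI := transferP_comp_transferI c hx tx
  have hinj : Function.Injective (transferI c x.γ) :=
    Function.LeftInverse.injective (g := transferP c x.γ) (LinearMap.congr_fun hPI)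
  have d1 : HasDegree 𝒜 ℬ 0 (transferP c x.γ) := hasDegree_transferP c hx tx
  have d2 : HasDegree ℬ 𝒜 0 (transferI c x.γ) := hasDegree_transferI c hx tx
  have c1 := isCoalgebraMap_transferP c hx tx
  have c2 := isCoalgebraMap_transferI c hx tx
  have u1 : transferP c x.γ 1 = 1 := groupLike_image c1
  have u2 : transferI c x.γ 1 = 1 := groupLike_image c2
  have i1 : IsPartiallyIsometric (tensorForm β) (transferForm c β x.γ) (transferP c x.γ) :=
    isPartiallyIsometric_of_rightInverse hPI fun _ _ => (transferForm_apply c x.γ _ _).symm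
  have i2 : IsPartiallyIsometric (transferForm c β x.γ) (tensorForm β) (transferI c x.γ) :=
    isPartiallyIsometric_of_isometric hinj fun _ _ => (transferForm_apply c x.γ _ _).symm
  have hs : transferP c x.γ ∘ₗ curvedDG E x.γ ∘ₗ transferI c x.γ = transferD c x.γ :=
    transferP_comp_curvedDG_comp_transferI c hx tx
  exact
    { degree_φ := d1
      degree_ψ := d2
      coalgebraMap_φ := c1
      coalgebraMap_ψ := c2
      unit_φ := u1
      unit_ψ := u2
      partiallyIsometric_φ := i1
      partiallyIsometric_ψ := i2
      structures := by
        rintro _ rfl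
        exact hs }

theorem transferPair_naturality (hΓ : ∀ γ ∈ Γ, γ ∈ 𝒜 1)
    (hΓ_transfer : ∀ γ ∈ Γ, IsTransferable c γ)
    (hH : ∀ g ∈ G, ∀ a, c.H (conj 𝕜 g a) = conj 𝕜 g (c.H a))
    {x y : GaugeGroupoid E G hG Γ} (f : x ⟶ y) :
    (gaugeTheoryA E β G hG Γ).map f ≫ transferPair c β G hG Γ y =
      transferPair c β G hG Γ x ≫ (gaugeTheoryB c β G hG Γ).map f := by
  have hf' := (Groupoid.inv f).2
  obtain ⟨⟨g, hg⟩, hf⟩ := f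
  change gaugeAct E g⁻¹ y.γ = x.γ at hf'
  change gaugeAct E g x.γ = y.γ at hf
  have h0 := hG g hg
  have h0' := hG g⁻¹ (inv_mem hg)
  have h0'' : ((g⁻¹⁻¹ : Aˣ) : A) ∈ 𝒜 0 := by rwa [inv_inv]
  have hx := hΓ _ x.mem
  have hy := hΓ _ y.mem
  have tx := hΓ_transfer _ x.mem
  have ty := hΓ_transfer _ y.mem
  have h : transferP c y.γ ∘ₗ gaugeRep 𝕜 g = transferRep c x.γ y.γ g ∘ₗ transferP c x.γ :=
    (transferRep_comp_transferP c hx hy tx ty h0 h0' hf (hH g hg)).symm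
  have h' : gaugeRep 𝕜 g⁻¹ ∘ₗ transferI c y.γ = transferI c x.γ ∘ₗ transferRep c y.γ x.γ g⁻¹ :=
    (transferI_comp_transferRep c hy hx ty tx h0' h0'' hf' (hH _ (inv_mem hg))).symm
  exact GradedTriple.Hom.ext h h'

end Theories

end AlgGauge

end

theorem theorem5p2 {𝕜 : Type u} [Field 𝕜] [CharZero 𝕜]
    {A : Type v} [Ring A] [Algebra 𝕜 A] (𝒜 : ℤ → Submodule 𝕜 A) [GradedAlgebra 𝒜]
    (E : AlgGauge.DGDifferential 𝒜)
    {B : Type v} [AddCommGroup B] [Module 𝕜 B] (ℬ : ℤ → Submodule 𝕜 B)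
    [DirectSum.Decomposition ℬ] (dB : AlgGauge.Differential ℬ)
    (c : AlgGauge.SpecialContraction E.toDifferential dB)
    (G : Subgroup Aˣ) (hG : ∀ g ∈ G, (g : A) ∈ 𝒜 0)
    (β : A →ₗ[𝕜] A →ₗ[𝕜] 𝕜)
    (β_symm : ∀ a b, β a b = β b a)
    (β_nondegenerate : ∀ a, (∀ b, β a b = 0) → a = 0)
    (β_graded : ∀ m n : ℤ, m ≠ n → ∀ a ∈ 𝒜 m, ∀ b ∈ 𝒜 n, β a b = 0)
    (β_adjoint : ∀ g ∈ G, ∀ a b, β (g * a) b = β a (b * g))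
    (Γ : Set A) (hΓ : ∀ γ ∈ Γ, γ ∈ 𝒜 1)
    (hΓ_transfer : ∀ γ ∈ Γ, AlgGauge.IsTransferable c γ)
    (hΓ_form : ∀ γ ∈ Γ, ∀ x,
      (∀ y, AlgGauge.transferForm c β γ x y = 0) → x = 0)
    (hH : ∀ g ∈ G, ∀ a, c.H (AlgGauge.conj 𝕜 g a) = AlgGauge.conj 𝕜 g (c.H a)) :
    ∃ (hFA : AlgGauge.IsAlgebraicGaugeTheory (AlgGauge.gaugeTheoryA E β G hG Γ))
      (hFB : AlgGauge.IsAlgebraicGaugeTheory (AlgGauge.gaugeTheoryB c β G hG Γ))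
      (η : hFA.functor ⟶ hFB.functor),
      ∀ x : AlgGauge.GaugeGroupoid E G hG Γ,
        η.app x = AlgGauge.transferPair c β G hG Γ x ∧
          AlgGauge.GradedTriple.IsMorphism (η.app x) := by
  let hFA := AlgGauge.isAlgebraicGaugeTheory_gaugeTheoryA (E := E) hG β_symm β_nondegenerate
    β_graded β_adjoint hΓ
  let hFB := AlgGauge.isAlgebraicGaugeTheory_gaugeTheoryB hG c β_symm β_graded β_adjoint hΓ
    hΓ_transfer hΓ_form hH
  exact ⟨hFA, hFB,
    { app := fun x => AlgGauge.transferPair c β G hG Γ x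
      naturality := fun _ _ f => AlgGauge.transferPair_naturality hG c hΓ hΓ_transfer hH f },
    fun x => ⟨rfl, AlgGauge.isMorphism_transferPair hG c hΓ hΓ_transfer x⟩⟩
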